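/- **Conventions.** All C*-algebras and \*-homomorphisms are unital, and $\otimes$ is the minimal (spatial) tensor product. A *compact quantum group* (CQG) is a pair $(Q,\Delta)$ of a C*-algebra $Q$ and a \*-homomorphism $\Delta:Q\to Q\otimes Q$ with $(\Delta\otimes\mathrm{id})\Delta=(\mathrm{id}\otimes\Delta)\Delta$ such that the linear spans of $\Delta(Q)(1\otimes Q)$ and of $\Delta(Q)(Q\otimes 1)$ are dense in $Q\otimes Q$. A CQG morphism $\phi:(Q_1,\Delta_1)\to(Q_2,\Delta_2)$ is a \*-homomorphism with $(\phi\otimes\phi)\Delta_1=\Delta_2\phi$; it is an isomorphism if it is bijective. A *quantum transformation group* of a C*-algebra $\mathcal C$ is a CQG $(Q,\Delta)$ with a faithful action on $\mathcal C$, that is, a \*-homomorphism $\alpha:\mathcal C\to\mathcal C\otimes Q$ such that $(\alpha\otimes\mathrm{id})\alpha=(\mathrm{id}\otimes\Delta)\alpha$, the linear span of $\alpha(\mathcal C)(1\otimes Q)$ is dense in $\mathcal C\otimes Q$, and the \*-algebra generated by $\{(\theta\otimes\mathrm{id})\alpha(c):\theta\in\mathcal C^*,\,c\in\mathcal C\}$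 is dense in $Q$. **Graphs.** Let $\Gamma$ be a finite directed graph with vertex set $V$, edge set $E$, and source and range maps $s,r:E\to V$. It is *connected* if every vertex is the source or the range of some edge. A *path of length $m$* is a sequence of edges $e_1\cdots e_m$ with $r(e_i)=s(e_{i+1})$ (a path of length $0$ is a single vertex). It is a *cycle* if $m\ge1$, $r(e_m)=s(e_1)$ and the vertices $s(e_1),\dots,s(e_m)$ are pairwise distinct. $\Gamma$ has *property (R)* if - (R1) $\Gamma$ has no cycle of length $\ge 2$; - (R2) there is a path of length $|V|-1$ that passes through all vertices (so $V\neq\emptyset$); - (R3) for any two, possibly equal, vertices $v,w$ there is at most one edge from $v$ to $w$. **The graph C\*-algebra and the category.** $C^*(\Gamma)$ is the universal C*-algebra generated by partial isometries $S_e$ ($e\in E$) and mutually orthogonal projections $p_v$ ($v\in V$) with $S_e^*S_e=p_{r(e)}$ for all $e$ and $p_v=\sum_{s(f)=v}S_fS_f^*$ for every $v$ that is the source of at least one edge; its unit is $\sum_v p_v$. Let $$\mathcal V_{2,+}=\operatorname{span}\bigl(\{p_u: u\in V\text{ is not the source of any edge}\}\cup\{S_eS_f^*: e,f\in E,\ r(e)=r(f)\}\bigr)\subseteq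 C^*(\Gamma).$$ The displayed spanning set is linearly independent, and $\tau$ denotes the linear functional on $\mathcal V_{2,+}$ with $\tau(p_u)=1$ and $\tau(S_eS_f^*)=\delta_{ef}$. The objects of the category $\mathfrak C_\tau^{Lin}$ are the quantum transformation groups $((Q,\Delta),\alpha)$ of $C^*(\Gamma)$ that are *linear*, i.e. there are $q_{fe}\in Q$ with $\alpha(S_e)=\sum_{f\in E}S_f\otimes q_{fe}$ for all $e\in E$, and *preserve $\tau$*, i.e. $(\tau\otimes\mathrm{id})\alpha(x)=\tau(x)1$ for all $x\in\mathcal V_{2,+}$ (here $\alpha(\mathcal V_{2,+})$ lies in the algebraic tensor product of $\mathcal V_{2,+}$ and $Q$). A *universal object* of $\mathfrak C_\tau^{Lin}$ is an object $((\widehat Q,\widehat\Delta),\widehat\alpha)$ such that for every object $((B,\Delta_B),\beta)$ there is a surjective CQG morphism $\phi:\widehat Q\to B$ with $(\mathrm{id}\otimes\phi)\widehat\alpha=\beta$; its underlying CQG is denoted by $Q_\tau^{Lin}$. **Theorem.** Let $\Gamma$ be a finite, connected, directed graph with property (R). Then $\mathfrak C_\tau^{Lin}$ has a universal object, and the underlying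 CQG $Q_\tau^{Lin}$ of any universal object is isomorphic, as a compact quantum group, to $$\bigl(\underbrace{C(S^1)*\cdots*C(S^1)}_{|E|\text{ times}},\ \Delta_*\bigr),$$ the free product of $|E|$ copies of $C(S^1)$, that is, the universal C*-algebra generated by unitaries $z_e$ ($e\in E$), with $\Delta_*(z_e)=z_e\otimes z_e$. -/

import Mathlib

set_option linter.unusedSectionVars false

universe u

noncomputable section

open scoped TensorProduct
open UniformSpace (Completion)

/-! ### Completing a complex `*`-algebra in a C*-seminorm -/

/-- A C*-seminorm on a unital complex `*`-algebra. -/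
structure CStarSeminorm (F : Type*) [Ring F] [Algebra ℂ F] [StarRing F] where
  toSeminorm : Seminorm ℂ F
  mul_le : ∀ x y, toSeminorm (x * y) ≤ toSeminorm x * toSeminorm y
  star_mul_self : ∀ x, toSeminorm (star x * x) = toSeminorm x ^ 2

namespace CStarSeminorm

section Basic

variable {F : Type*} [Ring F] [Algebra ℂ F] [StarRing F]

instance : CoeFun (CStarSeminorm F) (fun _ => F → ℝ) := ⟨fun p => p.toSeminorm⟩

theorem apply_star (p : CStarSeminorm F) (x : F) : p (star x) = p x := by
  have key : ∀ y, p y ≤ p (star y) := by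
    intro y
    have h1 := p.star_mul_self y
    have h2 := p.mul_le (star y) y
    have h3 : 0 ≤ p y := apply_nonneg _ _
    have h4 : 0 ≤ p (star y) := apply_nonneg _ _
    rcases h3.eq_or_lt with h | h
    · rw [← h]; exact h4
    · have : p y * p y ≤ p (star y) * p y := by nlinarith
      exact le_of_mul_le_mul_right this h
  apply le_antisymm
  · simpa using key (star x)
  · exact key x

theorem apply_one_le (p : CStarSeminorm F) : p 1 ≤ 1 := by
  have h1 := p.star_mul_self 1
  simp only [star_one, mul_one] at h1
  have h3 : 0 ≤ p 1 := apply_nonneg _ _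
  nlinarith

/-- The C*-seminorm `x ↦ ‖φ x‖` of a `*`-homomorphism into a C*-algebra. -/
noncomputable def ofHom {D : Type*} [CStarAlgebra D] (φ : F →⋆ₐ[ℂ] D) : CStarSeminorm F where
  toSeminorm := (normSeminorm ℂ D).comp φ.toAlgHom.toLinearMap
  mul_le x y := by simpa using norm_mul_le (φ x) (φ y)
  star_mul_self x := by
    change ‖φ (star x * x)‖ = ‖φ x‖ ^ 2
    rw [map_mul, map_star, CStarRing.norm_star_mul_self, sq]

@[simp] theorem ofHom_apply {D : Type*} [CStarAlgebra D] (φ : F →⋆ₐ[ℂ] D) (x : F) :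
    ofHom φ x = ‖φ x‖ := rfl

/-- The supremum of a pointwise bounded set of C*-seminorms is a C*-seminorm
(it is `0` for the empty set). -/
noncomputable def sup (S : Set (CStarSeminorm F))
    (hS : ∀ x, BddAbove (Set.range fun p : S => p.1 x)) : CStarSeminorm F where
  toSeminorm :=
    { toFun := fun x => ⨆ p : S, p.1 x
      map_zero' := by simp
      add_le' := fun x y => by
        refine Real.iSup_le (fun p => ?_) (add_nonneg
          (Real.iSup_nonneg fun p => apply_nonneg _ _) (Real.iSup_nonneg fun p => apply_nonneg _ _))
        exact (map_add_le_add _ _ _).trans (add_le_add (le_ciSup (hS x) p) (le_ciSup (hS y) p))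
      neg' := fun x => by simp
      smul' := fun a x => by
        simp only [map_smul_eq_mul]
        rw [Real.mul_iSup_of_nonneg (norm_nonneg _)] }
  mul_le x y := by
    refine Real.iSup_le (fun p => ?_) (mul_nonneg
      (Real.iSup_nonneg fun p => apply_nonneg _ _) (Real.iSup_nonneg fun p => apply_nonneg _ _))
    exact (p.1.mul_le x y).trans (mul_le_mul (le_ciSup (hS x) p) (le_ciSup (hS y) p)
      (apply_nonneg _ _) (Real.iSup_nonneg fun p => apply_nonneg _ _))
  star_mul_self x := by
    have h0 : 0 ≤ ⨆ p : S, p.1 x := Real.iSup_nonneg fun p => apply_nonneg _ _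
    apply le_antisymm
    · refine Real.iSup_le (fun p => ?_) (by positivity)
      rw [p.1.star_mul_self]
      exact pow_le_pow_left₀ (apply_nonneg _ _) (le_ciSup (hS x) p) 2
    · have h1 : 0 ≤ ⨆ p : S, p.1 (star x * x) := Real.iSup_nonneg fun p => apply_nonneg _ _
      change (⨆ p : S, p.1 x) ^ 2 ≤ ⨆ p : S, p.1 (star x * x)
      rw [← Real.sqrt_le_sqrt_iff h1, Real.sqrt_sq h0]
      refine Real.iSup_le (fun p => ?_) (Real.sqrt_nonneg _)
      apply Real.le_sqrt_of_sq_le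
      rw [← p.1.star_mul_self]
      exact le_ciSup (hS (star x * x)) p

theorem le_sup {S : Set (CStarSeminorm F)}
    (hS : ∀ x, BddAbove (Set.range fun p : S => p.1 x)) {p : CStarSeminorm F} (hp : p ∈ S) (x : F) :
    p x ≤ sup S hS x :=
  le_ciSup (hS x) ⟨p, hp⟩

theorem sup_le {S : Set (CStarSeminorm F)}
    (hS : ∀ x, BddAbove (Set.range fun p : S => p.1 x)) {x : F} {a : ℝ} (ha : 0 ≤ a)
    (h : ∀ p ∈ S, p x ≤ a) : sup S hS x ≤ a :=
  Real.iSup_le (fun p => h p.1 p.2) ha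

end Basic

section Completion

variable {F : Type*} [Ring F] [Algebra ℂ F] [StarRing F] [StarModule ℂ F]

/-- A copy of `F`, topologized by the C*-seminorm `p`. -/
def Pre (_p : CStarSeminorm F) : Type _ := F

variable (p : CStarSeminorm F)

instance : Ring p.Pre := inferInstanceAs (Ring F)
instance : Algebra ℂ p.Pre := inferInstanceAs (Algebra ℂ F)
instance : StarRing p.Pre := inferInstanceAs (StarRing F)
instance : StarModule ℂ p.Pre := inferInstanceAs (StarModule ℂ F)

/-- The identity of `F`, as a map into its copy. -/
def toPre : F →⋆ₐ[ℂ] p.Pre := StarAlgHom.id ℂ F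

noncomputable instance : SeminormedRing p.Pre :=
  { (inferInstance : Ring p.Pre),
    (p.toSeminorm.toAddGroupSeminorm.toSeminormedAddCommGroup : SeminormedAddCommGroup F) with
    norm_mul_le := fun x y => p.mul_le x y }

noncomputable instance : NormedAlgebra ℂ p.Pre :=
  { (inferInstance : Algebra ℂ p.Pre) with
    norm_smul_le := fun a x => (map_smul_eq_mul p.toSeminorm a x).le }

theorem norm_toPre (x : F) : ‖p.toPre x‖ = p x := rfl

theorem norm_star_pre (x : p.Pre) : ‖star x‖ = ‖x‖ := p.apply_star x

theorem norm_star_mul_self_pre (x : p.Pre) : ‖star x * x‖ = ‖x‖ ^ 2 := p.star_mul_self x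

/-- The C*-algebra obtained from `F` by dividing out the null space of `p` and completing. -/
def CStarCompletion : Type _ := Completion p.Pre

noncomputable instance : NormedRing p.CStarCompletion :=
  inferInstanceAs (NormedRing (Completion p.Pre))

noncomputable instance : CompleteSpace p.CStarCompletion :=
  inferInstanceAs (CompleteSpace (Completion p.Pre))

noncomputable instance : NormedAlgebra ℂ p.CStarCompletion :=
  { (inferInstance : Algebra ℂ (Completion p.Pre)) with
    norm_smul_le := fun a x => norm_smul_le (β := Completion p.Pre) a x }

/-- The dense copy of `p.Pre` in its completion. -/
noncomputable def coeC (x : p.Pre) : p.CStarCompletion := (x : Completion p.Pre)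

theorem coeC_mul (x y : p.Pre) : p.coeC (x * y) = p.coeC x * p.coeC y :=
  Completion.coe_mul x y
theorem coeC_add (x y : p.Pre) : p.coeC (x + y) = p.coeC x + p.coeC y :=
  Completion.coe_add x y
theorem coeC_smul (a : ℂ) (x : p.Pre) : p.coeC (a • x) = a • p.coeC x :=
  Completion.coe_smul a x
theorem norm_coeC (x : p.Pre) : ‖p.coeC x‖ = ‖x‖ := Completion.norm_coe x
theorem continuous_coeC : Continuous p.coeC := Completion.continuous_coe _
theorem denseRange_coeC : DenseRange p.coeC := Completion.denseRange_coe

theorem uniformContinuous_star_pre : UniformContinuous (star : p.Pre → p.Pre) := by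
  refine (AddMonoidHomClass.isometry_of_norm (starAddEquiv (R := p.Pre)) ?_).uniformContinuous
  exact p.norm_star_pre

noncomputable instance : Star p.CStarCompletion :=
  ⟨(Completion.map (star : p.Pre → p.Pre) : Completion p.Pre → Completion p.Pre)⟩

theorem star_coeC (x : p.Pre) : star (p.coeC x) = p.coeC (star x) :=
  Completion.map_coe p.uniformContinuous_star_pre x

theorem continuous_star_completion :
    Continuous (star : p.CStarCompletion → p.CStarCompletion) :=
  Completion.continuous_map

noncomputable instance : StarRing p.CStarCompletion where
  star_involutive x := by
    have hc := p.continuous_star_completion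
    refine p.denseRange_coeC.induction_on x
      (isClosed_eq (hc.comp hc) continuous_id) (fun a => ?_)
    simp [star_coeC]
  star_mul x y := by
    have hc := p.continuous_star_completion
    refine p.denseRange_coeC.induction_on₂
      (isClosed_eq (hc.comp (continuous_fst.mul continuous_snd))
        ((hc.comp continuous_snd).mul (hc.comp continuous_fst))) (fun a b => ?_) x y
    simp only [← coeC_mul, star_coeC, star_mul]
  star_add x y := by
    have hc := p.continuous_star_completion
    refine p.denseRange_coeC.induction_on₂
      (isClosed_eq (hc.comp (continuous_fst.add continuous_snd))
        ((hc.comp continuous_fst).add (hc.comp continuous_snd))) (fun a b => ?_) x y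
    simp only [← coeC_add, star_coeC, star_add]

instance : StarModule ℂ p.CStarCompletion where
  star_smul a x := by
    have hc := p.continuous_star_completion
    refine p.denseRange_coeC.induction_on x
      (isClosed_eq (hc.comp (continuous_const_smul a)) ((continuous_const_smul (star a)).comp hc)) (fun b => ?_)
    simp only [← coeC_smul, star_coeC, star_smul]

instance : CStarRing p.CStarCompletion where
  norm_mul_self_le x := by
    have hc := p.continuous_star_completion
    refine p.denseRange_coeC.induction_on x
      (isClosed_le (by fun_prop) ((hc.mul continuous_id).norm)) (fun b => ?_)
    simp only [star_coeC, ← coeC_mul, norm_coeC, norm_star_mul_self_pre]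
    exact (sq _).ge

noncomputable instance : CStarAlgebra p.CStarCompletion where

/-- The canonical `*`-homomorphism with dense range from `F` to its C*-completion. -/
noncomputable def toCompletion : F →⋆ₐ[ℂ] p.CStarCompletion where
  toFun x := p.coeC (p.toPre x)
  map_one' := rfl
  map_mul' x y := p.coeC_mul x y
  map_zero' := rfl
  map_add' x y := p.coeC_add x y
  commutes' _ := rfl
  map_star' x := (p.star_coeC x).symm

theorem norm_toCompletion (x : F) : ‖p.toCompletion x‖ = p x := p.norm_coeC x

theorem denseRange_toCompletion : DenseRange p.toCompletion := p.denseRange_coeC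

section Lift

variable {D : Type*} [CStarAlgebra D] (φ : F →⋆ₐ[ℂ] D) (h : ∀ x, ‖φ x‖ ≤ p x)

/-- A `*`-homomorphism dominated by `p`, as a continuous linear map. -/
noncomputable def preCLM : p.Pre →L[ℂ] D :=
  LinearMap.mkContinuous (φ.toAlgHom.toLinearMap : p.Pre →ₗ[ℂ] D) 1
    (fun x => by rw [one_mul]; exact h x)

/-- A `*`-homomorphism into a C*-algebra dominated by `p` extends to the completion. -/
noncomputable def lift : p.CStarCompletion →⋆ₐ[ℂ] D :=
  have hcoe : ∀ x : p.Pre, (p.preCLM φ h).fromCompletion (p.coeC x) = φ x :=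
    fun x => ContinuousLinearMap.fromCompletion_apply_coe _ x
  have hc : Continuous fun x : p.CStarCompletion => (p.preCLM φ h).fromCompletion x :=
    (p.preCLM φ h).fromCompletion.continuous
  have hone : (p.preCLM φ h).fromCompletion (1 : p.CStarCompletion) = 1 :=
    (hcoe 1).trans (map_one φ)
  { toFun := fun x => (p.preCLM φ h).fromCompletion x
    map_one' := hone
    map_mul' := fun x y => by
      refine p.denseRange_coeC.induction_on₂
        (isClosed_eq (hc.comp (continuous_fst.mul continuous_snd))
          ((hc.comp continuous_fst).mul (hc.comp continuous_snd))) (fun a b => ?_) x y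
      rw [← coeC_mul, hcoe, hcoe, hcoe]
      exact map_mul φ _ _
    map_zero' := map_zero (p.preCLM φ h).fromCompletion
    map_add' := fun x y => map_add (p.preCLM φ h).fromCompletion x y
    commutes' := fun r => by
      rw [Algebra.algebraMap_eq_smul_one, Algebra.algebraMap_eq_smul_one, ← hone]
      exact map_smul (p.preCLM φ h).fromCompletion r _
    map_star' := fun x => by
      refine p.denseRange_coeC.induction_on x
        (isClosed_eq (hc.comp p.continuous_star_completion) hc.star) (fun a => ?_)
      rw [star_coeC, hcoe, hcoe]
      exact map_star φ _ }

@[simp] theorem lift_toCompletion (x : F) : p.lift φ h (p.toCompletion x) = φ x :=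
  ContinuousLinearMap.fromCompletion_apply_coe (p.preCLM φ h) x

end Lift

end Completion

end CStarSeminorm

/-! ### Universal C*-algebras given by generators and relations -/

/-- The free unital complex `*`-algebra on `X`: noncommutative polynomials in the letters
`x = inl x` and `x* = inr x`. -/
def FreeStarAlgebra (X : Type u) : Type u := FreeAlgebra ℂ (X ⊕ X)

namespace FreeStarAlgebra

variable {X : Type u}

instance : Ring (FreeStarAlgebra X) := inferInstanceAs (Ring (FreeAlgebra ℂ (X ⊕ X)))
instance : Algebra ℂ (FreeStarAlgebra X) := inferInstanceAs (Algebra ℂ (FreeAlgebra ℂ (X ⊕ X)))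

/-- A letter, as an element of the free `*`-algebra. -/
def letter (y : X ⊕ X) : FreeStarAlgebra X := FreeAlgebra.ι ℂ y

/-- A generator of the free `*`-algebra. -/
def gen (x : X) : FreeStarAlgebra X := letter (Sum.inl x)

/-- The algebra homomorphism sending the letters to prescribed elements. -/
def liftLetters {B : Type*} [Ring B] [Algebra ℂ B] (f : X ⊕ X → B) : FreeStarAlgebra X →ₐ[ℂ] B :=
  FreeAlgebra.lift ℂ f

@[simp] theorem liftLetters_letter {B : Type*} [Ring B] [Algebra ℂ B] (f : X ⊕ X → B) (y : X ⊕ X) :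
    liftLetters f (letter y) = f y :=
  FreeAlgebra.lift_ι_apply f y

@[elab_as_elim]
theorem induction_letters {motive : FreeStarAlgebra X → Prop}
    (scalar : ∀ r : ℂ, motive (algebraMap ℂ (FreeStarAlgebra X) r))
    (letters : ∀ y, motive (letter y))
    (mul : ∀ a b, motive a → motive b → motive (a * b))
    (add : ∀ a b, motive a → motive b → motive (a + b)) (a : FreeStarAlgebra X) : motive a :=
  FreeAlgebra.induction (R := ℂ) (X := X ⊕ X) (motive := motive) scalar letters mul add a

/-- The conjugate-linear antimultiplicative map exchanging `x` and `x*`. -/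
def starHom : FreeStarAlgebra X →+* (FreeStarAlgebra X)ᵐᵒᵖ :=
  letI : Algebra ℂ (FreeStarAlgebra X)ᵐᵒᵖ := Algebra.compHom _ (starRingEnd ℂ)
  (liftLetters fun y => MulOpposite.op (letter y.swap)).toRingHom

theorem starHom_letter (y : X ⊕ X) : starHom (letter y) = MulOpposite.op (letter y.swap) :=
  letI : Algebra ℂ (FreeStarAlgebra X)ᵐᵒᵖ := Algebra.compHom _ (starRingEnd ℂ)
  liftLetters_letter (fun y => MulOpposite.op (letter y.swap)) y

theorem starHom_algebraMap (r : ℂ) :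
    starHom (algebraMap ℂ (FreeStarAlgebra X) r) =
      MulOpposite.op (algebraMap ℂ (FreeStarAlgebra X) (star r)) :=
  letI : Algebra ℂ (FreeStarAlgebra X)ᵐᵒᵖ := Algebra.compHom _ (starRingEnd ℂ)
  (liftLetters fun y : X ⊕ X => MulOpposite.op (letter y.swap)).commutes r

instance : Star (FreeStarAlgebra X) := ⟨fun a => (starHom a).unop⟩

theorem star_letter (y : X ⊕ X) : star (letter y) = letter y.swap :=
  congrArg MulOpposite.unop (starHom_letter y)

theorem star_scalar (r : ℂ) :
    star (algebraMap ℂ (FreeStarAlgebra X) r) = algebraMap ℂ (FreeStarAlgebra X) (star r) :=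
  congrArg MulOpposite.unop (starHom_algebraMap r)

instance : StarRing (FreeStarAlgebra X) where
  star_mul a b := congrArg MulOpposite.unop (map_mul starHom a b)
  star_add a b := congrArg MulOpposite.unop (map_add starHom a b)
  star_involutive a := by
    have hm : ∀ a b : FreeStarAlgebra X, star (a * b) = star b * star a :=
      fun a b => congrArg MulOpposite.unop (map_mul starHom a b)
    have ha : ∀ a b : FreeStarAlgebra X, star (a + b) = star a + star b :=
      fun a b => congrArg MulOpposite.unop (map_add starHom a b)
    refine induction_letters (fun r => ?_) (fun y => ?_) (fun a b h1 h2 => ?_)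
      (fun a b h1 h2 => ?_) a
    · rw [star_scalar, star_scalar, star_star]
    · rw [star_letter, star_letter, Sum.swap_swap]
    · rw [hm, hm, h1, h2]
    · rw [ha, ha, h1, h2]

instance : StarModule ℂ (FreeStarAlgebra X) where
  star_smul r a := by
    rw [Algebra.smul_def, star_mul, star_scalar, Algebra.smul_def, Algebra.commutes]

/-- The `*`-homomorphism sending the generators to prescribed elements. -/
def lift {B : Type*} [Ring B] [Algebra ℂ B] [StarRing B] [StarModule ℂ B] (f : X → B) :
    FreeStarAlgebra X →⋆ₐ[ℂ] B :=
  { liftLetters (Sum.elim f fun x => star (f x)) with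
    map_star' := fun a => by
      change liftLetters (Sum.elim f fun x => star (f x)) (star a) =
        star (liftLetters (Sum.elim f fun x => star (f x)) a)
      refine induction_letters (fun r => ?_) (fun y => ?_) (fun a b h1 h2 => ?_)
        (fun a b h1 h2 => ?_) a
      · rw [star_scalar, AlgHom.commutes, AlgHom.commutes, algebraMap_star_comm]
      · rw [star_letter]
        cases y <;> simp
      · rw [star_mul, map_mul, h1, h2, map_mul, star_mul]
      · rw [star_add, map_add, h1, h2, map_add, star_add] }

@[simp] theorem lift_gen {B : Type*} [Ring B] [Algebra ℂ B] [StarRing B] [StarModule ℂ B]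
    (f : X → B) (x : X) : lift f (gen x) = f x :=
  liftLetters_letter _ (Sum.inl x)

end FreeStarAlgebra

/-- The C*-seminorms on the free `*`-algebra which are at most `1` on the generators and
vanish on the relators. -/
def admissibleSeminorms {X : Type u} (R : Set (FreeStarAlgebra X)) :
    Set (CStarSeminorm (FreeStarAlgebra X)) :=
  {p | (∀ x, p (FreeStarAlgebra.gen x) ≤ 1) ∧ ∀ r ∈ R, p r = 0}

theorem admissibleSeminorms_bddAbove {X : Type u} (R : Set (FreeStarAlgebra X))
    (a : FreeStarAlgebra X) :
    BddAbove (Set.range fun p : admissibleSeminorms R => p.1 a) := by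
  suffices h : ∃ C, ∀ p ∈ admissibleSeminorms R, p a ≤ C by
    obtain ⟨C, hC⟩ := h
    exact ⟨C, by rintro _ ⟨p, rfl⟩; exact hC p.1 p.2⟩
  refine FreeStarAlgebra.induction_letters (fun r => ?_) (fun y => ?_) ?_ ?_ a
  · refine ⟨‖r‖, fun p _ => ?_⟩
    rw [Algebra.algebraMap_eq_smul_one, map_smul_eq_mul]
    exact mul_le_of_le_one_right (norm_nonneg _) p.apply_one_le
  · refine ⟨1, fun p hp => ?_⟩
    cases y with
    | inl x => exact hp.1 x
    | inr x =>
      have h := p.apply_star (FreeStarAlgebra.gen x)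
      rw [FreeStarAlgebra.gen, FreeStarAlgebra.star_letter] at h
      exact h.trans_le (hp.1 x)
  · rintro a b ⟨C, hC⟩ ⟨D, hD⟩
    exact ⟨C * D, fun p hp => (p.mul_le a b).trans (mul_le_mul (hC p hp) (hD p hp)
      (apply_nonneg _ _) ((apply_nonneg _ _).trans (hC p hp)))⟩
  · rintro a b ⟨C, hC⟩ ⟨D, hD⟩
    exact ⟨C + D, fun p hp => (map_add_le_add _ a b).trans (add_le_add (hC p hp) (hD p hp))⟩

/-- The universal unital C*-algebra generated by contractions `x ∈ X` subject to the relations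
`r = 0`, `r ∈ R`. When the relations force the generators to be partial isometries, which is the
only case used below, the bound `1` on the generators is automatic. -/
def UniversalCStarAlgebra {X : Type u} (R : Set (FreeStarAlgebra X)) : Type u :=
  (CStarSeminorm.sup (admissibleSeminorms R) (admissibleSeminorms_bddAbove R)).CStarCompletion

namespace UniversalCStarAlgebra

variable {X : Type u} (R : Set (FreeStarAlgebra X))

instance : CStarAlgebra (UniversalCStarAlgebra R) := inferInstanceAs (CStarAlgebra
  (CStarSeminorm.sup (admissibleSeminorms R) (admissibleSeminorms_bddAbove R)).CStarCompletion)

/-- The canonical map from the free `*`-algebra. -/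
def mk : FreeStarAlgebra X →⋆ₐ[ℂ] UniversalCStarAlgebra R :=
  (CStarSeminorm.sup (admissibleSeminorms R) (admissibleSeminorms_bddAbove R)).toCompletion

/-- The images of the generators. -/
def of (x : X) : UniversalCStarAlgebra R := mk R (FreeStarAlgebra.gen x)

theorem denseRange_mk : DenseRange (mk R) := CStarSeminorm.denseRange_toCompletion _

theorem mk_eq_zero {r : FreeStarAlgebra X} (hr : r ∈ R) : mk R r = 0 := by
  rw [← norm_le_zero_iff]
  refine (CStarSeminorm.norm_toCompletion _ r).trans_le ?_
  exact CStarSeminorm.sup_le _ le_rfl (fun p hp => (hp.2 r hr).le)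

/-- The universal property: contractions in a C*-algebra satisfying the relations are
the images of the generators under a `*`-homomorphism. -/
def lift {B : Type*} [CStarAlgebra B] (f : X → B) (h1 : ∀ x, ‖f x‖ ≤ 1)
    (hR : ∀ r ∈ R, FreeStarAlgebra.lift f r = 0) : UniversalCStarAlgebra R →⋆ₐ[ℂ] B :=
  CStarSeminorm.lift _ (FreeStarAlgebra.lift f) (fun x =>
    CStarSeminorm.le_sup (admissibleSeminorms_bddAbove R)
      (p := CStarSeminorm.ofHom (FreeStarAlgebra.lift f))
      ⟨fun x => by simpa using h1 x, fun r hr => by simp [hR r hr]⟩ x)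

@[simp] theorem lift_of {B : Type*} [CStarAlgebra B] (f : X → B) (h1 : ∀ x, ‖f x‖ ≤ 1)
    (hR : ∀ r ∈ R, FreeStarAlgebra.lift f r = 0) (x : X) : lift R f h1 hR (of R x) = f x := by
  refine (CStarSeminorm.lift_toCompletion _ _ _ _).trans ?_
  simp

end UniversalCStarAlgebra

/-! ### The minimal tensor product -/

section HilbertTensor

variable {H K : Type u} [NormedAddCommGroup H] [InnerProductSpace ℂ H] [CompleteSpace H]
  [NormedAddCommGroup K] [InnerProductSpace ℂ K] [CompleteSpace K]

variable (H K) in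
/-- The Hilbert space tensor product: the completion of the algebraic tensor product for the
inner product `⟪u ⊗ v, u' ⊗ v'⟫ = ⟪u, u'⟫ ⟪v, v'⟫`. -/
def HilbertTensor : Type u := Completion (H ⊗[ℂ] K)

instance : NormedAddCommGroup (HilbertTensor H K) :=
  inferInstanceAs (NormedAddCommGroup (Completion (H ⊗[ℂ] K)))
instance : InnerProductSpace ℂ (HilbertTensor H K) :=
  inferInstanceAs (InnerProductSpace ℂ (Completion (H ⊗[ℂ] K)))
instance : CompleteSpace (HilbertTensor H K) :=
  inferInstanceAs (CompleteSpace (Completion (H ⊗[ℂ] K)))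

/-- The inclusion of the algebraic tensor product. -/
def toHilbertTensor : H ⊗[ℂ] K →ₗᵢ[ℂ] HilbertTensor H K :=
  { toFun := fun x => (x : Completion (H ⊗[ℂ] K))
    map_add' := Completion.coe_add
    map_smul' := Completion.coe_smul
    norm_map' := Completion.norm_coe }

theorem denseRange_toHilbertTensor : DenseRange (toHilbertTensor : H ⊗[ℂ] K → HilbertTensor H K) :=
  Completion.denseRange_coe

/-- The operator `S ⊗ T` on the Hilbert space tensor product of `H` and `K`. -/
def hilbertTensorOp (S : H →L[ℂ] H) (T : K →L[ℂ] K) :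
    HilbertTensor H K →L[ℂ] HilbertTensor H K :=
  ContinuousLinearMap.mk
    { toFun := fun x => (TensorProduct.mapL S T).completion x
      map_add' := map_add (TensorProduct.mapL S T).completion
      map_smul' := map_smul (TensorProduct.mapL S T).completion }
    (TensorProduct.mapL S T).completion.continuous

theorem hilbertTensorOp_coe (S : H →L[ℂ] H) (T : K →L[ℂ] K) (x : H ⊗[ℂ] K) :
    hilbertTensorOp S T (toHilbertTensor x) = toHilbertTensor (TensorProduct.mapL S T x) :=
  ContinuousLinearMap.completion_apply_coe _ x

theorem hilbert_ext {S T : HilbertTensor H K →L[ℂ] HilbertTensor H K}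
    (h : ∀ x : H ⊗[ℂ] K, S (toHilbertTensor x) = T (toHilbertTensor x)) : S = T := by
  ext x
  exact denseRange_toHilbertTensor.induction_on x (isClosed_eq S.continuous T.continuous) h

theorem norm_hilbertTensorOp_le (S : H →L[ℂ] H) (T : K →L[ℂ] K) :
    ‖hilbertTensorOp S T‖ ≤ ‖S‖ * ‖T‖ := by
  refine ContinuousLinearMap.opNorm_le_bound _ (by positivity) (fun x => ?_)
  refine denseRange_toHilbertTensor.induction_on x
    (isClosed_le (by fun_prop) (by fun_prop)) (fun a => ?_)
  rw [hilbertTensorOp_coe, LinearIsometry.norm_map, LinearIsometry.norm_map]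
  exact ((TensorProduct.mapL S T).le_opNorm a).trans
    (mul_le_mul_of_nonneg_right (TensorProduct.norm_mapL_le S T) (norm_nonneg _))

theorem hilbertTensorOp_mul (S S' : H →L[ℂ] H) (T T' : K →L[ℂ] K) :
    hilbertTensorOp (S * S') (T * T') = hilbertTensorOp S T * hilbertTensorOp S' T' := by
  refine hilbert_ext fun x => ?_
  rw [mul_apply_eq_comp, hilbertTensorOp_coe, hilbertTensorOp_coe,
    hilbertTensorOp_coe, TensorProduct.mapL_mul]
  rfl

theorem hilbertTensorOp_one : hilbertTensorOp (1 : H →L[ℂ] H) (1 : K →L[ℂ] K) = 1 := by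
  refine hilbert_ext fun x => ?_
  rw [hilbertTensorOp_coe]
  rw [show (1 : H →L[ℂ] H) = .id ℂ H from rfl, show (1 : K →L[ℂ] K) = .id ℂ K from rfl,
    TensorProduct.mapL_id_id]
  rfl

theorem hilbertTensorOp_star (S : H →L[ℂ] H) (T : K →L[ℂ] K) :
    hilbertTensorOp (star S) (star T) = star (hilbertTensorOp S T) := by
  rw [ContinuousLinearMap.star_eq_adjoint (hilbertTensorOp S T),
    ContinuousLinearMap.eq_adjoint_iff]
  intro x y
  refine denseRange_toHilbertTensor.induction_on₂ (isClosed_eq (by fun_prop) (by fun_prop))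
    (fun a b => ?_) x y
  rw [hilbertTensorOp_coe, hilbertTensorOp_coe, LinearIsometry.inner_map_map,
    LinearIsometry.inner_map_map]
  induction a with
  | zero => simp
  | add a a' h h' => rw [map_add, inner_add_left, h, h', inner_add_left]
  | tmul u v =>
    induction b with
    | zero => simp
    | add b b' h h' => rw [inner_add_right, h, h', map_add, inner_add_right]
    | tmul u' v' =>
      simp [ContinuousLinearMap.star_eq_adjoint, ContinuousLinearMap.adjoint_inner_left]

/-- `hilbertTensorOp` as a bilinear map. -/
def hilbertTensorBilin : (H →L[ℂ] H) →ₗ[ℂ] (K →L[ℂ] K) →ₗ[ℂ]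
    (HilbertTensor H K →L[ℂ] HilbertTensor H K) :=
  LinearMap.mk₂ ℂ hilbertTensorOp
    (fun S S' T => hilbert_ext fun x => by
      rw [add_apply, hilbertTensorOp_coe, hilbertTensorOp_coe,
        hilbertTensorOp_coe, TensorProduct.mapL_add_left, add_apply,
        map_add])
    (fun c S T => hilbert_ext fun x => by
      rw [smul_apply, hilbertTensorOp_coe, hilbertTensorOp_coe,
        TensorProduct.mapL_smul_left, smul_apply, map_smul])
    (fun S T T' => hilbert_ext fun x => by
      rw [add_apply, hilbertTensorOp_coe, hilbertTensorOp_coe,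
        hilbertTensorOp_coe, TensorProduct.mapL_add_right, add_apply,
        map_add])
    (fun c S T => hilbert_ext fun x => by
      rw [smul_apply, hilbertTensorOp_coe, hilbertTensorOp_coe,
        TensorProduct.mapL_smul_right, smul_apply, map_smul])

end HilbertTensor

section MinTensor

variable {A B A' B' : Type u} [CStarAlgebra A] [CStarAlgebra B] [CStarAlgebra A'] [CStarAlgebra B']

section Rep

variable {H K : Type u} [NormedAddCommGroup H] [InnerProductSpace ℂ H] [CompleteSpace H]
  [NormedAddCommGroup K] [InnerProductSpace ℂ K] [CompleteSpace K]

/-- The linear map underlying `tensorRep`. -/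
def tensorRepLinear (π : A →⋆ₐ[ℂ] (H →L[ℂ] H)) (σ : B →⋆ₐ[ℂ] (K →L[ℂ] K)) :
    A ⊗[ℂ] B →ₗ[ℂ] (HilbertTensor H K →L[ℂ] HilbertTensor H K) :=
  TensorProduct.lift (hilbertTensorBilin.compl₁₂ π.toAlgHom.toLinearMap σ.toAlgHom.toLinearMap)

theorem tensorRepLinear_tmul (π : A →⋆ₐ[ℂ] (H →L[ℂ] H)) (σ : B →⋆ₐ[ℂ] (K →L[ℂ] K))
    (a : A) (b : B) : tensorRepLinear π σ (a ⊗ₜ b) = hilbertTensorOp (π a) (σ b) := rfl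

theorem tensorRepLinear_mul (π : A →⋆ₐ[ℂ] (H →L[ℂ] H)) (σ : B →⋆ₐ[ℂ] (K →L[ℂ] K))
    (x y : A ⊗[ℂ] B) :
    tensorRepLinear π σ (x * y) = tensorRepLinear π σ x * tensorRepLinear π σ y := by
  induction x with
  | zero => simp
  | add x x' hx hx' => rw [add_mul, map_add, hx, hx', map_add, add_mul]
  | tmul a b =>
    induction y with
    | zero => simp
    | add y y' hy hy' => rw [mul_add, map_add, hy, hy', map_add, mul_add]
    | tmul a' b' =>
      rw [Algebra.TensorProduct.tmul_mul_tmul, tensorRepLinear_tmul, tensorRepLinear_tmul,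
        tensorRepLinear_tmul, map_mul, map_mul, hilbertTensorOp_mul]

theorem tensorRepLinear_one (π : A →⋆ₐ[ℂ] (H →L[ℂ] H)) (σ : B →⋆ₐ[ℂ] (K →L[ℂ] K)) :
    tensorRepLinear π σ 1 = 1 := by
  rw [Algebra.TensorProduct.one_def, tensorRepLinear_tmul, map_one, map_one, hilbertTensorOp_one]

theorem tensorRepLinear_star (π : A →⋆ₐ[ℂ] (H →L[ℂ] H)) (σ : B →⋆ₐ[ℂ] (K →L[ℂ] K))
    (x : A ⊗[ℂ] B) : tensorRepLinear π σ (star x) = star (tensorRepLinear π σ x) := by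
  induction x with
  | zero => simp
  | add x y hx hy => rw [star_add, map_add, hx, hy, map_add, star_add]
  | tmul a b =>
    rw [TensorProduct.star_tmul, tensorRepLinear_tmul, tensorRepLinear_tmul, map_star, map_star,
      hilbertTensorOp_star]

/-- The representation `a ⊗ b ↦ π a ⊗ σ b` of the algebraic tensor product on the
Hilbert space tensor product. -/
def tensorRep (π : A →⋆ₐ[ℂ] (H →L[ℂ] H)) (σ : B →⋆ₐ[ℂ] (K →L[ℂ] K)) :
    A ⊗[ℂ] B →⋆ₐ[ℂ] (HilbertTensor H K →L[ℂ] HilbertTensor H K) :=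
  { AlgHom.ofLinearMap (tensorRepLinear π σ) (tensorRepLinear_one π σ)
      (tensorRepLinear_mul π σ) with
    map_star' := tensorRepLinear_star π σ }

@[simp] theorem tensorRep_tmul (π : A →⋆ₐ[ℂ] (H →L[ℂ] H)) (σ : B →⋆ₐ[ℂ] (K →L[ℂ] K))
    (a : A) (b : B) : tensorRep π σ (a ⊗ₜ b) = hilbertTensorOp (π a) (σ b) := rfl

theorem norm_tensorRep_tmul_le (π : A →⋆ₐ[ℂ] (H →L[ℂ] H)) (σ : B →⋆ₐ[ℂ] (K →L[ℂ] K))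
    (a : A) (b : B) : ‖tensorRep π σ (a ⊗ₜ b)‖ ≤ ‖a‖ * ‖b‖ := by
  rw [tensorRep_tmul]
  exact (norm_hilbertTensorOp_le _ _).trans (mul_le_mul
    (NonUnitalStarAlgHom.norm_apply_le π a) (NonUnitalStarAlgHom.norm_apply_le σ b)
    (norm_nonneg _) (norm_nonneg _))

theorem tensorRep_map (f : A →⋆ₐ[ℂ] A') (g : B →⋆ₐ[ℂ] B') (π : A' →⋆ₐ[ℂ] (H →L[ℂ] H))
    (σ : B' →⋆ₐ[ℂ] (K →L[ℂ] K)) (x : A ⊗[ℂ] B) :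
    tensorRep π σ (Algebra.TensorProduct.map f.toAlgHom g.toAlgHom x) =
      tensorRep (π.comp f) (σ.comp g) x := by
  induction x with
  | zero => simp
  | add x y hx hy => rw [map_add, map_add, hx, hy, map_add]
  | tmul a b => rfl

end Rep

variable (A B) in
/-- The C*-seminorms `‖(π ⊗ σ)(·)‖` on the algebraic tensor product, where `π` and `σ` are
representations of `A` and `B` on Hilbert spaces. -/
def spatialSeminorms : Set (CStarSeminorm (A ⊗[ℂ] B)) :=
  {p | ∃ (H K : Type u) (_ : NormedAddCommGroup H) (_ : InnerProductSpace ℂ H)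
    (_ : CompleteSpace H) (_ : NormedAddCommGroup K) (_ : InnerProductSpace ℂ K)
    (_ : CompleteSpace K) (π : A →⋆ₐ[ℂ] (H →L[ℂ] H)) (σ : B →⋆ₐ[ℂ] (K →L[ℂ] K)),
    p = CStarSeminorm.ofHom (tensorRep π σ)}

theorem spatialSeminorms_bddAbove (x : A ⊗[ℂ] B) :
    BddAbove (Set.range fun p : spatialSeminorms A B => p.1 x) := by
  suffices h : ∃ C, ∀ p ∈ spatialSeminorms A B, p x ≤ C by
    obtain ⟨C, hC⟩ := h
    exact ⟨C, by rintro _ ⟨p, rfl⟩; exact hC p.1 p.2⟩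
  induction x with
  | zero => exact ⟨0, fun p _ => (map_zero p.toSeminorm).le⟩
  | add x y hx hy =>
    obtain ⟨C, hC⟩ := hx
    obtain ⟨D, hD⟩ := hy
    exact ⟨C + D, fun p hp => (map_add_le_add _ x y).trans (add_le_add (hC p hp) (hD p hp))⟩
  | tmul a b =>
    refine ⟨‖a‖ * ‖b‖, ?_⟩
    rintro p ⟨H, K, _, _, _, _, _, _, π, σ, rfl⟩
    exact norm_tensorRep_tmul_le π σ a b

variable (A B) in
/-- The minimal (spatial) C*-norm on the algebraic tensor product. -/
def minSeminorm : CStarSeminorm (A ⊗[ℂ] B) :=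
  CStarSeminorm.sup (spatialSeminorms A B) spatialSeminorms_bddAbove

variable (A B) in
/-- The minimal (spatial) tensor product of two C*-algebras. -/
def MinTensor : Type u := (minSeminorm A B).CStarCompletion

instance : CStarAlgebra (MinTensor A B) :=
  inferInstanceAs (CStarAlgebra (minSeminorm A B).CStarCompletion)

namespace MinTensor

variable (A B) in
/-- The canonical map from the algebraic to the minimal tensor product. -/
def ofAlgebraic : A ⊗[ℂ] B →⋆ₐ[ℂ] MinTensor A B := (minSeminorm A B).toCompletion

theorem denseRange_ofAlgebraic : DenseRange (ofAlgebraic A B) :=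
  (minSeminorm A B).denseRange_toCompletion

/-- Elementary tensors in the minimal tensor product. -/
def tmul (a : A) (b : B) : MinTensor A B := ofAlgebraic A B (a ⊗ₜ b)

theorem tmul_mul_tmul (a a' : A) (b b' : B) :
    tmul a b * tmul a' b' = tmul (a * a') (b * b') := by
  rw [tmul, tmul, ← map_mul, Algebra.TensorProduct.tmul_mul_tmul, tmul]

theorem star_tmul (a : A) (b : B) : star (tmul a b) = tmul (star a) (star b) := by
  rw [tmul, ← map_star, TensorProduct.star_tmul, tmul]

theorem one_eq : (1 : MinTensor A B) = tmul 1 1 := (map_one (ofAlgebraic A B)).symm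

theorem norm_tmul_le (a : A) (b : B) : ‖tmul a b‖ ≤ ‖a‖ * ‖b‖ := by
  refine ((minSeminorm A B).norm_toCompletion _).trans_le ?_
  refine CStarSeminorm.sup_le _ (by positivity) ?_
  rintro p ⟨H, K, _, _, _, _, _, _, π, σ, rfl⟩
  exact norm_tensorRep_tmul_le π σ a b

/-- The bounded bilinear map `(a, b) ↦ a ⊗ b`. -/
def tmulCLM : A →L[ℂ] B →L[ℂ] MinTensor A B :=
  LinearMap.mkContinuous₂
    ((TensorProduct.mk ℂ A B).compr₂ (ofAlgebraic A B).toAlgHom.toLinearMap) 1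
    (fun a b => by rw [one_mul]; exact norm_tmul_le a b)

theorem tmulCLM_apply (a : A) (b : B) : tmulCLM a b = tmul a b := rfl

/-- The `*`-homomorphism `f ⊗ g` between algebraic tensor products. -/
def algMap (f : A →⋆ₐ[ℂ] A') (g : B →⋆ₐ[ℂ] B') : A ⊗[ℂ] B →⋆ₐ[ℂ] A' ⊗[ℂ] B' :=
  { Algebra.TensorProduct.map f.toAlgHom g.toAlgHom with
    map_star' := fun x => by
      change Algebra.TensorProduct.map f.toAlgHom g.toAlgHom (star x) =
        star (Algebra.TensorProduct.map f.toAlgHom g.toAlgHom x)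
      induction x with
      | zero => simp
      | add x y hx hy => rw [star_add, map_add, hx, hy, map_add, star_add]
      | tmul a b =>
        change f (star a) ⊗ₜ[ℂ] g (star b) = star (f a) ⊗ₜ[ℂ] star (g b)
        rw [map_star, map_star] }

theorem minSeminorm_algMap_le (f : A →⋆ₐ[ℂ] A') (g : B →⋆ₐ[ℂ] B') (x : A ⊗[ℂ] B) :
    minSeminorm A' B' (algMap f g x) ≤ minSeminorm A B x := by
  refine CStarSeminorm.sup_le _ (apply_nonneg _ _) ?_
  rintro p ⟨H, K, _, _, _, _, _, _, π, σ, rfl⟩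
  rw [CStarSeminorm.ofHom_apply]
  change ‖tensorRep π σ (Algebra.TensorProduct.map f.toAlgHom g.toAlgHom x)‖ ≤ _
  rw [tensorRep_map]
  exact CStarSeminorm.le_sup spatialSeminorms_bddAbove
    (p := CStarSeminorm.ofHom (tensorRep (π.comp f) (σ.comp g)))
    ⟨H, K, _, _, _, _, _, _, π.comp f, σ.comp g, rfl⟩ x

/-- The `*`-homomorphism `f ⊗ g` between minimal tensor products. -/
def map (f : A →⋆ₐ[ℂ] A') (g : B →⋆ₐ[ℂ] B') : MinTensor A B →⋆ₐ[ℂ] MinTensor A' B' :=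
  (minSeminorm A B).lift ((ofAlgebraic A' B').comp (algMap f g)) (fun x =>
    ((minSeminorm A' B').norm_toCompletion _).trans_le (minSeminorm_algMap_le f g x))

@[simp] theorem map_tmul (f : A →⋆ₐ[ℂ] A') (g : B →⋆ₐ[ℂ] B') (a : A) (b : B) :
    map f g (tmul a b) = tmul (f a) (g b) :=
  (minSeminorm A B).lift_toCompletion _ _ (a ⊗ₜ b)

end MinTensor

end MinTensor

/-! ### Compact quantum groups and their actions -/

/-- The graph of the canonical isomorphism `(A ⊗ B) ⊗ C ≅ A ⊗ (B ⊗ C)`, that is, the closed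
linear span of the pairs `((a ⊗ b) ⊗ c, a ⊗ (b ⊗ c))`. -/
def associatorGraph (A B C : Type u) [CStarAlgebra A] [CStarAlgebra B] [CStarAlgebra C] :
    Submodule ℂ (MinTensor (MinTensor A B) C × MinTensor A (MinTensor B C)) :=
  (Submodule.span ℂ (Set.range fun t : A × B × C =>
    (MinTensor.tmul (MinTensor.tmul t.1 t.2.1) t.2.2,
      MinTensor.tmul t.1 (MinTensor.tmul t.2.1 t.2.2)))).topologicalClosure

/-- `u` and `v` are equal under the canonical identification of `(A ⊗ B) ⊗ C` with
`A ⊗ (B ⊗ C)`. -/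
def AssocEq {A B C : Type u} [CStarAlgebra A] [CStarAlgebra B] [CStarAlgebra C]
    (u : MinTensor (MinTensor A B) C) (v : MinTensor A (MinTensor B C)) : Prop :=
  (u, v) ∈ associatorGraph A B C

/-- A compact quantum group: a unital C*-algebra with a coassociative comultiplication for
which the linear spans of `Δ(Q)(1 ⊗ Q)` and `Δ(Q)(Q ⊗ 1)` are dense in `Q ⊗ Q`. -/
structure CompactQuantumGroup where
  carrier : Type u
  [cstarAlgebra : CStarAlgebra carrier]
  comul : carrier →⋆ₐ[ℂ] MinTensor carrier carrier
  coassoc : ∀ x, AssocEq (MinTensor.map comul (StarAlgHom.id ℂ carrier) (comul x))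
    (MinTensor.map (StarAlgHom.id ℂ carrier) comul (comul x))
  dense_one_tmul : Dense (Submodule.span ℂ
    {y | ∃ a b : carrier, y = comul a * MinTensor.tmul 1 b} : Set (MinTensor carrier carrier))
  dense_tmul_one : Dense (Submodule.span ℂ
    {y | ∃ a b : carrier, y = comul a * MinTensor.tmul b 1} : Set (MinTensor carrier carrier))

attribute [instance] CompactQuantumGroup.cstarAlgebra

/-- A `*`-homomorphism `φ` is a morphism of compact quantum groups if
`(φ ⊗ φ) ∘ Δ₁ = Δ₂ ∘ φ`. -/
def IsCQGMorphism (G₁ G₂ : CompactQuantumGroup.{u}) (φ : G₁.carrier →⋆ₐ[ℂ] G₂.carrier) : Prop :=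
  ∀ x, MinTensor.map φ φ (G₁.comul x) = G₂.comul (φ x)

/-- Two compact quantum groups are isomorphic if there is a bijective morphism between them. -/
def IsomorphicCQG (G₁ G₂ : CompactQuantumGroup.{u}) : Prop :=
  ∃ φ : G₁.carrier →⋆ₐ[ℂ] G₂.carrier, IsCQGMorphism G₁ G₂ φ ∧ Function.Bijective φ

/-- `R` is the slice map `θ ⊗ id : C ⊗ Q → Q`: the bounded linear map with
`c ⊗ q ↦ θ(c) q`. -/
def IsSliceMap {C Q : Type u} [CStarAlgebra C] [CStarAlgebra Q] (θ : C →L[ℂ] ℂ)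
    (R : MinTensor C Q →L[ℂ] Q) : Prop :=
  ∀ c q, R (MinTensor.tmul c q) = θ c • q

/-- A quantum transformation group of `C`: a compact quantum group with a faithful action
on `C`. -/
structure QuantumTransformationGroup (C : Type u) [CStarAlgebra C] where
  cqg : CompactQuantumGroup.{u}
  action : C →⋆ₐ[ℂ] MinTensor C cqg.carrier
  coaction : ∀ c, AssocEq (MinTensor.map action (StarAlgHom.id ℂ cqg.carrier) (action c))
    (MinTensor.map (StarAlgHom.id ℂ C) cqg.comul (action c))
  dense_span : Dense (Submodule.span ℂ
    {y | ∃ (c : C) (q : cqg.carrier), y = action c * MinTensor.tmul 1 q} :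
      Set (MinTensor C cqg.carrier))
  faithful : Dense (StarAlgebra.adjoin ℂ
    {q | ∃ (θ : C →L[ℂ] ℂ) (R : MinTensor C cqg.carrier →L[ℂ] cqg.carrier),
      IsSliceMap θ R ∧ ∃ c, q = R (action c)} : Set cqg.carrier)

/-- `U` is a universal object of the category of those quantum transformation groups of `C`
which satisfy `P`: it satisfies `P`, and for every `W` satisfying `P` there is a surjective
morphism of compact quantum groups `φ` from `U` to `W` with `(id ⊗ φ) ∘ α_U = α_W`. -/
def IsUniversalObject {C : Type u} [CStarAlgebra C] (P : QuantumTransformationGroup C → Prop)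
    (U : QuantumTransformationGroup C) : Prop :=
  P U ∧ ∀ W, P W → ∃ φ : U.cqg.carrier →⋆ₐ[ℂ] W.cqg.carrier, IsCQGMorphism U.cqg W.cqg φ ∧
    Function.Surjective φ ∧
    ∀ c, MinTensor.map (StarAlgHom.id ℂ C) φ (U.action c) = W.action c

/-! ### The free product of copies of the circle -/

theorem MinTensor.dense_of_tmul_mem {A B : Type u} [CStarAlgebra A] [CStarAlgebra B]
    (M : Submodule ℂ (MinTensor A B))
    (h : ∀ a b, MinTensor.tmul a b ∈ M.topologicalClosure) :
    Dense (M : Set (MinTensor A B)) := by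
  rw [Submodule.dense_iff_topologicalClosure_eq_top, Submodule.eq_top_iff']
  intro x
  refine MinTensor.denseRange_ofAlgebraic.induction_on
    (p := fun x => x ∈ M.topologicalClosure) x M.isClosed_topologicalClosure (fun t => ?_)
  induction t with
  | zero => rw [map_zero]; exact Submodule.zero_mem _
  | add x y hx hy => rw [map_add]; exact Submodule.add_mem _ hx hy
  | tmul a b => exact h a b

section CStarNorm

variable {B : Type*} [CStarAlgebra B]

theorem CStarAlgebra.norm_one_le : ‖(1 : B)‖ ≤ 1 := by
  have h := CStarRing.norm_star_mul_self (x := (1 : B))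
  rw [star_one, one_mul] at h
  nlinarith [norm_nonneg (1 : B)]

theorem CStarAlgebra.norm_le_one_of_star_mul_self_eq_one {a : B} (h : star a * a = 1) :
    ‖a‖ ≤ 1 := by
  have h1 := CStarRing.norm_star_mul_self (x := a)
  rw [h] at h1
  nlinarith [norm_nonneg a, CStarAlgebra.norm_one_le (B := B)]

end CStarNorm

/-- The relations `z_i* z_i = 1 = z_i z_i*`. -/
def unitaryRelators (I : Type u) : Set (FreeStarAlgebra I) :=
  {r | ∃ i, r = star (FreeStarAlgebra.gen i) * FreeStarAlgebra.gen i - 1 ∨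
    r = FreeStarAlgebra.gen i * star (FreeStarAlgebra.gen i) - 1}

/-- The free product of copies of `C(S¹)` indexed by `I`: the universal unital C*-algebra
generated by unitaries `z i`, `i ∈ I`. -/
def CircleFreeProduct (I : Type u) : Type u := UniversalCStarAlgebra (unitaryRelators I)

namespace CircleFreeProduct

variable {I : Type u}

instance : CStarAlgebra (CircleFreeProduct I) :=
  inferInstanceAs (CStarAlgebra (UniversalCStarAlgebra (unitaryRelators I)))

/-- The canonical map from the free `*`-algebra. -/
def mk : FreeStarAlgebra I →⋆ₐ[ℂ] CircleFreeProduct I := UniversalCStarAlgebra.mk _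

theorem denseRange_mk : DenseRange (mk : FreeStarAlgebra I → CircleFreeProduct I) :=
  UniversalCStarAlgebra.denseRange_mk _

/-- The canonical unitary generators. -/
def z (i : I) : CircleFreeProduct I := mk (FreeStarAlgebra.gen i)

theorem star_z_mul_z (i : I) : star (z i) * z i = 1 := by
  have h : mk (star (FreeStarAlgebra.gen i) * FreeStarAlgebra.gen i - 1) = 0 :=
    UniversalCStarAlgebra.mk_eq_zero _ ⟨i, Or.inl rfl⟩
  rwa [map_sub, map_mul, map_star, map_one, sub_eq_zero] at h

theorem z_mul_star_z (i : I) : z i * star (z i) = 1 := by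
  have h : mk (FreeStarAlgebra.gen i * star (FreeStarAlgebra.gen i) - 1) = 0 :=
    UniversalCStarAlgebra.mk_eq_zero _ ⟨i, Or.inr rfl⟩
  rwa [map_sub, map_mul, map_star, map_one, sub_eq_zero] at h

/-- The universal property: unitaries `u i` in a C*-algebra are the images of the generators
`z i` under a `*`-homomorphism. -/
def lift {B : Type*} [CStarAlgebra B] (f : I → B) (h1 : ∀ i, star (f i) * f i = 1)
    (h2 : ∀ i, f i * star (f i) = 1) : CircleFreeProduct I →⋆ₐ[ℂ] B :=
  UniversalCStarAlgebra.lift _ f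
    (fun i => CStarAlgebra.norm_le_one_of_star_mul_self_eq_one (h1 i))
    (by
      rintro r ⟨i, rfl | rfl⟩
      · simp [map_star, h1 i]
      · simp [map_star, h2 i])

@[simp] theorem lift_z {B : Type*} [CStarAlgebra B] (f : I → B) (h1 : ∀ i, star (f i) * f i = 1)
    (h2 : ∀ i, f i * star (f i) = 1) (i : I) : lift f h1 h2 (z i) = f i :=
  UniversalCStarAlgebra.lift_of _ f _ _ i

/-- The comultiplication, determined by `Δ(z i) = z i ⊗ z i`. -/
def comul : CircleFreeProduct I →⋆ₐ[ℂ] MinTensor (CircleFreeProduct I) (CircleFreeProduct I) :=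
  lift (fun i => MinTensor.tmul (z i) (z i))
    (fun i => by
      rw [MinTensor.star_tmul, MinTensor.tmul_mul_tmul, star_z_mul_z, MinTensor.one_eq])
    (fun i => by
      rw [MinTensor.star_tmul, MinTensor.tmul_mul_tmul, z_mul_star_z, MinTensor.one_eq])

theorem comul_z (i : I) : comul (z i) = MinTensor.tmul (z i) (z i) := lift_z _ _ _ i

/-- The images of the letters of the free `*`-algebra are group-like unitaries. -/
theorem letter_props (y : I ⊕ I) :
    comul (mk (FreeStarAlgebra.letter y)) =
        MinTensor.tmul (mk (FreeStarAlgebra.letter y)) (mk (FreeStarAlgebra.letter y)) ∧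
      mk (FreeStarAlgebra.letter y) * star (mk (FreeStarAlgebra.letter y)) = 1 := by
  cases y with
  | inl i => exact ⟨comul_z i, z_mul_star_z i⟩
  | inr i =>
    have h : mk (FreeStarAlgebra.letter (Sum.inr i)) = star (z i) := by
      rw [z, ← map_star, FreeStarAlgebra.gen, FreeStarAlgebra.star_letter]
      rfl
    rw [h, map_star, comul_z, MinTensor.star_tmul, star_star]
    exact ⟨rfl, star_z_mul_z i⟩

theorem mem_of_mul_letter {T : Submodule ℂ (CircleFreeProduct I)}
    (hT : IsClosed (T : Set (CircleFreeProduct I))) (h1 : 1 ∈ T)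
    (hl : ∀ y, ∀ a ∈ T, mk (FreeStarAlgebra.letter y) * a ∈ T) (a : CircleFreeProduct I) :
    a ∈ T := by
  have key : ∀ x : FreeStarAlgebra I, ∀ a ∈ T, mk x * a ∈ T := by
    intro x
    induction x using FreeStarAlgebra.induction_letters with
    | scalar r =>
      intro a ha
      rw [AlgHomClass.commutes, ← Algebra.smul_def]
      exact T.smul_mem r ha
    | letters y => exact hl y
    | mul x y hx hy =>
      intro a ha
      rw [map_mul, mul_assoc]
      exact hx _ (hy a ha)
    | add x y hx hy =>
      intro a ha
      rw [map_add, add_mul]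
      exact T.add_mem (hx a ha) (hy a ha)
  refine denseRange_mk.induction_on (p := fun a => a ∈ T) a hT (fun x => ?_)
  simpa using key x 1 h1

theorem coassoc (x : CircleFreeProduct I) :
    AssocEq (MinTensor.map comul (StarAlgHom.id ℂ _) (comul x))
      (MinTensor.map (StarAlgHom.id ℂ _) comul (comul x)) := by
  set L := (MinTensor.map comul (StarAlgHom.id ℂ (CircleFreeProduct I))).comp comul with hL
  set R := (MinTensor.map (StarAlgHom.id ℂ (CircleFreeProduct I)) comul).comp comul with hR
  let D := associatorGraph (CircleFreeProduct I) (CircleFreeProduct I) (CircleFreeProduct I)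
  have hD : IsClosed (D : Set (MinTensor (MinTensor (CircleFreeProduct I) (CircleFreeProduct I))
      (CircleFreeProduct I) × MinTensor (CircleFreeProduct I)
        (MinTensor (CircleFreeProduct I) (CircleFreeProduct I)))) :=
    Submodule.isClosed_topologicalClosure _
  have hmem : ∀ a b c, (MinTensor.tmul (MinTensor.tmul a b) c,
      MinTensor.tmul a (MinTensor.tmul b c)) ∈ D := fun a b c =>
    Submodule.le_topologicalClosure _ (Submodule.subset_span ⟨(a, b, c), rfl⟩)
  have hmul : ∀ (g : CircleFreeProduct I), ∀ w ∈ D,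
      ((MinTensor.tmul (MinTensor.tmul g g) g, MinTensor.tmul g (MinTensor.tmul g g)) :
        MinTensor (MinTensor _ _) _ × MinTensor _ (MinTensor _ _)) * w ∈ D := by
    intro g
    refine Submodule.topologicalClosure_minimal (t := D.comap (LinearMap.mulLeft ℂ _)) _ ?_
      (hD.preimage (continuous_const_mul _))
    rw [Submodule.span_le]
    rintro _ ⟨⟨a, b, c⟩, rfl⟩
    change (_ * _, _ * _) ∈ D
    simp only [MinTensor.tmul_mul_tmul]
    exact hmem _ _ _
  let T : Submodule ℂ (CircleFreeProduct I) :=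
    D.comap (L.toAlgHom.toLinearMap.prod R.toAlgHom.toLinearMap)
  have hT : ∀ x, x ∈ T ↔ (L x, R x) ∈ D := fun x => Iff.rfl
  have hLc : Continuous L :=
    AddMonoidHomClass.continuous_of_bound L 1 (by simpa using NonUnitalStarAlgHom.norm_apply_le L)
  have hRc : Continuous R :=
    AddMonoidHomClass.continuous_of_bound R 1 (by simpa using NonUnitalStarAlgHom.norm_apply_le R)
  have : x ∈ T := by
    refine mem_of_mul_letter (hD.preimage (hLc.prodMk hRc)) ?_ (fun y a ha => ?_) x
    · rw [hT, map_one, map_one, MinTensor.one_eq, MinTensor.one_eq, MinTensor.one_eq]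
      exact hmem 1 1 1
    · have h := (letter_props y).1
      rw [hT] at ha ⊢
      have h2 := hmul (mk (FreeStarAlgebra.letter y)) _ ha
      have hl : L (mk (FreeStarAlgebra.letter y)) = MinTensor.tmul
          (MinTensor.tmul (mk (FreeStarAlgebra.letter y)) (mk (FreeStarAlgebra.letter y)))
          (mk (FreeStarAlgebra.letter y)) := by
        rw [hL, StarAlgHom.comp_apply, h, MinTensor.map_tmul, h, StarAlgHom.coe_id, id_eq]
      have hr : R (mk (FreeStarAlgebra.letter y)) = MinTensor.tmul
          (mk (FreeStarAlgebra.letter y))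
          (MinTensor.tmul (mk (FreeStarAlgebra.letter y)) (mk (FreeStarAlgebra.letter y))) := by
        rw [hR, StarAlgHom.comp_apply, h, MinTensor.map_tmul, h, StarAlgHom.coe_id, id_eq]
      rw [map_mul, map_mul, hl, hr]
      exact h2
  exact this

theorem mul_mem_closure {M : Submodule ℂ (MinTensor (CircleFreeProduct I) (CircleFreeProduct I))}
    (g : MinTensor (CircleFreeProduct I) (CircleFreeProduct I)) (hM : ∀ w ∈ M, g * w ∈ M) :
    ∀ w ∈ M.topologicalClosure, g * w ∈ M.topologicalClosure := by
  refine Submodule.topologicalClosure_minimal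
    (t := M.topologicalClosure.comap (LinearMap.mulLeft ℂ g)) _ ?_
    (M.isClosed_topologicalClosure.preimage (continuous_const_mul g))
  exact fun w hw => Submodule.le_topologicalClosure _ (hM w hw)

theorem dense_one_tmul : Dense (Submodule.span ℂ
    {y | ∃ a b : CircleFreeProduct I, y = comul a * MinTensor.tmul 1 b} :
      Set (MinTensor (CircleFreeProduct I) (CircleFreeProduct I))) := by
  set M := Submodule.span ℂ
    {y | ∃ a b : CircleFreeProduct I, y = comul a * MinTensor.tmul 1 b} with hM
  refine MinTensor.dense_of_tmul_mem M fun a => ?_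
  let T : Submodule ℂ (CircleFreeProduct I) := ⨅ b, M.topologicalClosure.comap
    (MinTensor.tmulCLM.flip b : CircleFreeProduct I →L[ℂ] MinTensor _ _).toLinearMap
  have hT : ∀ x, x ∈ T ↔ ∀ b, MinTensor.tmul x b ∈ M.topologicalClosure := fun x => by
    simp only [T, Submodule.mem_iInf]
    rfl
  refine (hT a).1 (mem_of_mul_letter ?_ ?_ (fun y c hc => ?_) a)
  · have : (T : Set (CircleFreeProduct I)) = ⋂ b, (MinTensor.tmulCLM.flip b) ⁻¹'
        (M.topologicalClosure : Set (MinTensor (CircleFreeProduct I) (CircleFreeProduct I))) := by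
      ext x
      rw [SetLike.mem_coe, hT, Set.mem_iInter]
      rfl
    rw [this]
    exact isClosed_iInter fun b => M.isClosed_topologicalClosure.preimage (map_continuous _)
  · rw [hT]
    exact fun b => Submodule.le_topologicalClosure _
      (Submodule.subset_span ⟨1, b, by rw [map_one, one_mul]⟩)
  · obtain ⟨h1, h2⟩ := letter_props y
    rw [hT] at hc ⊢
    intro b
    have h3 : MinTensor.tmul (mk (FreeStarAlgebra.letter y) * c) b =
        comul (mk (FreeStarAlgebra.letter y)) *
          MinTensor.tmul c (star (mk (FreeStarAlgebra.letter y)) * b) := by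
      rw [h1, MinTensor.tmul_mul_tmul, ← mul_assoc, h2, one_mul]
    rw [h3]
    refine mul_mem_closure _ (fun w hw => ?_) _ (hc _)
    induction hw using Submodule.span_induction with
    | mem w hw =>
      obtain ⟨a, b, rfl⟩ := hw
      exact Submodule.subset_span ⟨_ * a, b, by rw [map_mul, mul_assoc]⟩
    | zero => rw [mul_zero]; exact Submodule.zero_mem _
    | add w w' _ _ hw hw' => rw [mul_add]; exact Submodule.add_mem _ hw hw'
    | smul r w _ hw => rw [mul_smul_comm]; exact Submodule.smul_mem _ r hw

theorem dense_tmul_one : Dense (Submodule.span ℂ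
    {y | ∃ a b : CircleFreeProduct I, y = comul a * MinTensor.tmul b 1} :
      Set (MinTensor (CircleFreeProduct I) (CircleFreeProduct I))) := by
  set M := Submodule.span ℂ
    {y | ∃ a b : CircleFreeProduct I, y = comul a * MinTensor.tmul b 1} with hM
  refine MinTensor.dense_of_tmul_mem M fun b a => ?_
  let T : Submodule ℂ (CircleFreeProduct I) := ⨅ b, M.topologicalClosure.comap
    (MinTensor.tmulCLM b : CircleFreeProduct I →L[ℂ] MinTensor _ _).toLinearMap
  have hT : ∀ x, x ∈ T ↔ ∀ b, MinTensor.tmul b x ∈ M.topologicalClosure := fun x => by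
    simp only [T, Submodule.mem_iInf]
    rfl
  refine (hT a).1 (mem_of_mul_letter ?_ ?_ (fun y c hc => ?_) a) b
  · have : (T : Set (CircleFreeProduct I)) = ⋂ b, (MinTensor.tmulCLM b) ⁻¹'
        (M.topologicalClosure : Set (MinTensor (CircleFreeProduct I) (CircleFreeProduct I))) := by
      ext x
      rw [SetLike.mem_coe, hT, Set.mem_iInter]
      rfl
    rw [this]
    exact isClosed_iInter fun b => M.isClosed_topologicalClosure.preimage (map_continuous _)
  · rw [hT]
    exact fun b => Submodule.le_topologicalClosure _
      (Submodule.subset_span ⟨1, b, by rw [map_one, one_mul]⟩)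
  · obtain ⟨h1, h2⟩ := letter_props y
    rw [hT] at hc ⊢
    intro b
    have h3 : MinTensor.tmul b (mk (FreeStarAlgebra.letter y) * c) =
        comul (mk (FreeStarAlgebra.letter y)) *
          MinTensor.tmul (star (mk (FreeStarAlgebra.letter y)) * b) c := by
      rw [h1, MinTensor.tmul_mul_tmul, ← mul_assoc, h2, one_mul]
    rw [h3]
    refine mul_mem_closure _ (fun w hw => ?_) _ (hc _)
    induction hw using Submodule.span_induction with
    | mem w hw =>
      obtain ⟨a, b, rfl⟩ := hw
      exact Submodule.subset_span ⟨_ * a, b, by rw [map_mul, mul_assoc]⟩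
    | zero => rw [mul_zero]; exact Submodule.zero_mem _
    | add w w' _ _ hw hw' => rw [mul_add]; exact Submodule.add_mem _ hw hw'
    | smul r w _ hw => rw [mul_smul_comm]; exact Submodule.smul_mem _ r hw

end CircleFreeProduct

/-- The free product of copies of `C(S¹)` indexed by `I`, as a compact quantum group with
`Δ(z i) = z i ⊗ z i`. -/
def circleFreeProductCQG (I : Type u) : CompactQuantumGroup.{u} where
  carrier := CircleFreeProduct I
  comul := CircleFreeProduct.comul
  coassoc := CircleFreeProduct.coassoc
  dense_one_tmul := CircleFreeProduct.dense_one_tmul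
  dense_tmul_one := CircleFreeProduct.dense_tmul_one

/-! ### Directed graphs -/

/-- A directed graph (loops and multiple edges allowed) with vertex set `V`, edge set `E`,
source map `src` and range map `rng`. -/
structure DirectedGraph (V E : Type u) where
  src : E → V
  rng : E → V

namespace DirectedGraph

variable {V E : Type u} (Γ : DirectedGraph V E)

/-- Every vertex is the source or the range of an edge. -/
def IsConnected : Prop := ∀ v, (∃ e, Γ.src e = v) ∨ ∃ e, Γ.rng e = v

/-- `l` is the list of edges of a path starting at `v` (of length `l.length`, possibly `0`). -/
def IsPathFrom : V → List E → Prop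
  | _, [] => True
  | v, e :: l => Γ.src e = v ∧ IsPathFrom (Γ.rng e) l

/-- The vertices visited by a path starting at `v`. -/
def pathVertices (v : V) (l : List E) : List V := v :: l.map Γ.rng

/-- `l` is a cycle: a path of positive length whose range is its source, and whose edges
have pairwise distinct sources. -/
def IsCycle (l : List E) : Prop :=
  l ≠ [] ∧ (∃ v, Γ.IsPathFrom v l ∧ (Γ.pathVertices v l).getLast? = some v) ∧
    (l.map Γ.src).Nodup

/-- Property (R). -/
structure PropertyR [Fintype V] : Prop where
  /-- There is no cycle of length at least `2`. -/
  no_cycle : ∀ l : List E, 2 ≤ l.length → ¬ Γ.IsCycle l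
  /-- There is a path of length `|V| - 1` through all vertices. -/
  exists_path : ∃ (v : V) (l : List E), Γ.IsPathFrom v l ∧ l.length + 1 = Fintype.card V ∧
    ∀ w, w ∈ Γ.pathVertices v l
  /-- There is at most one edge from a given vertex to a given vertex. -/
  edge_unique : ∀ e f, Γ.src e = Γ.src f → Γ.rng e = Γ.rng f → e = f

end DirectedGraph

/-! ### Graph C*-algebras -/

open Classical in
/-- Partial isometries `S e` and mutually orthogonal projections `p v` with sum `1` which satisfy
`S_e* S_e = p_{r(e)}`, and `p_v = ∑_{s(f) = v} S_f S_f*` for each `v` which is not a sink. -/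
structure IsCuntzKriegerFamily {V E : Type u} [Fintype V] [Fintype E] (Γ : DirectedGraph V E)
    {B : Type*} [Ring B] [StarRing B] (S : E → B) (p : V → B) : Prop where
  partial_isometry : ∀ e, S e * star (S e) * S e = S e
  idempotent : ∀ v, p v * p v = p v
  self_adjoint : ∀ v, star (p v) = p v
  orthogonal : ∀ v w, v ≠ w → p v * p w = 0
  sum_eq_one : ∑ v, p v = 1
  star_mul_self : ∀ e, star (S e) * S e = p (Γ.rng e)
  sum_mul_star : ∀ v, (∃ f, Γ.src f = v) → p v = ∑ f with Γ.src f = v, S f * star (S f)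

section GraphAlgebra

variable {V E : Type u} [Fintype V] [Fintype E] (Γ : DirectedGraph V E)

open FreeStarAlgebra in
open Classical in
/-- The defining relations of the graph C*-algebra, in the letters `S e = inl e` and
`p v = inr v`. -/
inductive GraphRelator : FreeStarAlgebra (E ⊕ V) → Prop
  | partial_isometry (e : E) : GraphRelator
      (gen (.inl e) * star (gen (.inl e)) * gen (.inl e) - gen (.inl e))
  | idempotent (v : V) : GraphRelator (gen (.inr v) * gen (.inr v) - gen (.inr v))
  | self_adjoint (v : V) : GraphRelator (star (gen (.inr v)) - gen (.inr v))
  | orthogonal (v w : V) (h : v ≠ w) : GraphRelator (gen (.inr v) * gen (.inr w))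
  | sum_eq_one : GraphRelator ((∑ v : V, gen (.inr v)) - 1)
  | star_mul_self (e : E) : GraphRelator
      (star (gen (.inl e)) * gen (.inl e) - gen (.inr (Γ.rng e)))
  | sum_mul_star (v : V) (h : ∃ f, Γ.src f = v) : GraphRelator
      (gen (.inr v) - ∑ f with Γ.src f = v, gen (.inl f) * star (gen (.inl f)))

/-- The graph C*-algebra `C*(Γ)`: the universal C*-algebra generated by partial isometries `S e`
and mutually orthogonal projections `p v` subject to the Cuntz-Krieger relations. Its unit is
`∑ v, p v`. -/
def GraphCStarAlgebra : Type u := UniversalCStarAlgebra {r | GraphRelator Γ r}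

namespace GraphCStarAlgebra

instance : CStarAlgebra (GraphCStarAlgebra Γ) :=
  inferInstanceAs (CStarAlgebra (UniversalCStarAlgebra {r | GraphRelator Γ r}))

/-- The canonical map from the free `*`-algebra. -/
def mk : FreeStarAlgebra (E ⊕ V) →⋆ₐ[ℂ] GraphCStarAlgebra Γ :=
  UniversalCStarAlgebra.mk {r | GraphRelator Γ r}

/-- The generating partial isometries. -/
def S (e : E) : GraphCStarAlgebra Γ := mk Γ (FreeStarAlgebra.gen (.inl e))

/-- The generating projections. -/
def p (v : V) : GraphCStarAlgebra Γ := mk Γ (FreeStarAlgebra.gen (.inr v))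

theorem isCuntzKriegerFamily : IsCuntzKriegerFamily Γ (S Γ) (p Γ) := by
  have h : ∀ r, GraphRelator Γ r → mk Γ r = 0 := fun r hr => UniversalCStarAlgebra.mk_eq_zero _ hr
  refine ⟨fun e => ?_, fun v => ?_, fun v => ?_, fun v w hvw => ?_, ?_, fun e => ?_, fun v hv => ?_⟩
  · simpa [S, p, map_star, sub_eq_zero] using h _ (.partial_isometry e)
  · simpa [S, p, map_star, sub_eq_zero] using h _ (.idempotent v)
  · simpa [S, p, map_star, sub_eq_zero] using h _ (.self_adjoint v)
  · simpa [S, p, map_star, sub_eq_zero] using h _ (.orthogonal v w hvw)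
  · simpa [p, sub_eq_zero] using h _ .sum_eq_one
  · simpa [S, p, map_star, sub_eq_zero] using h _ (.star_mul_self e)
  · simpa [S, p, map_star, sub_eq_zero] using h _ (.sum_mul_star v hv)

variable {Γ} in
/-- The universal property of the graph C*-algebra. -/
def lift {B : Type*} [CStarAlgebra B] {T : E → B} {q : V → B}
    (h : IsCuntzKriegerFamily Γ T q) : GraphCStarAlgebra Γ →⋆ₐ[ℂ] B :=
  UniversalCStarAlgebra.lift _ (Sum.elim T q)
    (by
      have hq : ∀ v, ‖q v‖ ≤ 1 := fun v => by
        have h1 := CStarRing.norm_star_mul_self (x := q v)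
        rw [h.self_adjoint, h.idempotent] at h1
        nlinarith [norm_nonneg (q v)]
      rintro (e | v)
      · have h1 := CStarRing.norm_star_mul_self (x := T e)
        rw [h.star_mul_self] at h1
        have h2 := hq (Γ.rng e)
        change ‖T e‖ ≤ 1
        nlinarith [norm_nonneg (T e)]
      · exact hq v)
    (by
      rintro r (e | v | v | ⟨v, w, hvw⟩ | _ | e | ⟨v, hv⟩)
      · simp [map_star, h.partial_isometry]
      · simp [h.idempotent]
      · simp [map_star, h.self_adjoint]
      · simp [h.orthogonal v w hvw]
      · simp [h.sum_eq_one]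
      · simp [map_star, h.star_mul_self]
      · simp [map_star, h.sum_mul_star v hv])

@[simp] theorem lift_S {B : Type*} [CStarAlgebra B] {T : E → B} {q : V → B}
    (h : IsCuntzKriegerFamily Γ T q) (e : E) : lift h (S Γ e) = T e :=
  UniversalCStarAlgebra.lift_of _ _ _ _ _

@[simp] theorem lift_p {B : Type*} [CStarAlgebra B] {T : E → B} {q : V → B}
    (h : IsCuntzKriegerFamily Γ T q) (v : V) : lift h (p Γ v) = q v :=
  UniversalCStarAlgebra.lift_of _ _ _ _ _

end GraphCStarAlgebra

/-! ### The category of linear actions on a graph C*-algebra preserving `τ` -/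

open GraphCStarAlgebra

/-- The space `V_{2,+}`: the span of the `p u`, for `u` not the source of any edge, and of the
`S_e S_f*` with `r(e) = r(f)`. -/
def V2plus : Submodule ℂ (GraphCStarAlgebra Γ) :=
  Submodule.span ℂ ({x | ∃ u, (¬ ∃ e, Γ.src e = u) ∧ x = p Γ u} ∪
    {x | ∃ e f, Γ.rng e = Γ.rng f ∧ x = S Γ e * star (S Γ f)})

variable {Γ} in
/-- `τ` is the linear functional on `V_{2,+}` with `τ(S_e S_f*) = δ_{ef}` and `τ(p_u) = 1`.
(There is exactly one: the spanning set defining `V_{2,+}` is linearly independent.) -/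
structure IsTau (τ : V2plus Γ →ₗ[ℂ] ℂ) : Prop where
  apply_self : ∀ (x : V2plus Γ) (e : E), (x : GraphCStarAlgebra Γ) = S Γ e * star (S Γ e) →
    τ x = 1
  apply_ne : ∀ (x : V2plus Γ) (e f : E), Γ.rng e = Γ.rng f → e ≠ f →
    (x : GraphCStarAlgebra Γ) = S Γ e * star (S Γ f) → τ x = 0
  apply_p : ∀ (x : V2plus Γ) (u : V), (¬ ∃ e, Γ.src e = u) →
    (x : GraphCStarAlgebra Γ) = p Γ u → τ x = 1

variable {Γ} in
/-- The action is linear: `α(S_e) = ∑_f S_f ⊗ q_{fe}` for some elements `q_{fe}`. -/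
def IsLinearAction (U : QuantumTransformationGroup (GraphCStarAlgebra Γ)) : Prop :=
  ∃ q : E → E → U.cqg.carrier, ∀ e, U.action (S Γ e) = ∑ f, MinTensor.tmul (S Γ f) (q f e)

variable {Γ} in
/-- The action preserves `τ`, that is, `(τ ⊗ id) ∘ α = τ(·) 1` on `V_{2,+}`: every `α(x)`,
`x ∈ V_{2,+}`, is (the image of) an element `t` of the algebraic tensor product `V_{2,+} ⊗ Q`
with `(τ ⊗ id)(t) = τ(x) 1`. -/
def PreservesTau (U : QuantumTransformationGroup (GraphCStarAlgebra Γ)) : Prop :=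
  ∃ τ : V2plus Γ →ₗ[ℂ] ℂ, IsTau τ ∧ ∀ x : V2plus Γ, ∃ t : V2plus Γ ⊗[ℂ] U.cqg.carrier,
    MinTensor.ofAlgebraic _ _ (TensorProduct.map (V2plus Γ).subtype LinearMap.id t) =
        U.action (x : GraphCStarAlgebra Γ) ∧
      TensorProduct.lid ℂ U.cqg.carrier (TensorProduct.map τ LinearMap.id t) =
        τ x • (1 : U.cqg.carrier)

/-- The objects of the category of quantum transformation groups of `C*(Γ)` which act linearly
and preserve `τ`. -/
def IsLinTauObject (U : QuantumTransformationGroup (GraphCStarAlgebra Γ)) : Prop :=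
  IsLinearAction U ∧ PreservesTau U

end GraphAlgebra

end

/-! The free product of circles acts on `C*(Γ)` by `S_e ↦ S_e ⊗ z_e`. Tensoring with unitaries
preserves the Cuntz-Krieger relations, so this is always a linear action preserving `τ`. The content
of the theorem is the converse: property (R) forces every linear action preserving `τ` to be
diagonal, `α(S_e) = S_e ⊗ u_e` with `u_e` unitary. Then `z_e ↦ u_e` defines the required morphism.
Coassociativity makes `u_e` group-like, and faithfulness together with closedness of the range makes
the morphism surjective. A universal object and the diagonal object therefore map onto each other
over `C*(Γ)`, and the composite on the free product fixes each `z_e`, which gives the isomorphism.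

Rigidity (`LinTauRelations.vertex`, `LinTauRelations.diagonal`). Write `α(S_e) = ∑ S_g ⊗ q_{ge}` and
`α(p_w) = ∑ p_v ⊗ P_{vw}`. Multiplicativity makes each `P_{vw}` a projection, with rows of sum `1`.
The relation `S_e* S_e = p_{r(e)}` gives `∑_{r(g)=v} q_{ge}* q_{ge} = P_{v,r(e)}`, and `p_w = ∑ S_e
S_e*` gives `∑_{s(e)=w} q_{ge} q_{ge}* = P_{s(g),w}`. Hence `q_{ge}` vanishes as soon as
`P_{s(g),s(e)}` or `P_{r(g),r(e)}` does. Invariance of `τ` says that `∑_g q_{ge} q_{ge}* = 1`. The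
covering path orders the vertices; with no cycle of length at least `2`, no edge goes backwards, and
each vertex but the last has an edge to the next one. Descending induction along this order shows
`P_{vw} = δ_{vw}`. Since an edge is determined by its endpoints, `q` is then diagonal, and the
relations above make its diagonal entries unitary.

Reading off coefficients requires bounded slice maps on the minimal tensor product. Vector
functionals suffice: their slices are bounded because every element of a C*-algebra attains its norm
in a GNS representation (`exists_rep_norm_le`, `norm_algSlice_le`). A concrete representation of
`C*(Γ)` on `ℓ²(V × ℕ)` supplies vectors separating the generators (`SeparatingRep`), and `τ` itself
becomes a finite sum of vector functionals. -/

noncomputable section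

open scoped TensorProduct
open UniformSpace (Completion)

/-! ### States and representations of C*-algebras -/

section States

open scoped ComplexOrder

variable {A : Type u} [CStarAlgebra A] [PartialOrder A] [StarOrderedRing A]

/-- A contractive unital functional on a C*-algebra is positive. -/
theorem ContinuousLinearMap.nonneg_of_map_one {f : A →L[ℂ] ℂ} (hf : ‖f‖ ≤ 1) (h1 : f 1 = 1)
    {b : A} (hb : 0 ≤ b) : 0 ≤ (f b).re ∧ (f b).im = 0 := by
  have hle : ∀ x, ‖f x‖ ≤ ‖x‖ := fun x =>
    (f.le_opNorm x).trans (mul_le_of_le_one_left (norm_nonneg x) hf)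
  have hsa : IsSelfAdjoint b := .of_nonneg hb
  have him : (f b).im = 0 := by
    -- For selfadjoint `b`, `‖b + it‖² = ‖b² + t²‖ ≤ ‖b‖² + t²`, while `f (b + it)` has imaginary
    -- part `Im f(b) + t`. The left side below grows linearly in `t` relative to `t²`, so `Im f(b)`
    -- must vanish.
    have key : ∀ t : ℝ, ((f b).im + t) ^ 2 ≤ ‖b‖ ^ 2 + t ^ 2 := by
      intro t
      have h2 : ‖b + (t * Complex.I) • (1 : A)‖ ^ 2 ≤ ‖b‖ ^ 2 + t ^ 2 := by
        have h4 : star (b + (t * Complex.I) • (1 : A)) * (b + (t * Complex.I) • (1 : A)) =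
            star b * b + ((t : ℂ) ^ 2) • (1 : A) := by
          rw [star_add, star_smul, star_one, hsa.star_eq]
          simp only [add_mul, mul_add, smul_mul_assoc, mul_smul_comm, one_mul, mul_one, smul_add,
            star_mul', Complex.star_def, Complex.conj_ofReal, Complex.conj_I]
          have h5 : (t * -Complex.I * (t * Complex.I) : ℂ) = (t : ℂ) ^ 2 := by
            linear_combination (-(t : ℂ) ^ 2) * Complex.I_sq
          rw [smul_smul, ← h5, mul_comm (_ * _) (_ * Complex.I), mul_neg, neg_smul]
          abel
        rw [sq, ← CStarRing.norm_star_mul_self, h4]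
        refine (norm_add_le _ _).trans (add_le_add ?_ ?_)
        · rw [CStarRing.norm_star_mul_self, sq]
        · rw [norm_smul, norm_pow, Complex.norm_real, Real.norm_eq_abs, sq_abs]
          exact mul_le_of_le_one_right (sq_nonneg t) CStarAlgebra.norm_one_le
      have h3 := hle (b + (t * Complex.I) • (1 : A))
      rw [map_add, map_smul, h1, smul_eq_mul, mul_one] at h3
      have h6 := (Complex.abs_im_le_norm _).trans h3
      have h7 : (f b + t * Complex.I).im = (f b).im + t := by simp
      rw [h7] at h6
      calc ((f b).im + t) ^ 2 = |(f b).im + t| ^ 2 := (sq_abs _).symm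
        _ ≤ _ := pow_le_pow_left₀ (abs_nonneg _) h6 2
        _ ≤ _ := h2
    by_contra hne
    -- This `t` solves `2 t Im f(b) = ‖b‖² + 1`, one more than the bound allows.
    have h8 := key ((‖b‖ ^ 2 + 1) / (2 * (f b).im))
    have h9 : 2 * (f b).im * ((‖b‖ ^ 2 + 1) / (2 * (f b).im)) = ‖b‖ ^ 2 + 1 := by
      field_simp
    nlinarith [sq_nonneg (f b).im]
  refine ⟨?_, him⟩
  -- From `0 ≤ ‖b‖ - b ≤ ‖b‖`; applying `f` gives `‖b‖ - Re f(b) ≤ ‖b‖`.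
  have h2 : ‖algebraMap ℝ A ‖b‖ - b‖ ≤ ‖b‖ := by
    refine (CStarAlgebra.norm_le_iff_le_algebraMap _ (norm_nonneg b) ?_).2 ?_
    · exact sub_nonneg.2 hsa.le_algebraMap_norm_self
    · exact sub_le_self _ hb
  have h3 := (Complex.abs_re_le_norm _).trans ((hle _).trans h2)
  have h4 : (f (algebraMap ℝ A ‖b‖ - b)).re = ‖b‖ - (f b).re := by
    rw [map_sub, Algebra.algebraMap_eq_smul_one, ← Complex.coe_smul ‖b‖ (1 : A), map_smul, h1]
    simp
  rw [h4] at h3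
  linarith [(abs_le.1 h3).2]

/-- `‖a‖` lies in the spectrum of `a ≥ 0`, hence is the value at `a` of a character of the
C*-algebra generated by `a`. A norm-preserving Hahn-Banach extension is unital and contractive,
therefore positive. The zero algebra is set apart because its spectra are empty. -/
theorem exists_positive_functional_eq_norm {a : A} (ha : 0 ≤ a) :
    ∃ f : A →ₚ[ℂ] ℂ, f a = ‖a‖ ∧ ‖f 1‖ ≤ 1 := by
  rcases subsingleton_or_nontrivial A with hA | hA
  · refine ⟨0, ?_, by simp⟩
    simp [Subsingleton.elim a 0]
  have hsa : IsSelfAdjoint a := .of_nonneg ha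
  let S : StarSubalgebra ℂ A := StarAlgebra.elemental ℂ a
  have hS : IsClosed (S : Set A) := StarAlgebra.elemental.isClosed ℂ a
  let a' : S := ⟨a, StarAlgebra.elemental.self_mem ℂ a⟩
  have hn : IsStarNormal a := hsa.isStarNormal
  have hspec : ((‖a‖ : ℝ) : ℂ) ∈ spectrum ℂ a' := by
    rw [StarSubalgebra.mem_spectrum_iff]
    have h := CStarAlgebra.norm_mem_spectrum_of_nonneg ha
    rwa [← spectrum.algebraMap_mem_iff ℂ] at h
  obtain ⟨χ, hχ⟩ := WeakDual.CharacterSpace.mem_spectrum_iff_exists.1 hspec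
  obtain ⟨g, hg, hgn⟩ := exists_extension_norm_eq (𝕜 := ℂ) S.toSubalgebra.toSubmodule
    (WeakDual.toStrongDual (χ : WeakDual ℂ S))
  have hg1 : g 1 = 1 := (hg (1 : S)).trans (map_one χ)
  have hga : g a = ‖a‖ := (hg a').trans hχ
  have hgn1 : ‖g‖ ≤ 1 := by
    rw [hgn]
    refine ContinuousLinearMap.opNorm_le_bound _ zero_le_one fun x => ?_
    have h := spectrum.norm_le_norm_of_mem
      (AlgHom.apply_mem_spectrum (χ : WeakDual.characterSpace ℂ S) (show S from x))
    rw [one_mul]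
    exact h
  refine ⟨PositiveLinearMap.mk₀ (g : A →ₗ[ℂ] ℂ) fun x hx => ?_, hga, ?_⟩
  · obtain ⟨h1, h2⟩ := g.nonneg_of_map_one hgn1 hg1 hx
    exact Complex.nonneg_iff.2 ⟨h1, h2.symm⟩
  · change ‖g 1‖ ≤ 1
    rw [hg1, norm_one]

end States

open scoped ComplexOrder in
/-- Every element of a C*-algebra attains its norm in some representation (Gelfand-Naimark). -/
theorem exists_rep_norm_le {A : Type u} [CStarAlgebra A] (a : A) :
    ∃ (H : Type u) (_ : NormedAddCommGroup H) (_ : InnerProductSpace ℂ H) (_ : CompleteSpace H)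
      (π : A →⋆ₐ[ℂ] (H →L[ℂ] H)), ‖a‖ ≤ ‖π a‖ := by
  let _ := CStarAlgebra.spectralOrder A
  let _ := CStarAlgebra.spectralOrderedRing A
  obtain ⟨f, hf, hf1⟩ := exists_positive_functional_eq_norm (star_mul_self_nonneg a)
  refine ⟨f.GNS, inferInstance, inferInstance, inferInstance, f.gnsStarAlgHom, ?_⟩
  -- The cyclic vector, the class of `1`: `‖π(a) ζ‖² = f(a* a) = ‖a‖²`, and `‖ζ‖² = f(1) ≤ 1`.
  let ζ : f.GNS := ((f.toPreGNS 1 : f.PreGNS) : Completion f.PreGNS)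
  have h1 : ‖ζ‖ ≤ 1 := by
    rw [← sq_le_one_iff₀ (norm_nonneg ζ), Completion.norm_coe, PositiveLinearMap.preGNS_norm_def]
    simp only [PositiveLinearMap.ofPreGNS_toPreGNS, star_one, mul_one]
    rw [Real.sq_sqrt']
    exact max_le ((Complex.re_le_norm _).trans hf1) zero_le_one
  have h2 : ‖f.gnsStarAlgHom a ζ‖ = ‖a‖ := by
    have h3 : f.gnsStarAlgHom a ζ = ((f.toPreGNS a : f.PreGNS) : Completion f.PreGNS) := by
      simp [ζ]
    rw [h3, Completion.norm_coe, PositiveLinearMap.preGNS_norm_def]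
    simp only [PositiveLinearMap.ofPreGNS_toPreGNS]
    rw [hf, Complex.ofReal_re, CStarRing.norm_star_mul_self, Real.sqrt_mul_self (norm_nonneg a)]
  rw [← h2]
  exact (ContinuousLinearMap.le_opNorm _ _).trans (mul_le_of_le_one_right (norm_nonneg _) h1)

/-! ### Slice maps and representations of minimal tensor products -/

namespace MinTensor

section Rep

variable {A B C : Type u} [CStarAlgebra A] [CStarAlgebra B] [CStarAlgebra C]
variable {H K L : Type u} [NormedAddCommGroup H] [InnerProductSpace ℂ H] [CompleteSpace H]
  [NormedAddCommGroup K] [InnerProductSpace ℂ K] [CompleteSpace K]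
  [NormedAddCommGroup L] [InnerProductSpace ℂ L] [CompleteSpace L]

theorem norm_tensorRep_le (π : A →⋆ₐ[ℂ] (H →L[ℂ] H)) (σ : B →⋆ₐ[ℂ] (K →L[ℂ] K))
    (x : A ⊗[ℂ] B) : ‖tensorRep π σ x‖ ≤ minSeminorm A B x :=
  CStarSeminorm.le_sup spatialSeminorms_bddAbove (p := CStarSeminorm.ofHom (tensorRep π σ))
    ⟨H, K, _, _, _, _, _, _, π, σ, rfl⟩ x

/-- The representation `π ⊗ σ` of the minimal tensor product. -/
def rep (π : A →⋆ₐ[ℂ] (H →L[ℂ] H)) (σ : B →⋆ₐ[ℂ] (K →L[ℂ] K)) :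
    MinTensor A B →⋆ₐ[ℂ] (HilbertTensor H K →L[ℂ] HilbertTensor H K) :=
  (minSeminorm A B).lift (tensorRep π σ) (norm_tensorRep_le π σ)

theorem rep_ofAlgebraic (π : A →⋆ₐ[ℂ] (H →L[ℂ] H)) (σ : B →⋆ₐ[ℂ] (K →L[ℂ] K))
    (x : A ⊗[ℂ] B) : rep π σ (ofAlgebraic A B x) = tensorRep π σ x :=
  CStarSeminorm.lift_toCompletion _ _ _ _

theorem rep_tmul (π : A →⋆ₐ[ℂ] (H →L[ℂ] H)) (σ : B →⋆ₐ[ℂ] (K →L[ℂ] K)) (a : A) (b : B) :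
    rep π σ (tmul a b) = hilbertTensorOp (π a) (σ b) :=
  rep_ofAlgebraic π σ _

/-- On the algebraic tensor product the norm is by construction the supremum over the `π ⊗ σ`. For
`x` in the completion, an algebraic `t` within `ε/2` of `x` has norm at most `ε/2` in each `π ⊗ σ`,
so `‖x‖ ≤ ε`. -/
theorem eq_zero_of_rep_eq_zero {x : MinTensor A B}
    (h : ∀ (H K : Type u) [NormedAddCommGroup H] [InnerProductSpace ℂ H] [CompleteSpace H]
      [NormedAddCommGroup K] [InnerProductSpace ℂ K] [CompleteSpace K]
      (π : A →⋆ₐ[ℂ] (H →L[ℂ] H)) (σ : B →⋆ₐ[ℂ] (K →L[ℂ] K)), rep π σ x = 0) : x = 0 := by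
  rw [← norm_le_zero_iff]
  refine le_of_forall_pos_le_add fun ε hε => ?_
  obtain ⟨t, ht⟩ := (denseRange_ofAlgebraic (A := A) (B := B)).exists_dist_lt x (half_pos hε)
  rw [dist_eq_norm] at ht
  have h1 : ‖ofAlgebraic A B t‖ ≤ ε / 2 := by
    refine ((minSeminorm A B).norm_toCompletion t).trans_le ?_
    refine CStarSeminorm.sup_le _ (half_pos hε).le ?_
    rintro p ⟨H, K, _, _, _, _, _, _, π, σ, rfl⟩
    rw [CStarSeminorm.ofHom_apply, ← rep_ofAlgebraic]
    have h2 := NonUnitalStarAlgHom.norm_apply_le (rep π σ) (x - ofAlgebraic A B t)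
    rw [map_sub, h, zero_sub, norm_neg] at h2
    exact h2.trans ht.le
  calc ‖x‖ = ‖(x - ofAlgebraic A B t) + ofAlgebraic A B t‖ := by rw [sub_add_cancel]
    _ ≤ ε / 2 + ε / 2 := (norm_add_le _ _).trans (add_le_add ht.le h1)
    _ = 0 + ε := by ring

/-- An operator on a Hilbert space tensor product which has no matrix coefficients between
elementary tensors is zero. -/
theorem hilbert_eq_zero {T : HilbertTensor H K →L[ℂ] HilbertTensor H K}
    (h : ∀ ξ ξ' : H, ∀ η η' : K,
      inner ℂ (toHilbertTensor (ξ ⊗ₜ[ℂ] η)) (T (toHilbertTensor (ξ' ⊗ₜ[ℂ] η'))) = 0) : T = 0 := by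
  refine hilbert_ext fun x => ?_
  rw [zero_apply]
  induction x with
  | zero => simp
  | add x y hx hy => rw [map_add, map_add, hx, hy, add_zero]
  | tmul ξ' η' =>
    refine ext_inner_left ℂ fun v => ?_
    rw [inner_zero_right]
    refine denseRange_toHilbertTensor.induction_on v (isClosed_eq (by fun_prop) (by fun_prop))
      fun y => ?_
    induction y with
    | zero => simp
    | add y z hy hz => rw [map_add, inner_add_left, hy, hz, add_zero]
    | tmul ξ η => exact h ξ ξ' η η'

theorem inner_toHilbertTensor (ξ ξ' : H) (η η' : K) :
    inner ℂ (toHilbertTensor (ξ ⊗ₜ[ℂ] η)) (toHilbertTensor (ξ' ⊗ₜ[ℂ] η')) =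
      inner ℂ ξ ξ' * inner ℂ η η' := by
  rw [LinearIsometry.inner_map_map, TensorProduct.inner_tmul]

/-- The vector functional `a ↦ ⟪ξ, π(a) ξ'⟫`. -/
def vectorFunctional (π : A →⋆ₐ[ℂ] (H →L[ℂ] H)) (ξ ξ' : H) : A →L[ℂ] ℂ :=
  LinearMap.mkContinuous
    { toFun := fun a => inner ℂ ξ (π a ξ')
      map_add' := fun a b => by rw [map_add, add_apply, inner_add_right]
      map_smul' := fun c a => by
        rw [map_smul, smul_apply, inner_smul_right, RingHom.id_apply, smul_eq_mul] }
    (‖ξ‖ * ‖ξ'‖) (fun a => by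
      refine (norm_inner_le_norm _ _).trans ?_
      rw [mul_assoc, mul_comm ‖ξ'‖]
      exact mul_le_mul_of_nonneg_left ((ContinuousLinearMap.le_opNorm _ _).trans
        (mul_le_mul_of_nonneg_right (NonUnitalStarAlgHom.norm_apply_le π a) (norm_nonneg _)))
        (norm_nonneg _))

theorem vectorFunctional_apply (π : A →⋆ₐ[ℂ] (H →L[ℂ] H)) (ξ ξ' : H) (a : A) :
    vectorFunctional π ξ ξ' a = inner ℂ ξ (π a ξ') := rfl

/-- The slice map `θ ⊗ id` on the algebraic tensor product. -/
def algSlice (θ : A →L[ℂ] ℂ) : A ⊗[ℂ] B →ₗ[ℂ] B :=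
  (TensorProduct.lid ℂ B).toLinearMap ∘ₗ TensorProduct.map θ.toLinearMap LinearMap.id

theorem algSlice_tmul (θ : A →L[ℂ] ℂ) (a : A) (b : B) : algSlice θ (a ⊗ₜ[ℂ] b) = θ a • b := by
  simp [algSlice]

theorem inner_rep_algSlice (π : A →⋆ₐ[ℂ] (H →L[ℂ] H)) (σ : B →⋆ₐ[ℂ] (K →L[ℂ] K)) (ξ ξ' : H)
    (η η' : K) (x : A ⊗[ℂ] B) :
    inner ℂ η (σ (algSlice (vectorFunctional π ξ ξ') x) η') =
      inner ℂ (toHilbertTensor (ξ ⊗ₜ[ℂ] η)) (tensorRep π σ x (toHilbertTensor (ξ' ⊗ₜ[ℂ] η'))) := by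
  induction x with
  | zero => simp
  | add x y hx hy =>
    rw [map_add, map_add, add_apply, inner_add_right, hx, hy, map_add, add_apply, inner_add_right]
  | tmul a b =>
    rw [algSlice_tmul, map_smul, smul_apply, inner_smul_right, tensorRep_tmul, hilbertTensorOp_coe]
    exact (inner_toHilbertTensor _ _ _ _).symm

/-- Represent `B` by some `σ` in which the slice attains its norm. The matrix coefficients of `σ` at
the slice are coefficients of `π ⊗ σ` at `x` between elementary tensors, and `π ⊗ σ` is dominated by
the minimal norm. Pairing `η = σ(slice) η'` with itself and cancelling one factor `‖η‖` yields the
bound. -/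
theorem norm_algSlice_le (π : A →⋆ₐ[ℂ] (H →L[ℂ] H)) (ξ ξ' : H) (x : A ⊗[ℂ] B) :
    ‖algSlice (vectorFunctional π ξ ξ') x‖ ≤ ‖ξ‖ * ‖ξ'‖ * minSeminorm A B x := by
  obtain ⟨K, _, _, _, σ, hσ⟩ := exists_rep_norm_le (algSlice (vectorFunctional π ξ ξ') x)
  have h0 : 0 ≤ minSeminorm A B x := apply_nonneg _ _
  refine hσ.trans (ContinuousLinearMap.opNorm_le_bound _ (by positivity) fun η' => ?_)
  set η := σ (algSlice (vectorFunctional π ξ ξ') x) η' with hη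
  have hn : ∀ (ξ : H) (η : K), ‖toHilbertTensor (ξ ⊗ₜ[ℂ] η)‖ = ‖ξ‖ * ‖η‖ := fun ξ η => by
    rw [LinearIsometry.norm_map, TensorProduct.norm_tmul]
  have h1 : ‖η‖ * ‖η‖ ≤ (‖ξ‖ * ‖η‖) * (minSeminorm A B x * (‖ξ'‖ * ‖η'‖)) := by
    have h2 : ‖η‖ * ‖η‖ = ‖inner ℂ η η‖ := by
      rw [inner_self_eq_norm_sq_to_K]
      simp [sq]
    rw [h2]
    nth_rewrite 2 [hη]
    rw [inner_rep_algSlice, ← hn ξ η, ← hn ξ' η']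
    refine (norm_inner_le_norm _ _).trans (mul_le_mul_of_nonneg_left ?_ (norm_nonneg _))
    exact (ContinuousLinearMap.le_opNorm _ _).trans
      (mul_le_mul_of_nonneg_right (norm_tensorRep_le π σ x) (norm_nonneg _))
  rcases (norm_nonneg η).eq_or_lt with h2 | h2
  · rw [← h2]
    positivity
  · refine le_of_mul_le_mul_right (h1.trans_eq ?_) h2
    ring

/-- The algebraic slice map of a vector functional, as a continuous linear map. -/
def preSlice (π : A →⋆ₐ[ℂ] (H →L[ℂ] H)) (ξ ξ' : H) : (minSeminorm A B).Pre →L[ℂ] B :=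
  LinearMap.mkContinuous
    (algSlice (vectorFunctional π ξ ξ') : (minSeminorm A B).Pre →ₗ[ℂ] B) (‖ξ‖ * ‖ξ'‖)
    (fun x => norm_algSlice_le π ξ ξ' x)

/-- The slice map of a vector functional. -/
def slice (π : A →⋆ₐ[ℂ] (H →L[ℂ] H)) (ξ ξ' : H) : MinTensor A B →L[ℂ] B where
  toFun x := (preSlice π ξ ξ').fromCompletion x
  map_add' x y := map_add (preSlice π ξ ξ').fromCompletion x y
  map_smul' c x := map_smul (preSlice π ξ ξ').fromCompletion c x
  cont := (preSlice (B := B) π ξ ξ').fromCompletion.continuous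

theorem slice_ofAlgebraic (π : A →⋆ₐ[ℂ] (H →L[ℂ] H)) (ξ ξ' : H) (x : A ⊗[ℂ] B) :
    slice π ξ ξ' (ofAlgebraic A B x) = algSlice (vectorFunctional π ξ ξ') x :=
  ContinuousLinearMap.fromCompletion_apply_coe (preSlice π ξ ξ') x

theorem slice_tmul (π : A →⋆ₐ[ℂ] (H →L[ℂ] H)) (ξ ξ' : H) (a : A) (b : B) :
    slice π ξ ξ' (tmul a b) = inner ℂ ξ (π a ξ') • b :=
  (slice_ofAlgebraic π ξ ξ' _).trans (algSlice_tmul _ _ _)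

theorem isSliceMap_slice (π : A →⋆ₐ[ℂ] (H →L[ℂ] H)) (ξ ξ' : H) :
    IsSliceMap (Q := B) (vectorFunctional π ξ ξ') (slice π ξ ξ') :=
  slice_tmul π ξ ξ'

/-- Both coefficients are bounded functionals which agree on the generating pairs of
`associatorGraph`, so their difference vanishes on its closed span. This is how the associator,
given only by its graph, is evaluated. -/
theorem inner_eq_of_assocEq {u : MinTensor (MinTensor A B) C} {v : MinTensor A (MinTensor B C)}
    (h : AssocEq u v) (π : A →⋆ₐ[ℂ] (H →L[ℂ] H)) (σ : B →⋆ₐ[ℂ] (K →L[ℂ] K))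
    (ρ : C →⋆ₐ[ℂ] (L →L[ℂ] L)) (ξ ξ' : H) (η η' : K) (ζ ζ' : L) :
    inner ℂ (toHilbertTensor (toHilbertTensor (ξ ⊗ₜ[ℂ] η) ⊗ₜ[ℂ] ζ))
        (rep (rep π σ) ρ u (toHilbertTensor (toHilbertTensor (ξ' ⊗ₜ[ℂ] η') ⊗ₜ[ℂ] ζ'))) =
      inner ℂ (toHilbertTensor (ξ ⊗ₜ[ℂ] toHilbertTensor (η ⊗ₜ[ℂ] ζ)))
        (rep π (rep σ ρ) v (toHilbertTensor (ξ' ⊗ₜ[ℂ] toHilbertTensor (η' ⊗ₜ[ℂ] ζ')))) := by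
  let F := vectorFunctional (rep (rep π σ) ρ)
    (toHilbertTensor (toHilbertTensor (ξ ⊗ₜ[ℂ] η) ⊗ₜ[ℂ] ζ))
    (toHilbertTensor (toHilbertTensor (ξ' ⊗ₜ[ℂ] η') ⊗ₜ[ℂ] ζ'))
  let G := vectorFunctional (rep π (rep σ ρ))
    (toHilbertTensor (ξ ⊗ₜ[ℂ] toHilbertTensor (η ⊗ₜ[ℂ] ζ)))
    (toHilbertTensor (ξ' ⊗ₜ[ℂ] toHilbertTensor (η' ⊗ₜ[ℂ] ζ')))
  let D := LinearMap.ker (F.comp (ContinuousLinearMap.fst ℂ _ _) -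
    G.comp (ContinuousLinearMap.snd ℂ _ _)).toLinearMap
  have hD : associatorGraph A B C ≤ D := by
    refine Submodule.topologicalClosure_minimal _ ?_
      (ContinuousLinearMap.isClosed_ker (F.comp (ContinuousLinearMap.fst ℂ _ _) -
        G.comp (ContinuousLinearMap.snd ℂ _ _)))
    rw [Submodule.span_le]
    rintro _ ⟨⟨a, b, c⟩, rfl⟩
    rw [SetLike.mem_coe, LinearMap.mem_ker]
    change F (tmul (tmul a b) c) - G (tmul a (tmul b c)) = 0
    rw [sub_eq_zero, vectorFunctional_apply, vectorFunctional_apply]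
    simp only [rep_tmul, hilbertTensorOp_coe, TensorProduct.mapL_tmul, inner_toHilbertTensor]
    ring
  have h1 := hD h
  rw [LinearMap.mem_ker] at h1
  exact sub_eq_zero.1 h1

/-- If `a ⊗ b ⊗ c` and `a ⊗ x` agree under the associator and `a ≠ 0` in the sense that it has
a nonzero matrix coefficient, then `x = b ⊗ c`. -/
theorem eq_tmul_of_assocEq {a : A} {b : B} {c : C} {x : MinTensor B C}
    (h : AssocEq (tmul (tmul a b) c) (tmul a x)) (π : A →⋆ₐ[ℂ] (H →L[ℂ] H)) (ξ ξ' : H)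
    (ha : inner ℂ ξ (π a ξ') ≠ (0 : ℂ)) : x = tmul b c := by
  rw [← sub_eq_zero]
  refine eq_zero_of_rep_eq_zero fun K L _ _ _ _ _ _ σ ρ => hilbert_eq_zero fun η η' ζ ζ' => ?_
  have h1 := inner_eq_of_assocEq h π σ ρ ξ ξ' η η' ζ ζ'
  simp only [rep_tmul, hilbertTensorOp_coe, TensorProduct.mapL_tmul, inner_toHilbertTensor] at h1
  rw [map_sub, sub_apply, inner_sub_right, rep_tmul, hilbertTensorOp_coe, TensorProduct.mapL_tmul,
    inner_toHilbertTensor, sub_eq_zero]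
  refine mul_left_cancel₀ ha ?_
  rw [← h1, mul_assoc]

end Rep

end MinTensor

/-! ### Ranges of `*`-homomorphisms are closed -/

section Range

variable {A B : Type u} [CStarAlgebra A] [CStarAlgebra B]

/-- A selfadjoint element of the range of a `*`-homomorphism is the image of an element of the
same norm. -/
theorem StarAlgHom.exists_norm_le_of_isSelfAdjoint (φ : A →⋆ₐ[ℂ] B) {a : A}
    (ha : IsSelfAdjoint a) : ∃ a', φ a' = φ a ∧ ‖a'‖ ≤ ‖φ a‖ := by
  -- Truncation to `[-‖φ a‖, ‖φ a‖]`: it is the identity on the spectrum of `φ a`, so `f(a)` has the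
  -- same image as `a`, while `‖f(a)‖ ≤ ‖φ a‖`.
  let f : ℝ → ℝ := fun t => max (-‖φ a‖) (min ‖φ a‖ t)
  have hf : Continuous f := by fun_prop
  have hc : Continuous φ :=
    AddMonoidHomClass.continuous_of_bound φ 1 (by simpa using NonUnitalStarAlgHom.norm_apply_le φ)
  refine ⟨cfc f a, ?_, ?_⟩
  · rw [StarAlgHomClass.map_cfc (S := ℂ) φ f a hf.continuousOn hc ha (ha.map φ)]
    conv_rhs => rw [← cfc_id' ℝ (φ a) (ha.map φ)]
    refine cfc_congr fun t ht => ?_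
    have h1 : ‖t‖ ≤ ‖φ a‖ := (spectrum.norm_le_norm_mul_of_mem ht).trans
      (mul_le_of_le_one_right (norm_nonneg _) CStarAlgebra.norm_one_le)
    rw [Real.norm_eq_abs, abs_le] at h1
    change max _ (min _ t) = t
    rw [min_eq_right h1.2, max_eq_right h1.1]
  · refine norm_cfc_le (norm_nonneg _) fun t _ => ?_
    rw [Real.norm_eq_abs, abs_le]
    exact ⟨le_max_left _ _, max_le (by linarith [norm_nonneg (φ a)]) (min_le_left _ _)⟩

/-- Lifting real and imaginary parts separately without increasing their norms gives every `b` in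
the range a preimage of norm at most `2‖b‖`. By completeness of `A`, such controlled preimages
extend to the closure of the range. -/
theorem StarAlgHom.isClosed_range (φ : A →⋆ₐ[ℂ] B) : IsClosed (Set.range φ) := by
  let f : NormedAddGroupHom A B := AddMonoidHom.mkNormedAddGroupHom (φ : A →+ B) 1
    (by simpa using NonUnitalStarAlgHom.norm_apply_le φ)
  have h : f.SurjectiveOnWith f.range 2 := by
    rintro _ ⟨a, rfl⟩
    obtain ⟨x, hx, hxn⟩ := φ.exists_norm_le_of_isSelfAdjoint (realPart a).2
    obtain ⟨y, hy, hyn⟩ := φ.exists_norm_le_of_isSelfAdjoint (imaginaryPart a).2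
    rw [map_realPart] at hx hxn
    rw [map_imaginaryPart] at hy hyn
    refine ⟨x + Complex.I • y, ?_, ?_⟩
    · change φ (x + Complex.I • y) = φ a
      rw [map_add, map_smul, hx, hy, realPart_add_I_smul_imaginaryPart]
    · change _ ≤ 2 * ‖φ a‖
      refine (norm_add_le _ _).trans ?_
      rw [norm_smul, Complex.norm_I, one_mul]
      have h1 : ‖(realPart (φ a) : B)‖ ≤ ‖φ a‖ := realPart.norm_le (φ a)
      have h2 : ‖(imaginaryPart (φ a) : B)‖ ≤ ‖φ a‖ := imaginaryPart.norm_le (φ a)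
      linarith
  have h2 := controlled_closure_of_complete zero_lt_two zero_lt_one h
  have h3 : Set.range φ = (f.range.topologicalClosure : Set B) := by
    ext b
    refine ⟨fun hb => subset_closure hb, fun hb => ?_⟩
    obtain ⟨a, ha, -⟩ := h2 b hb
    exact ⟨a, ha⟩
  rw [h3]
  exact isClosed_closure

end Range

/-! ### Projections with sum one -/

section Projections

variable {B : Type u} [CStarAlgebra B] {ι : Type*}

/-- The terms are positive, so none of them can cancel another. -/
theorem eq_zero_of_sum_star_mul_self_eq_zero {s : Finset ι} {a : ι → B}
    (h : ∑ i ∈ s, star (a i) * a i = 0) {i : ι} (hi : i ∈ s) : a i = 0 := by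
  let _ := CStarAlgebra.spectralOrder B
  let _ := CStarAlgebra.spectralOrderedRing B
  rw [Finset.sum_eq_zero_iff_of_nonneg fun i _ => star_mul_self_nonneg (a i)] at h
  exact CStarRing.star_mul_self_eq_zero_iff _ |>.1 (h i hi)

theorem eq_zero_of_sum_mul_star_self_eq_zero {s : Finset ι} {a : ι → B}
    (h : ∑ i ∈ s, a i * star (a i) = 0) {i : ι} (hi : i ∈ s) : a i = 0 := by
  have h1 : star (a i) = 0 := eq_zero_of_sum_star_mul_self_eq_zero (s := s)
    (a := fun i => star (a i)) (by simpa using h) hi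
  simpa using h1

theorem IsStarProjection.eq_zero_of_sum_eq_zero {s : Finset ι} {p : ι → B}
    (hp : ∀ i ∈ s, IsStarProjection (p i)) (h : ∑ i ∈ s, p i = 0) {i : ι} (hi : i ∈ s) :
    p i = 0 := by
  refine eq_zero_of_sum_star_mul_self_eq_zero (s := s) (a := p) ?_ hi
  rw [← h]
  refine Finset.sum_congr rfl fun i hi => ?_
  rw [(hp i hi).isSelfAdjoint.star_eq, (hp i hi).isIdempotentElem]

/-- Projections with sum `1` are mutually orthogonal. -/
theorem IsStarProjection.mul_eq_zero_of_sum_eq_one {s : Finset ι} {p : ι → B}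
    (hp : ∀ i ∈ s, IsStarProjection (p i)) (h : ∑ i ∈ s, p i = 1) {i j : ι} (hi : i ∈ s)
    (hj : j ∈ s) (hij : i ≠ j) : p i * p j = 0 := by
  classical
  -- The sum of `(p_k p_j)* (p_k p_j)` over `k ≠ j` is `p_j (1 - p_j) p_j = 0`.
  refine eq_zero_of_sum_star_mul_self_eq_zero (s := s.erase j) (a := fun i => p i * p j) ?_
    (Finset.mem_erase.2 ⟨hij, hi⟩)
  have hpj := (hp j hj).isIdempotentElem.eq
  have h1 : ∀ k ∈ s.erase j, star (p k * p j) * (p k * p j) = p j * p k * p j := by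
    intro k hk
    have hk := hp k (Finset.mem_of_mem_erase hk)
    rw [star_mul, hk.isSelfAdjoint.star_eq, (hp j hj).isSelfAdjoint.star_eq, mul_assoc,
      ← mul_assoc (p k), hk.isIdempotentElem.eq, mul_assoc]
  rw [Finset.sum_congr rfl h1, ← Finset.sum_mul, ← Finset.mul_sum]
  rw [← Finset.add_sum_erase _ _ hj, ← eq_sub_iff_add_eq'] at h
  rw [h, mul_sub, mul_one, hpj, sub_self, zero_mul]

end Projections

/-! ### The ordering of the vertices of a graph with property (R) -/

namespace DirectedGraph

variable {V E : Type u} (Γ : DirectedGraph V E)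

/-- The last vertex of a path starting at `v`. -/
def pathEnd : V → List E → V
  | v, [] => v
  | _, e :: l => pathEnd (Γ.rng e) l

variable {Γ}

theorem isPathFrom_append {v : V} {l m : List E} :
    Γ.IsPathFrom v (l ++ m) ↔ Γ.IsPathFrom v l ∧ Γ.IsPathFrom (Γ.pathEnd v l) m := by
  induction l generalizing v with
  | nil => simp [IsPathFrom, pathEnd]
  | cons e l ih => simp [IsPathFrom, pathEnd, ih, and_assoc]

/-- Passes between the two descriptions of the visited vertices: the start followed by ranges, as in
`pathVertices`, and sources followed by the end, as needed for `IsCycle`. -/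
theorem map_src_append {v : V} {l : List E} (h : Γ.IsPathFrom v l) (m : List E) :
    Γ.pathVertices v (l ++ m) = l.map Γ.src ++ Γ.pathVertices (Γ.pathEnd v l) m := by
  induction l generalizing v with
  | nil => simp [pathEnd]
  | cons e l ih =>
    have h1 : Γ.src e :: Γ.pathVertices (Γ.rng e) (l ++ m) = _ := congrArg _ (ih h.2)
    rw [h.1] at h1
    rw [List.map_cons, h.1]
    exact h1

theorem pathEnd_append_singleton (v : V) (l : List E) (e : E) :
    Γ.pathEnd v (l ++ [e]) = Γ.rng e := by
  induction l generalizing v with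
  | nil => rfl
  | cons f l ih => exact ih _

theorem getElem_pathVertices {v : V} {l : List E} (h : Γ.IsPathFrom v l) {i : ℕ}
    (hi : i < (Γ.pathVertices v l).length) :
    (Γ.pathVertices v l)[i] = Γ.pathEnd v (l.take i) := by
  have hl : i ≤ l.length := by
    simp [pathVertices] at hi
    omega
  have h1 : Γ.pathVertices v l = (l.take i).map Γ.src ++
      Γ.pathVertices (Γ.pathEnd v (l.take i)) (l.drop i) := by
    conv_lhs => rw [← List.take_append_drop i l]
    refine map_src_append ?_ _
    rw [← List.take_append_drop i l, isPathFrom_append] at h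
    exact h.1
  have h2 : (l.take i).length = i := by simp [hl]
  simp only [h1]
  rw [List.getElem_append_right (by simp)]
  simp [pathVertices, min_eq_left hl]

/-- An injective ranking of the vertices such that edges do not decrease the rank, and such that
from each vertex there is an edge to the next one. -/
structure IsPathRank (Γ : DirectedGraph V E) (ρ : V → ℕ) : Prop where
  injective : Function.Injective ρ
  mono : ∀ e, ρ (Γ.src e) ≤ ρ (Γ.rng e)
  step : ∀ v w, ρ v < ρ w → ∃ e, Γ.src e = v ∧ ρ v < ρ (Γ.rng e) ∧ ρ (Γ.rng e) ≤ ρ w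
  range : ∃ v, ∀ w, w ≠ v → ∃ e, Γ.rng e = w

/-- The rank is the position on the covering path, which repeats no vertex because it visits `|V|`
vertices in `|V|` places. An edge from position `j` back to position `i < j` would close the segment
between them to a cycle of length `j - i + 1 ≥ 2`. The path itself provides an edge to each next
vertex, and only its first vertex can fail to be a range. -/
theorem PropertyR.exists_isPathRank [Fintype V] (hR : Γ.PropertyR) : ∃ ρ, IsPathRank Γ ρ := by
  classical
  obtain ⟨v, l, hl, hcard, hmem⟩ := hR.exists_path
  set L := Γ.pathVertices v l with hL
  have hlen : L.length = l.length + 1 := by simp [hL, pathVertices]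
  have hnd : L.Nodup := by
    have h1 : L.toFinset = Finset.univ := by
      ext w
      simp [hmem w]
    have h2 : L.toFinset.card = L.length := by rw [h1, Finset.card_univ, ← hcard, hlen]
    exact Multiset.toFinset_card_eq_card_iff_nodup.1 h2
  have hidx : ∀ w, L.idxOf w < L.length := fun w => List.idxOf_lt_length_iff.2 (hmem w)
  have hget : ∀ w, Γ.pathEnd v (l.take (L.idxOf w)) = w := fun w => by
    rw [← getElem_pathVertices hl (hidx w)]
    exact List.getElem_idxOf (hidx w)
  refine ⟨fun w => L.idxOf w, fun a b hab => ?_, fun e => ?_, fun a b hab => ?_, v, fun w hw => ?_⟩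
  · rw [← hget a, ← hget b]
    exact congrArg (fun i => Γ.pathEnd v (l.take i)) hab
  · by_contra! hlt
    set i := L.idxOf (Γ.rng e)
    set j := L.idxOf (Γ.src e)
    have hj : j ≤ l.length := by
      have := hidx (Γ.src e)
      omega
    -- The segment of the path from `r(e)` (position `i`) to `s(e)` (position `j`); `m ++ [e]` is
    -- the forbidden cycle.
    let m := (l.take j).drop i
    have h1 : l.take j = l.take i ++ m := by
      have h2 := (List.take_append_drop i (l.take j)).symm
      rwa [List.take_take, min_eq_left hlt.le] at h2
    have hp : Γ.IsPathFrom v (l.take i ++ m) := by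
      rw [← h1]
      rw [← List.take_append_drop j l, isPathFrom_append] at hl
      exact hl.1
    have hp2 := (isPathFrom_append.1 hp).2
    have hend : Γ.pathEnd v (l.take i) = Γ.rng e := hget _
    have happ : ∀ (w : V) (a b : List E), Γ.pathEnd w (a ++ b) = Γ.pathEnd (Γ.pathEnd w a) b := by
      intro w a b
      induction a generalizing w with
      | nil => rfl
      | cons f a ih => exact ih _
    have hend2 : Γ.pathEnd (Γ.rng e) m = Γ.src e := by
      rw [← hend, ← happ, ← h1]
      exact hget _
    rw [hend] at hp2
    have hmlen : m.length = j - i := by simp [m, hj]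
    refine hR.no_cycle (m ++ [e]) (by simp; omega) ⟨by simp, ⟨Γ.rng e, ?_, ?_⟩, ?_⟩
    · rw [isPathFrom_append, hend2]
      exact ⟨hp2, rfl, trivial⟩
    · rw [pathVertices, List.map_append, ← List.cons_append]
      exact List.getLast?_concat
    · have h3 : (m ++ [e]).map Γ.src = Γ.pathVertices (Γ.rng e) m := by
        have h4 := map_src_append hp2 []
        rw [List.append_nil, hend2] at h4
        rw [h4]
        simp [pathVertices]
      rw [h3]
      have h5 : L = (l.take i).map Γ.src ++ Γ.pathVertices (Γ.rng e) (m ++ l.drop j) := by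
        rw [← hend, ← map_src_append (isPathFrom_append.1 hp).1, ← List.append_assoc, ← h1,
          List.take_append_drop]
      rw [h5] at hnd
      refine hnd.of_append_right.sublist ?_
      simp [pathVertices]
  · have hi : L.idxOf a < l.length := by
      have := hidx b
      omega
    have h1 : l.take (L.idxOf a + 1) = l.take (L.idxOf a) ++ [l[L.idxOf a]] := by
      rw [List.take_append_getElem]
    have h2 : Γ.pathEnd v (l.take (L.idxOf a + 1)) = Γ.rng l[L.idxOf a] := by
      rw [h1, pathEnd_append_singleton]
    have h3 : L.idxOf (Γ.rng l[L.idxOf a]) = L.idxOf a + 1 := by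
      have h5 : L.idxOf a + 1 < L.length := by omega
      rw [← h2, ← getElem_pathVertices hl h5]
      exact hnd.idxOf_getElem _ h5
    refine ⟨l[L.idxOf a], ?_, by omega, by omega⟩
    have h4 := hl
    rw [← List.take_append_drop (L.idxOf a) l, isPathFrom_append, hget,
      List.drop_eq_getElem_cons hi] at h4
    exact h4.2.1
  · have h1 := hmem w
    rw [hL, pathVertices, List.mem_cons, List.mem_map] at h1
    obtain ⟨e, -, he⟩ := h1.resolve_left hw
    exact ⟨e, he⟩

end DirectedGraph

/-! ### Rigidity of the coefficients of a linear action -/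

section Rigidity

variable {V E : Type u} [Fintype V] [Fintype E] {Γ : DirectedGraph V E} {B : Type u}
  [CStarAlgebra B]

open Classical in
/-- The relations between the coefficients `q` of a linear action on `C*(Γ)` preserving `τ` and
the coefficients `P` of its restriction to the vertex projections. -/
structure LinTauRelations (Γ : DirectedGraph V E) (q : E → E → B) (P : V → V → B) : Prop where
  proj : ∀ v w, IsStarProjection (P v w)
  row_sum : ∀ v, ∑ w, P v w = 1
  star_mul : ∀ e v, ∑ g with Γ.rng g = v, star (q g e) * q g e = P v (Γ.rng e)
  mul_star : ∀ w, (∃ e, Γ.src e = w) → ∀ g,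
    ∑ e with Γ.src e = w, q g e * star (q g e) = P (Γ.src g) w
  sink : ∀ u w, (¬ ∃ e, Γ.src e = u) → (∃ e, Γ.src e = w) → P u w = 0
  tau_edge : ∀ e, ∑ g, q g e * star (q g e) = 1
  tau_sink : ∀ u, (¬ ∃ e, Γ.src e = u) →
    ∑ g, P (Γ.src g) u + ∑ u' with ¬ ∃ e, Γ.src e = u', P u' u = 1

namespace LinTauRelations

variable {q : E → E → B} {P : V → V → B}

/-- `q_{ge}* q_{ge}` is one of the positive terms whose sum is `P_{r(g),r(e)}`. Off-diagonal zeros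
of `P` thus propagate to `q`. -/
theorem coeff_eq_zero_of_rng (h : LinTauRelations Γ q P) {g e : E}
    (h0 : P (Γ.rng g) (Γ.rng e) = 0) : q g e = 0 := by
  classical
  rw [← h.star_mul] at h0
  exact eq_zero_of_sum_star_mul_self_eq_zero h0 (by simp)

theorem coeff_eq_zero_of_src (h : LinTauRelations Γ q P) {g e : E}
    (h0 : P (Γ.src g) (Γ.src e) = 0) : q g e = 0 := by
  classical
  rw [← h.mul_star _ ⟨e, rfl⟩] at h0
  exact eq_zero_of_sum_mul_star_self_eq_zero h0 (by simp)

theorem row_eq_zero (h : LinTauRelations Γ q P) {w : V} (h1 : P w w = 1) {v : V} (hv : v ≠ w) :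
    P w v = 0 := by
  have h2 := IsStarProjection.mul_eq_zero_of_sum_eq_one (fun v _ => h.proj w v) (h.row_sum w)
    (Finset.mem_univ v) (Finset.mem_univ w) hv
  rwa [h1, mul_one] at h2

/-- Along the path order `w` is the only sink. The relation `sink` empties its row off the diagonal,
so `P_{ww} = 1`. Then `tau_sink` is already exhausted by this term, and the remaining projections in
its sum, which include `P_{vw}` for every other `v`, vanish. -/
theorem vertex_of_sink (h : LinTauRelations Γ q P) {ρ : V → ℕ} (hρ : Γ.IsPathRank ρ) {w : V}
    (hw : ¬ ∃ e, Γ.src e = w) : (∀ v, v ≠ w → P v w = 0) ∧ P w w = 1 := by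
  classical
  have hns : ∀ v, v ≠ w → ∃ e, Γ.src e = v := by
    intro v hv
    rcases lt_or_gt_of_ne (hρ.injective.ne hv) with hlt | hlt
    · obtain ⟨e, he, -⟩ := hρ.step _ _ hlt
      exact ⟨e, he⟩
    · obtain ⟨e, he, -⟩ := hρ.step _ _ hlt
      exact absurd ⟨e, he⟩ hw
  have h1 : P w w = 1 := by
    rw [← h.row_sum w]
    exact (Finset.sum_eq_single w (fun v _ hv => h.sink w v hw (hns v hv)) (fun he => (he (Finset.mem_univ _)).elim)).symm
  have h2 := h.tau_sink w hw
  have h3 : ∑ u' with ¬ ∃ e, Γ.src e = u', P u' w = 1 := by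
    rw [← h1]
    refine Finset.sum_eq_single w (fun v hv hvw => ?_) (fun hv => ?_)
    · exact absurd (hns v hvw) (Finset.mem_filter.1 hv).2
    · exact (hv (Finset.mem_filter.2 ⟨Finset.mem_univ _, hw⟩)).elim
  rw [h3, add_eq_right] at h2
  refine ⟨fun v hv => ?_, h1⟩
  obtain ⟨g, rfl⟩ := hns v hv
  exact IsStarProjection.eq_zero_of_sum_eq_zero (fun g _ => h.proj (Γ.src g) w) h2
    (Finset.mem_univ g)

/-- Descending induction on the rank, run as strong induction on `N - ρ w` with `N` an upper bound
of `ρ`. If `P_{w'w'} = 1`, the rest of row `w'` vanishes; this settles the entries of column `w`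
above `w`. The entries below `w` are killed by coefficients `q_{ge}` with `r(g) ≤ w < r(e)`, which
vanish by the induction hypothesis. A loop at `w` is an edge without `w < r(e)`, and requires a
separate argument using `τ`. -/
theorem vertex (h : LinTauRelations Γ q P) {ρ : V → ℕ} (hρ : Γ.IsPathRank ρ)
    (hR : ∀ e f, Γ.src e = Γ.src f → Γ.rng e = Γ.rng f → e = f) (w : V) :
    (∀ v, v ≠ w → P v w = 0) ∧ P w w = 1 := by
  classical
  obtain ⟨N, hN⟩ : ∃ N, ∀ v, ρ v ≤ N :=
    ⟨Finset.univ.sup ρ, fun v => Finset.le_sup (Finset.mem_univ v)⟩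
  induction hk : N - ρ w using Nat.strong_induction_on generalizing w with
  | _ k ih =>
  replace ih : ∀ w', ρ w < ρ w' → (∀ v, v ≠ w' → P v w' = 0) ∧ P w' w' = 1 := fun w' hw' =>
    ih _ (by have := hN w'; omega) w' rfl
  have hrow : ∀ w' v, ρ w < ρ w' → v ≠ w' → P w' v = 0 := fun w' v hw' hv =>
    h.row_eq_zero (ih w' hw').2 hv
  by_cases hw : ∃ e, Γ.src e = w
  swap
  · exact h.vertex_of_sink hρ hw
  have hhigh : ∀ v, ρ w < ρ v → P v w = 0 := fun v hv =>
    hrow v w hv fun hwv => by rw [hwv] at hv; exact lt_irrefl _ hv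
  by_cases hloop : ∃ l, Γ.src l = w ∧ Γ.rng l = w
  · obtain ⟨l, hls, hlr⟩ := hloop
    -- All edges leaving `w` other than the loop end strictly above `w`, so for `r(g) ≤ w` only the
    -- loop contributes to `mul_star`. Hence the `q_{gl} q_{gl}*` are projections, and as `τ` makes
    -- their sum `1` they are mutually orthogonal.
    have hP : ∀ g, ρ (Γ.rng g) ≤ ρ w → q g l * star (q g l) = P (Γ.src g) w := by
      intro g hg
      rw [← h.mul_star w hw g]
      refine (Finset.sum_eq_single (s := Finset.univ.filter fun e => Γ.src e = w)
        (f := fun e => q g e * star (q g e)) l (fun e he hel => ?_) (fun hl => ?_)).symm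
      · have hes := (Finset.mem_filter.1 he).2
        have hne : Γ.rng e ≠ w := fun her => hel (hR e l (hes.trans hls.symm) (her.trans hlr.symm))
        have hlt : ρ w < ρ (Γ.rng e) :=
          lt_of_le_of_ne (hes ▸ hρ.mono e) (hρ.injective.ne hne.symm)
        rw [h.coeff_eq_zero_of_rng ((ih _ hlt).1 _ fun hge => ?_), zero_mul]
        rw [hge] at hg
        omega
      · exact (hl (Finset.mem_filter.2 ⟨Finset.mem_univ _, hls⟩)).elim
    have hQ : ∀ g, ρ w < ρ (Γ.rng g) → q g l = 0 := fun g hg =>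
      h.coeff_eq_zero_of_rng (hlr.symm ▸ hhigh _ hg)
    have hproj : ∀ g ∈ Finset.univ, IsStarProjection (q g l * star (q g l)) := by
      intro g _
      rcases le_or_gt (ρ (Γ.rng g)) (ρ w) with hg | hg
      · rw [hP g hg]
        exact h.proj _ _
      · rw [hQ g hg, zero_mul]
        exact IsStarProjection.zero B
    -- Ascending induction on `v` below `w`. If `v` carries a loop `m`, then `m` and the forward
    -- edge `g` give two orthogonal projections both equal to `P_{vw}`, which is therefore `0`.
    -- Otherwise every edge into `v` starts at a lower vertex, where the inner induction kills its
    -- coefficient, and `star_mul` gives `P_{vw} = 0`.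
    have hlow : ∀ n v, ρ v = n → ρ v < ρ w → P v w = 0 := by
      intro n
      induction n using Nat.strong_induction_on with
      | _ n ihn =>
      intro v hvn hv
      obtain ⟨g, hgs, hg1, hg2⟩ := hρ.step v w hv
      by_cases hvl : ∃ m, Γ.src m = v ∧ Γ.rng m = v
      · obtain ⟨m, hms, hmr⟩ := hvl
        have hne : m ≠ g := by
          rintro rfl
          rw [hmr] at hg1
          exact lt_irrefl _ hg1
        have h1 := IsStarProjection.mul_eq_zero_of_sum_eq_one hproj (h.tau_edge l)
          (Finset.mem_univ m) (Finset.mem_univ g) hne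
        rwa [hP m (by rw [hmr]; exact hv.le), hP g hg2, hms, hgs,
          (h.proj v w).isIdempotentElem.eq] at h1
      · have h1 := h.star_mul l v
        rw [hlr] at h1
        rw [← h1]
        refine Finset.sum_eq_zero fun m hm => ?_
        have hmr := (Finset.mem_filter.1 hm).2
        have hms : Γ.src m ≠ v := fun hms => hvl ⟨m, hms, hmr⟩
        have hlt : ρ (Γ.src m) < ρ v := by
          have h2 := hρ.mono m
          rw [hmr] at h2
          exact lt_of_le_of_ne h2 (hρ.injective.ne hms)
        have h3 : q m l = 0 := h.coeff_eq_zero_of_src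
          (by rw [hls]; exact ihn _ (hvn ▸ hlt) _ rfl (hlt.trans hv))
        rw [h3, mul_zero]
    have hoff : ∀ v, v ≠ w → P v w = 0 := fun v hv =>
      (lt_or_gt_of_ne (hρ.injective.ne hv)).elim (hlow _ v rfl) (hhigh v)
    refine ⟨hoff, ?_⟩
    have h1 := hP l (by rw [hlr])
    rw [hls] at h1
    rw [← h1, ← h.tau_edge l]
    refine (Finset.sum_eq_single (s := Finset.univ)
      (f := fun g => q g l * star (q g l)) l (fun g _ hgl => ?_) (fun he => (he (Finset.mem_univ _)).elim)).symm
    rcases eq_or_ne (Γ.src g) w with hgs | hgs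
    · have hne : Γ.rng g ≠ w := fun hgr => hgl (hR g l (hgs.trans hls.symm) (hgr.trans hlr.symm))
      rw [hQ g (lt_of_le_of_ne (hgs ▸ hρ.mono g) (hρ.injective.ne hne.symm)), zero_mul]
    · rw [h.coeff_eq_zero_of_src (by rw [hls]; exact hoff _ hgs), zero_mul]
  -- Without a loop, all edges leaving `w` end above `w`, so an edge `g` from a lower `v` with `r(g)
  -- ≤ w` has `q_{ge} = 0` for each of them. On the diagonal, an edge `e` from `w` leaves a single
  -- term in both `mul_star` and `tau_edge`, namely `q_{ee} q_{ee}*`; comparing them gives `P_{ww} =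
  -- 1`.
  · have hgt : ∀ e, Γ.src e = w → ρ w < ρ (Γ.rng e) := fun e he =>
      lt_of_le_of_ne (he ▸ hρ.mono e) (hρ.injective.ne fun h1 => hloop ⟨e, he, h1.symm⟩)
    have hoff : ∀ v, v ≠ w → P v w = 0 := by
      intro v hv
      rcases lt_or_gt_of_ne (hρ.injective.ne hv) with hlt | hlt
      · obtain ⟨g, rfl, -, hg⟩ := hρ.step v w hlt
        rw [← h.mul_star w hw g]
        refine Finset.sum_eq_zero fun e he => ?_
        have hlt := hgt e (Finset.mem_filter.1 he).2
        rw [h.coeff_eq_zero_of_rng ((ih _ hlt).1 _ fun hge => ?_), zero_mul]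
        rw [hge] at hg
        omega
      · exact hhigh v hlt
    refine ⟨hoff, ?_⟩
    obtain ⟨e, he⟩ := hw
    have h1 := h.mul_star w ⟨e, he⟩ e
    rw [he] at h1
    rw [← h1, ← h.tau_edge e]
    refine (Finset.sum_eq_single (s := Finset.univ.filter fun e => Γ.src e = w)
      (f := fun e' => q e e' * star (q e e')) e (fun e' he' hne => ?_) (fun hl => ?_)).trans
      (Finset.sum_eq_single (s := Finset.univ)
      (f := fun g => q g e * star (q g e)) e (fun g _ hge => ?_) (fun he => (he (Finset.mem_univ _)).elim)).symm
    · have hs' := (Finset.mem_filter.1 he').2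
      have hr : Γ.rng e ≠ Γ.rng e' := fun hr => hne (hR e' e (hs'.trans he.symm) hr.symm)
      rw [h.coeff_eq_zero_of_rng ((ih _ (hgt e' hs')).1 _ hr), zero_mul]
    · exact (hl (Finset.mem_filter.2 ⟨Finset.mem_univ _, he⟩)).elim
    · rcases eq_or_ne (Γ.src g) w with hgs | hgs
      · have hr : Γ.rng g ≠ Γ.rng e := fun hr => hge (hR g e (hgs.trans he.symm) hr)
        rw [h.coeff_eq_zero_of_rng ((ih _ (hgt e he)).1 _ hr), zero_mul]
      · rw [h.coeff_eq_zero_of_src (by rw [he]; exact hoff _ hgs), zero_mul]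

/-- The coefficient matrix of a linear action preserving `τ` is diagonal, with unitaries on the
diagonal. -/
theorem diagonal (h : LinTauRelations Γ q P) {ρ : V → ℕ} (hρ : Γ.IsPathRank ρ)
    (hR : ∀ e f, Γ.src e = Γ.src f → Γ.rng e = Γ.rng f → e = f) :
    (∀ g e, g ≠ e → q g e = 0) ∧ (∀ e, star (q e e) * q e e = 1) ∧
      ∀ e, q e e * star (q e e) = 1 := by
  classical
  have hoff : ∀ g e, g ≠ e → q g e = 0 := by
    intro g e hge
    by_cases hr : Γ.rng g = Γ.rng e
    · exact h.coeff_eq_zero_of_src ((h.vertex hρ hR _).1 _ fun hs => hge (hR _ _ hs hr))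
    · exact h.coeff_eq_zero_of_rng ((h.vertex hρ hR _).1 _ hr)
  refine ⟨hoff, fun e => ?_, fun e => ?_⟩
  · have h1 := h.star_mul e (Γ.rng e)
    rw [(h.vertex hρ hR _).2] at h1
    rw [← h1]
    refine (Finset.sum_eq_single (s := Finset.univ.filter fun g => Γ.rng g = Γ.rng e)
      (f := fun g => star (q g e) * q g e) e (fun g _ hg => ?_) (fun he => ?_)).symm
    · rw [hoff g e hg, mul_zero]
    · exact (he (Finset.mem_filter.2 ⟨Finset.mem_univ _, rfl⟩)).elim
  · rw [← h.tau_edge e]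
    refine (Finset.sum_eq_single (s := Finset.univ)
      (f := fun g => q g e * star (q g e)) e (fun g _ hg => ?_) (fun he => (he (Finset.mem_univ _)).elim)).symm
    rw [hoff g e hg, zero_mul]

end LinTauRelations

end Rigidity

/-! ### A representation of the graph C*-algebra on `ℓ²(V × ℕ)` -/

section PartialShift

variable {X : Type u} {H : Type u} [NormedAddCommGroup H] [InnerProductSpace ℂ H]
  [CompleteSpace H] (b : HilbertBasis X ℂ H)

/-- The isometry `δ_n ↦ b (j n)`. -/
def basisIsometry (j : ℕ ↪ X) : lp (fun _ : ℕ => ℂ) 2 →L[ℂ] H :=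
  (b.orthonormal.comp j j.injective).orthogonalFamily.linearIsometry.toContinuousLinearMap

theorem basisIsometry_single (j : ℕ ↪ X) (n : ℕ) :
    basisIsometry b j (lp.single 2 n 1) = b (j n) := by
  refine ((b.orthonormal.comp j j.injective).orthogonalFamily.linearIsometry_apply_single
    (1 : ℂ)).trans ?_
  simp

theorem adjoint_basisIsometry_comp (j : ℕ ↪ X) :
    (basisIsometry b j).adjoint ∘L basisIsometry b j = ContinuousLinearMap.id ℂ _ := by
  refine ContinuousLinearMap.ext fun x => ext_inner_left ℂ fun y => ?_
  rw [ContinuousLinearMap.comp_apply, ContinuousLinearMap.adjoint_inner_right]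
  exact LinearIsometry.inner_map_map _ _ _

theorem adjoint_basisIsometry_apply_of_notMem (j : ℕ ↪ X) {x : X} (hx : x ∉ Set.range j) :
    (basisIsometry b j).adjoint (b x) = 0 := by
  refine ext_inner_right ℂ fun y => ?_
  rw [ContinuousLinearMap.adjoint_inner_left, inner_zero_left]
  have h := (innerSL ℂ (b x)).hasSum
    ((b.orthonormal.comp j j.injective).orthogonalFamily.hasSum_linearIsometry y)
  refine h.unique ?_
  convert hasSum_zero using 2 with n
  have h1 : inner ℂ (b x) (b (j n)) = 0 := b.orthonormal.2 fun hn => hx ⟨n, hn.symm⟩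
  simp [h1]

/-- The partial isometry with `b (k n) ↦ b (j n)` which vanishes on the other basis vectors. -/
def partialShift (j k : ℕ ↪ X) : H →L[ℂ] H :=
  basisIsometry b j ∘L (basisIsometry b k).adjoint

theorem star_partialShift (j k : ℕ ↪ X) : star (partialShift b j k) = partialShift b k j := by
  rw [partialShift, ContinuousLinearMap.star_eq_adjoint, ContinuousLinearMap.adjoint_comp,
    ContinuousLinearMap.adjoint_adjoint, partialShift]

theorem partialShift_mul (j k l : ℕ ↪ X) :
    partialShift b j k * partialShift b k l = partialShift b j l := by
  have h := adjoint_basisIsometry_comp b k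
  refine ContinuousLinearMap.ext fun x => ?_
  change basisIsometry b j (((basisIsometry b k).adjoint ∘L basisIsometry b k)
    ((basisIsometry b l).adjoint x)) = _
  rw [h]
  rfl

theorem partialShift_apply (j k : ℕ ↪ X) (n : ℕ) : partialShift b j k (b (k n)) = b (j n) := by
  rw [← basisIsometry_single b k, ← basisIsometry_single b j]
  have h := adjoint_basisIsometry_comp b k
  change basisIsometry b j (((basisIsometry b k).adjoint ∘L basisIsometry b k) _) = _
  rw [h]
  rfl

theorem partialShift_apply_of_notMem (j k : ℕ ↪ X) {x : X} (hx : x ∉ Set.range k) :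
    partialShift b j k (b x) = 0 := by
  change basisIsometry b j ((basisIsometry b k).adjoint (b x)) = 0
  rw [adjoint_basisIsometry_apply_of_notMem b k hx, map_zero]

open Classical in
theorem partialShift_self_apply (j : ℕ ↪ X) (x : X) :
    partialShift b j j (b x) = if x ∈ Set.range j then b x else 0 := by
  split_ifs with h
  · obtain ⟨n, rfl⟩ := h
    exact partialShift_apply b j j n
  · exact partialShift_apply_of_notMem b j j h

theorem HilbertBasis.clm_ext {S T : H →L[ℂ] H} (h : ∀ x, S (b x) = T (b x)) : S = T := by
  refine ContinuousLinearMap.ext_on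
    (Submodule.dense_iff_topologicalClosure_eq_top.2 b.dense_span) ?_
  rintro _ ⟨x, rfl⟩
  exact h x

end PartialShift

/-! ### A Cuntz-Krieger family of partial shifts and its separating vectors -/

section GraphRep

variable {V E : Type u} [Fintype V] [Fintype E] (Γ : DirectedGraph V E)

/-- A splitting of the vertices `(v, n)`, `n ∈ ℕ`, for `v` not a sink, into sequences indexed by
the edges with source `v`. -/
structure EdgeSplitting (Γ : DirectedGraph V E) where
  toFun : E → ℕ ↪ V × ℕ
  fst : ∀ e n, (toFun e n).1 = Γ.src e
  disjoint : ∀ e f n m, toFun e n = toFun f m → e = f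
  exists_eq : ∀ v n, (∃ e, Γ.src e = v) → ∃ e m, toFun e m = (v, n)

/-- For `v` not a sink, (edges leaving `v`) `× ℕ` is countably infinite, hence in bijection with
`ℕ`. -/
theorem EdgeSplitting.nonempty : Nonempty (EdgeSplitting Γ) := by
  have h : ∀ v, (∃ e, Γ.src e = v) → Nonempty ({e // Γ.src e = v} × ℕ ≃ ℕ) := fun v hv => by
    obtain ⟨e, he⟩ := hv
    have : Nonempty {e // Γ.src e = v} := ⟨⟨e, he⟩⟩
    exact nonempty_equiv_of_countable
  let ψ : ∀ v, (∃ e, Γ.src e = v) → ({e // Γ.src e = v} × ℕ ≃ ℕ) := fun v hv => (h v hv).some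
  -- Keeping `v` and `w` apart until `v = w` is substituted lets the bijections of two edges be
  -- compared although their domains depend on the source.
  have key : ∀ v w (hv : ∃ e, Γ.src e = v) (hw : ∃ e, Γ.src e = w) (e : {e // Γ.src e = v})
      (f : {e // Γ.src e = w}) (n m : ℕ), v = w → ψ v hv (e, n) = ψ w hw (f, m) →
      (e : E) = f ∧ n = m := by
    rintro v _ hv hw e f n m rfl h
    have h1 := (ψ v hv).injective h
    exact ⟨congrArg (fun x => (x.1 : E)) h1, congrArg Prod.snd h1⟩
  refine ⟨⟨fun e => ⟨fun n => (Γ.src e, ψ _ ⟨e, rfl⟩ (⟨e, rfl⟩, n)), fun n m h => ?_⟩,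
    fun e n => rfl, fun e f n m h => ?_, fun v n hv => ?_⟩⟩
  · exact (key _ _ ⟨e, rfl⟩ ⟨e, rfl⟩ _ _ _ _ rfl (congrArg Prod.snd h)).2
  · exact (key _ _ ⟨e, rfl⟩ ⟨f, rfl⟩ _ _ _ _ (congrArg Prod.fst h) (congrArg Prod.snd h)).1
  · obtain ⟨⟨⟨e, rfl⟩, m⟩, hx⟩ := (ψ v hv).surjective n
    exact ⟨e, m, Prod.ext rfl hx⟩

/-- The sequence `n ↦ (v, n)`. -/
def vertexSequence (v : V) : ℕ ↪ V × ℕ := ⟨fun n => (v, n), Prod.mk_right_injective v⟩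

theorem mem_range_vertexSequence {v : V} {x : V × ℕ} :
    x ∈ Set.range (vertexSequence v) ↔ x.1 = v :=
  ⟨by rintro ⟨n, rfl⟩; rfl, fun h => ⟨x.2, Prod.ext h.symm rfl⟩⟩

variable {Γ} {H : Type u} [NormedAddCommGroup H] [InnerProductSpace ℂ H]
  [CompleteSpace H] (b : HilbertBasis (V × ℕ) ℂ H)

/-- `S_e` maps the sequence of `r(e)` onto the part of the sequence of `s(e)` reserved for `e`.
These parts partition the sequence of each vertex which is not a sink, which is the relation `p_v =
∑ S_f S_f*`. -/
theorem EdgeSplitting.isCuntzKriegerFamily (ι : EdgeSplitting Γ) : IsCuntzKriegerFamily Γ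
    (fun e => partialShift b (ι.toFun e) (vertexSequence (Γ.rng e)))
    (fun v => partialShift b (vertexSequence v) (vertexSequence v)) := by
  classical
  refine ⟨fun e => ?_, fun v => ?_, fun v => ?_, fun v w hvw => ?_, ?_, fun e => ?_, fun v hv => ?_⟩
  · rw [star_partialShift, partialShift_mul, partialShift_mul]
  · exact partialShift_mul b _ _ _
  · exact star_partialShift b _ _
  · refine b.clm_ext fun x => ?_
    rw [mul_apply_eq_comp, partialShift_self_apply, zero_apply]
    split_ifs with h
    · rw [partialShift_self_apply, if_neg]
      rw [mem_range_vertexSequence] at h ⊢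
      exact fun h' => hvw (h'.symm.trans h)
    · exact map_zero _
  · refine b.clm_ext fun x => ?_
    rw [sum_apply, Finset.sum_eq_single x.1 (fun v _ hv => ?_) (by simp)]
    · rw [partialShift_self_apply, if_pos (mem_range_vertexSequence.2 rfl)]
      rfl
    · exact partialShift_apply_of_notMem b _ _
        (fun h => hv (mem_range_vertexSequence.1 h).symm)
  · rw [star_partialShift, partialShift_mul]
  · refine b.clm_ext fun x => ?_
    simp only [star_partialShift, partialShift_mul]
    rw [sum_apply]
    by_cases hx : x.1 = v
    · obtain ⟨e, m, hem⟩ := ι.exists_eq v x.2 hv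
      replace hem : ι.toFun e m = x := hem.trans (Prod.ext hx.symm rfl)
      have he : Γ.src e = v := by rw [← ι.fst e m, hem, hx]
      rw [partialShift_self_apply, if_pos (mem_range_vertexSequence.2 hx),
        Finset.sum_eq_single e (fun f _ hf => ?_) (fun h => ?_)]
      · rw [partialShift_self_apply, if_pos ⟨m, hem⟩]
      · refine partialShift_apply_of_notMem b _ _ ?_
        rintro ⟨n, hn⟩
        exact hf (ι.disjoint _ _ _ _ (hn.trans hem.symm))
      · exact (h (Finset.mem_filter.2 ⟨Finset.mem_univ _, he⟩)).elim
    · rw [partialShift_apply_of_notMem b _ _ (fun h => hx (mem_range_vertexSequence.1 h))]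
      refine (Finset.sum_eq_zero fun e he => ?_).symm
      refine partialShift_apply_of_notMem b _ _ ?_
      rintro ⟨n, rfl⟩
      exact hx ((ι.fst e n).trans (Finset.mem_filter.1 he).2)

open Classical in
/-- A representation of the graph C*-algebra with vectors `ξ e`, `ζ v` whose matrix coefficients
separate the vertex projections, the generating partial isometries and the `S_e S_f*`. -/
structure SeparatingRep (Γ : DirectedGraph V E) where
  H : Type u
  [normedAddCommGroup : NormedAddCommGroup H]
  [innerProductSpace : InnerProductSpace ℂ H]
  [completeSpace : CompleteSpace H]
  π : GraphCStarAlgebra Γ →⋆ₐ[ℂ] (H →L[ℂ] H)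
  ξ : E → H
  ζ : V → H
  vertex_p : ∀ v w, inner ℂ (ζ v) (π (GraphCStarAlgebra.p Γ w) (ζ v)) = if v = w then (1 : ℂ) else 0
  sink_S : ∀ u, (¬ ∃ e, Γ.src e = u) → ∀ e f, inner ℂ (ζ u)
    (π (GraphCStarAlgebra.S Γ e * star (GraphCStarAlgebra.S Γ f)) (ζ u)) = (0 : ℂ)
  edge_p : ∀ g v, inner ℂ (ξ g) (π (GraphCStarAlgebra.p Γ v) (ξ g)) =
    if Γ.src g = v then (1 : ℂ) else 0
  edge_S : ∀ g e f, inner ℂ (ξ g)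
    (π (GraphCStarAlgebra.S Γ e * star (GraphCStarAlgebra.S Γ f)) (ξ g)) =
      if e = g ∧ f = g then (1 : ℂ) else 0
  apply_S : ∀ e f, inner ℂ (ξ e) (π (GraphCStarAlgebra.S Γ f) (ζ (Γ.rng e))) =
    if f = e then (1 : ℂ) else 0

attribute [instance] SeparatingRep.normedAddCommGroup SeparatingRep.innerProductSpace
  SeparatingRep.completeSpace

/-- With `ζ_v = δ_{(v,0)}` and `ξ_e = S_e ζ_{r(e)}`, one has `S_f* ξ_g = 0` unless `f = g`, and
`S_g* ξ_g = ζ_{r(g)}`. For a sink `u`, `ζ_u` lies in the range of no `S_f`, so every `S_f*` kills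
it. -/
theorem SeparatingRep.nonempty (Γ : DirectedGraph V E) : Nonempty (SeparatingRep Γ) := by
  classical
  obtain ⟨ι⟩ := EdgeSplitting.nonempty Γ
  let b : HilbertBasis (V × ℕ) ℂ (lp (fun _ : V × ℕ => ℂ) 2) := ⟨LinearIsometryEquiv.refl ℂ _⟩
  let π := GraphCStarAlgebra.lift (ι.isCuntzKriegerFamily b)
  have hp : ∀ v, π (GraphCStarAlgebra.p Γ v) =
    partialShift b (vertexSequence v) (vertexSequence v) := fun v => GraphCStarAlgebra.lift_p _ _ v
  have hS : ∀ e, π (GraphCStarAlgebra.S Γ e) =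
    partialShift b (ι.toFun e) (vertexSequence (Γ.rng e)) := fun v => GraphCStarAlgebra.lift_S _ _ v
  have hSS : ∀ e f x, π (GraphCStarAlgebra.S Γ e * star (GraphCStarAlgebra.S Γ f)) x =
      partialShift b (ι.toFun e) (vertexSequence (Γ.rng e))
        (partialShift b (vertexSequence (Γ.rng f)) (ι.toFun f) x) := fun e f x => by
    rw [map_mul, map_star, hS, hS, star_partialShift]
    rfl
  have hb : ∀ x y, inner ℂ (b x) (b y) = if x = y then (1 : ℂ) else 0 :=
    orthonormal_iff_ite.1 b.orthonormal
  have hpx : ∀ x v, inner ℂ (b x) (π (GraphCStarAlgebra.p Γ v) (b x)) =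
      if x.1 = v then (1 : ℂ) else 0 := fun x v => by
    rw [hp, partialShift_self_apply, mem_range_vertexSequence]
    split_ifs
    · rw [hb, if_pos rfl]
    · exact inner_zero_right _
  have hSx : ∀ e f n, inner ℂ (b (ι.toFun e 0)) (partialShift b (ι.toFun f)
      (vertexSequence (Γ.rng f)) (b (Γ.rng e, n))) = if f = e ∧ n = 0 then (1 : ℂ) else 0 := by
    intro e f n
    by_cases hr : Γ.rng e = Γ.rng f
    · rw [hr]
      have h1 : partialShift b (ι.toFun f) (vertexSequence (Γ.rng f)) (b (Γ.rng f, n)) =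
        b (ι.toFun f n) := partialShift_apply b _ _ n
      rw [h1, hb]
      refine if_congr ⟨fun h => ?_, ?_⟩ rfl rfl
      · obtain rfl := ι.disjoint _ _ _ _ h
        exact ⟨rfl, ((ι.toFun e).injective h).symm⟩
      · rintro ⟨rfl, rfl⟩
        rfl
    · rw [partialShift_apply_of_notMem, inner_zero_right, if_neg]
      · rintro ⟨rfl, -⟩
        exact hr rfl
      · exact fun h => hr (mem_range_vertexSequence.1 h)
  refine ⟨⟨_, π, fun e => b (ι.toFun e 0), fun v => b (v, 0), fun v w => hpx _ w,
    fun u hu e f => ?_, fun g v => ?_, fun g e f => ?_, fun e f => ?_⟩⟩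
  · rw [hSS, partialShift_apply_of_notMem b (vertexSequence (Γ.rng f)), map_zero, inner_zero_right]
    rintro ⟨n, hn⟩
    exact hu ⟨f, by rw [← ι.fst f n, hn]⟩
  · rw [hpx, ι.fst]
  · rw [hSS]
    by_cases hf : f = g
    · subst hf
      have h1 : partialShift b (vertexSequence (Γ.rng f)) (ι.toFun f) (b (ι.toFun f 0)) =
        b (Γ.rng f, 0) := partialShift_apply b _ _ 0
      rw [h1, hSx]
      simp
    · have h1 : partialShift b (vertexSequence (Γ.rng f)) (ι.toFun f) (b (ι.toFun g 0)) = 0 := by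
        refine partialShift_apply_of_notMem b _ _ ?_
        rintro ⟨n, hn⟩
        exact hf (ι.disjoint _ _ _ _ hn)
      rw [h1, ContinuousLinearMap.map_zero, inner_zero_right, if_neg (fun h => hf h.2)]
  · rw [hS, hSx]
    simp

end GraphRep

/-! ### Relations in Cuntz-Krieger families -/

section CuntzKrieger

variable {V E : Type u} [Fintype V] [Fintype E] {Γ : DirectedGraph V E} {B : Type u}
  [CStarAlgebra B] {S : E → B} {p : V → B}

theorem IsCuntzKriegerFamily.isStarProjection_p (h : IsCuntzKriegerFamily Γ S p) (v : V) :
    IsStarProjection (p v) := ⟨h.idempotent v, h.self_adjoint v⟩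

theorem IsCuntzKriegerFamily.isStarProjection_S (h : IsCuntzKriegerFamily Γ S p) (e : E) :
    IsStarProjection (S e * star (S e)) :=
  ⟨by rw [IsIdempotentElem, ← mul_assoc, h.partial_isometry], .mul_star_self _⟩

/-- Orthogonality of the ranges is not among the defining relations; it follows because the `S_e
S_e*`, together with the `p_v` at sinks, are projections with sum `1`. -/
theorem IsCuntzKriegerFamily.star_S_mul_S_of_ne (h : IsCuntzKriegerFamily Γ S p) {e f : E}
    (hef : e ≠ f) : star (S e) * S f = 0 := by
  classical
  -- A vertex which is not a sink contributes `0`, since its projection is already the sum of the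
  -- `S_e S_e*` over the edges leaving it.
  let r : E ⊕ V → B :=
    Sum.elim (fun e => S e * star (S e)) (fun v => if ∃ e, Γ.src e = v then 0 else p v)
  have hr : ∀ i ∈ Finset.univ, IsStarProjection (r i) := by
    rintro (e | v) -
    · exact h.isStarProjection_S e
    · change IsStarProjection (if ∃ e, Γ.src e = v then 0 else p v)
      split_ifs
      · exact IsStarProjection.zero B
      · exact h.isStarProjection_p v
  have hsum : ∑ i, r i = 1 := by
    rw [Fintype.sum_sum_type, ← h.sum_eq_one]
    change ∑ e, S e * star (S e) + ∑ v, (if ∃ e, Γ.src e = v then 0 else p v) = _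
    rw [← Finset.sum_fiberwise Finset.univ Γ.src, ← Finset.sum_add_distrib]
    refine Finset.sum_congr rfl fun v _ => ?_
    split_ifs with hv
    · rw [add_zero, h.sum_mul_star v hv]
    · rw [Finset.sum_eq_zero, zero_add]
      exact fun e he => (hv ⟨e, (Finset.mem_filter.1 he).2⟩).elim
  have h1 := IsStarProjection.mul_eq_zero_of_sum_eq_one hr hsum (Finset.mem_univ (.inl e))
    (Finset.mem_univ (.inl f)) (Sum.inl_injective.ne hef)
  have h2 : ∀ e, star (S e) * (S e * star (S e)) = star (S e) := fun e => by
    rw [← star_star (S e), ← star_mul, ← star_mul, star_star, h.partial_isometry]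
  calc star (S e) * S f = star (S e) * (S e * star (S e)) * (S f * star (S f) * S f) := by
        rw [h2, h.partial_isometry]
    _ = star (S e) * ((S e * star (S e)) * (S f * star (S f))) * S f := by
        simp only [mul_assoc]
    _ = 0 := by
        change (S e * star (S e)) * (S f * star (S f)) = 0 at h1
        rw [h1, mul_zero, zero_mul]

end CuntzKrieger

/-! ### `τ` as a slice map, and the coefficients of actions preserving `τ` -/

namespace MinTensor

variable {A B : Type u} [CStarAlgebra A] [CStarAlgebra B]

theorem tmul_sum {ι : Type*} (s : Finset ι) (a : A) (b : ι → B) :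
    tmul a (∑ i ∈ s, b i) = ∑ i ∈ s, tmul a (b i) := map_sum (tmulCLM a) b s

theorem sum_tmul {ι : Type*} (s : Finset ι) (a : ι → A) (b : B) :
    tmul (∑ i ∈ s, a i) b = ∑ i ∈ s, tmul (a i) b :=
  map_sum ((tmulCLM (A := A) (B := B)).flip b) a s

theorem tmul_sub (a : A) (b c : B) : tmul a (b - c) = tmul a b - tmul a c :=
  map_sub (tmulCLM a) b c

@[simp] theorem tmul_zero (a : A) : tmul a (0 : B) = 0 := map_zero (tmulCLM a)

@[simp] theorem zero_tmul (b : B) : tmul (0 : A) b = 0 :=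
  map_zero ((tmulCLM (A := A) (B := B)).flip b)

end MinTensor

section Coefficients

open MinTensor

variable {V E : Type u} [Fintype V] [Fintype E] {Γ : DirectedGraph V E} (R : SeparatingRep Γ)
  {Q : Type u} [CStarAlgebra Q]

namespace SeparatingRep

open Classical in
/-- An extension of `τ` to the graph C*-algebra. -/
def tau : GraphCStarAlgebra Γ →L[ℂ] ℂ :=
  ∑ g, vectorFunctional R.π (R.ξ g) (R.ξ g) +
    ∑ u with ¬ ∃ e, Γ.src e = u, vectorFunctional R.π (R.ζ u) (R.ζ u)

open Classical in
/-- The slice map `τ ⊗ id`. -/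
def tauSlice : MinTensor (GraphCStarAlgebra Γ) Q →L[ℂ] Q :=
  ∑ g, slice R.π (R.ξ g) (R.ξ g) + ∑ u with ¬ ∃ e, Γ.src e = u, slice R.π (R.ζ u) (R.ζ u)

theorem tauSlice_tmul (a : GraphCStarAlgebra Γ) (b : Q) :
    R.tauSlice (tmul a b) = R.tau a • b := by
  simp only [tauSlice, tau, add_apply, sum_apply, slice_tmul, vectorFunctional_apply, add_smul,
    Finset.sum_smul]

open Classical in
theorem tau_S (e f : E) : R.tau (GraphCStarAlgebra.S Γ e * star (GraphCStarAlgebra.S Γ f)) =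
    if e = f then 1 else 0 := by
  simp only [tau, add_apply, sum_apply, vectorFunctional_apply, R.edge_S]
  rw [Finset.sum_eq_zero (s := Finset.univ.filter _)
    (fun u hu => R.sink_S u (Finset.mem_filter.1 hu).2 e f), add_zero]
  split_ifs with h
  · subst h
    simp
  · exact Finset.sum_eq_zero fun g _ => if_neg fun h' => h (h'.1.trans h'.2.symm)

theorem tau_p {u : V} (hu : ¬ ∃ e, Γ.src e = u) : R.tau (GraphCStarAlgebra.p Γ u) = 1 := by
  classical
  simp only [tau, add_apply, sum_apply, vectorFunctional_apply, R.edge_p, R.vertex_p]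
  rw [Finset.sum_eq_zero fun g _ => if_neg fun h => hu ⟨g, h⟩, zero_add, Finset.sum_eq_single u]
  · exact if_pos rfl
  · exact fun v _ hv => if_neg hv
  · exact fun h => (h (Finset.mem_filter.2 ⟨Finset.mem_univ _, hu⟩)).elim

/-- `τ` on `V_{2,+}`. -/
def tauV2plus : V2plus Γ →ₗ[ℂ] ℂ := R.tau.toLinearMap ∘ₗ (V2plus Γ).subtype

theorem isTau_tauV2plus : IsTau R.tauV2plus := by
  classical
  refine ⟨fun x e hx => ?_, fun x e f _ hef hx => ?_, fun x u hu hx => ?_⟩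
  · change R.tau x = 1
    rw [hx, tau_S, if_pos rfl]
  · change R.tau x = 0
    rw [hx, tau_S, if_neg hef]
  · change R.tau x = 1
    rw [hx, tau_p R hu]

/-- `IsTau` fixes the values on a spanning set, so any such functional is the restriction of the
bounded functional `R.tau`, to which slice maps apply. -/
theorem eq_tauV2plus {τ : V2plus Γ →ₗ[ℂ] ℂ} (h : IsTau τ) : τ = R.tauV2plus := by
  have h' := R.isTau_tauV2plus
  refine LinearMap.ext fun ⟨x, hx⟩ => ?_
  induction hx using Submodule.span_induction with
  | mem x hx =>
    rcases hx with ⟨u, hu, rfl⟩ | ⟨e, f, hef, rfl⟩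
    · rw [h.apply_p _ u hu rfl, h'.apply_p _ u hu rfl]
    · by_cases hne : e = f
      · subst hne
        rw [h.apply_self _ e rfl, h'.apply_self _ e rfl]
      · rw [h.apply_ne _ e f hef hne rfl, h'.apply_ne _ e f hef hne rfl]
  | zero => exact (map_zero τ).trans (map_zero _).symm
  | add x y hx hy h1 h2 =>
    have h3 := congrArg₂ (· + ·) h1 h2
    simp only [← map_add] at h3
    exact h3
  | smul c x hx h1 =>
    have h3 := congrArg (c • ·) h1
    simp only [← map_smul] at h3
    exact h3

theorem tauSlice_of_preservesTau {U : QuantumTransformationGroup (GraphCStarAlgebra Γ)}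
    (h : PreservesTau U) {x : GraphCStarAlgebra Γ} (hx : x ∈ V2plus Γ) :
    R.tauSlice (U.action x) = R.tau x • (1 : U.cqg.carrier) := by
  obtain ⟨τ, hτ, h⟩ := h
  rw [R.eq_tauV2plus hτ] at h
  obtain ⟨t, ht1, ht2⟩ := h ⟨x, hx⟩
  refine Eq.trans ?_ ht2
  rw [← ht1]
  clear ht1 ht2
  induction t with
  | zero => simp
  | add s t hs ht => simp only [map_add, hs, ht]
  | tmul y b =>
    rw [TensorProduct.map_tmul, TensorProduct.map_tmul, TensorProduct.lid_tmul]
    exact R.tauSlice_tmul _ _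

/-- The slice map `θ ⊗ id` for the vector functional of `ζ v`. -/
theorem slice_vertex (v : V) (X : V → Q) :
    slice R.π (R.ζ v) (R.ζ v) (∑ w, tmul (GraphCStarAlgebra.p Γ w) (X w)) = X v := by
  classical
  rw [map_sum, Finset.sum_eq_single v (fun w _ hw => ?_) (by simp)]
  · rw [slice_tmul, R.vertex_p, if_pos rfl, one_smul]
  · rw [slice_tmul, R.vertex_p, if_neg hw.symm, zero_smul]

theorem slice_edge_vertex (g : E) (X : V → Q) :
    slice R.π (R.ξ g) (R.ξ g) (∑ w, tmul (GraphCStarAlgebra.p Γ w) (X w)) = X (Γ.src g) := by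
  classical
  rw [map_sum, Finset.sum_eq_single (Γ.src g) (fun w _ hw => ?_) (by simp)]
  · rw [slice_tmul, R.edge_p, if_pos rfl, one_smul]
  · rw [slice_tmul, R.edge_p, if_neg hw.symm, zero_smul]

/-- Among all products `S_e S_f*`, only `S_g S_g*` has a nonzero coefficient at `ξ_g`. -/
theorem slice_edge_edge (g : E) (X Y : E → Q) :
    slice R.π (R.ξ g) (R.ξ g) ((∑ e, tmul (GraphCStarAlgebra.S Γ e) (X e)) *
      star (∑ f, tmul (GraphCStarAlgebra.S Γ f) (Y f))) = X g * star (Y g) := by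
  classical
  rw [star_sum, Finset.sum_mul_sum]
  simp only [star_tmul, tmul_mul_tmul, map_sum, slice_tmul, R.edge_S]
  rw [Finset.sum_eq_single g (fun e _ he => ?_) (by simp),
    Finset.sum_eq_single g (fun f _ hf => ?_) (by simp)]
  · rw [if_pos ⟨rfl, rfl⟩, one_smul]
  · rw [if_neg fun h => hf h.2, zero_smul]
  · exact Finset.sum_eq_zero fun f _ => by rw [if_neg fun h => he h.1, zero_smul]

theorem slice_sink_edge {u : V} (hu : ¬ ∃ e, Γ.src e = u) (X Y : E → Q) :
    slice R.π (R.ζ u) (R.ζ u) ((∑ e, tmul (GraphCStarAlgebra.S Γ e) (X e)) *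
      star (∑ f, tmul (GraphCStarAlgebra.S Γ f) (Y f))) = 0 := by
  rw [star_sum, Finset.sum_mul_sum]
  simp only [star_tmul, tmul_mul_tmul, map_sum, slice_tmul, R.sink_S u hu, zero_smul,
    Finset.sum_const_zero]

/-- Each relation is a Cuntz-Krieger relation, or invariance of `τ`, pushed through `α` and read off
by slicing: at `ζ_v` for the coefficient of `p_v`, at `ξ_g` for that of `S_g S_g*`. -/
theorem linTauRelations {ρ : V → ℕ} (hρ : Γ.IsPathRank ρ)
    (α : GraphCStarAlgebra Γ →⋆ₐ[ℂ] MinTensor (GraphCStarAlgebra Γ) Q) {q : E → E → Q}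
    (hq : ∀ e, α (GraphCStarAlgebra.S Γ e) = ∑ f, tmul (GraphCStarAlgebra.S Γ f) (q f e))
    (hτ : ∀ x ∈ V2plus Γ, R.tauSlice (α x) = R.tau x • (1 : Q)) :
    ∃ P : V → V → Q, LinTauRelations Γ q P ∧
      ∀ w, α (GraphCStarAlgebra.p Γ w) = ∑ v, tmul (GraphCStarAlgebra.p Γ v) (P v w) := by
  classical
  have hCK := GraphCStarAlgebra.isCuntzKriegerFamily Γ
  have hrng : ∀ e, α (GraphCStarAlgebra.p Γ (Γ.rng e)) = ∑ v, tmul (GraphCStarAlgebra.p Γ v)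
      (∑ g with Γ.rng g = v, star (q g e) * q g e) := by
    intro e
    rw [← hCK.star_mul_self, map_mul, map_star, hq, star_sum, Finset.sum_mul_sum]
    simp only [star_tmul, tmul_mul_tmul, tmul_sum]
    rw [← Finset.sum_fiberwise Finset.univ Γ.rng]
    refine Finset.sum_congr rfl fun v _ => Finset.sum_congr rfl fun g hg => ?_
    rw [Finset.sum_eq_single g (fun f _ hf => ?_) (by simp)]
    · rw [hCK.star_mul_self, (Finset.mem_filter.1 hg).2]
    · rw [hCK.star_S_mul_S_of_ne hf.symm, zero_tmul]
  have hone : (1 : MinTensor (GraphCStarAlgebra Γ) Q) =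
      ∑ v, tmul (GraphCStarAlgebra.p Γ v) 1 := by
    rw [← sum_tmul, hCK.sum_eq_one, one_eq]
  -- If `w = r(e)`, linearity describes `α(p_w) = α(S_e)* α(S_e)`. At most one vertex is not a
  -- range, and its projection is `1` minus all the others.
  have hex : ∀ w, ∃ X : V → Q,
      α (GraphCStarAlgebra.p Γ w) = ∑ v, tmul (GraphCStarAlgebra.p Γ v) (X v) := by
    obtain ⟨v₀, hv₀⟩ := hρ.range
    have hne : ∀ w, w ≠ v₀ → ∃ X : V → Q,
        α (GraphCStarAlgebra.p Γ w) = ∑ v, tmul (GraphCStarAlgebra.p Γ v) (X v) := by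
      intro w hw
      obtain ⟨e, rfl⟩ := hv₀ w hw
      exact ⟨_, hrng e⟩
    intro w
    rcases eq_or_ne w v₀ with rfl | hw
    · choose X hX using hne
      refine ⟨fun v => 1 - ∑ w' ∈ (Finset.univ.erase w).attach,
        X w' (Finset.ne_of_mem_erase w'.2) v, ?_⟩
      have h1 : α (GraphCStarAlgebra.p Γ w) = 1 - ∑ w' ∈ (Finset.univ.erase w).attach,
          α (GraphCStarAlgebra.p Γ w') := by
        rw [Finset.sum_attach (Finset.univ.erase w) fun w' => α (GraphCStarAlgebra.p Γ w'),
          eq_sub_iff_add_eq, Finset.add_sum_erase _ (fun w' => α (GraphCStarAlgebra.p Γ w'))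
            (Finset.mem_univ w), ← map_sum,
          hCK.sum_eq_one, map_one]
      rw [h1, hone]
      simp only [tmul_sub, tmul_sum, Finset.sum_sub_distrib]
      rw [Finset.sum_comm (s := Finset.univ)]
      exact congrArg _ (Finset.sum_congr rfl fun w' _ => hX _ _)
    · exact hne w hw
  choose P hP using hex
  have hinj : ∀ {X Y : V → Q}, ∑ v, tmul (GraphCStarAlgebra.p Γ v) (X v) =
      ∑ v, tmul (GraphCStarAlgebra.p Γ v) (Y v) → ∀ v, X v = Y v := fun h v => by
    have h1 := congrArg (slice R.π (R.ζ v) (R.ζ v)) h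
    rwa [R.slice_vertex, R.slice_vertex] at h1
  have hmul : ∀ w, α (GraphCStarAlgebra.p Γ w) = ∑ v, tmul (GraphCStarAlgebra.p Γ v)
      (P w v * P w v) := fun w => by
    rw [← hCK.idempotent w, map_mul, hP, Finset.sum_mul_sum]
    refine Finset.sum_congr rfl fun v _ => ?_
    rw [Finset.sum_eq_single v (fun v' _ hv' => ?_) (by simp)]
    · rw [tmul_mul_tmul, hCK.idempotent]
    · rw [tmul_mul_tmul, hCK.orthogonal _ _ hv'.symm, zero_tmul]
  have hstar : ∀ w, α (GraphCStarAlgebra.p Γ w) = ∑ v, tmul (GraphCStarAlgebra.p Γ v)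
      (star (P w v)) := fun w => by
    rw [← hCK.self_adjoint w, map_star, hP, star_sum]
    exact Finset.sum_congr rfl fun v _ => by rw [star_tmul, hCK.self_adjoint]
  have hsrc : ∀ w, (∃ e, Γ.src e = w) → α (GraphCStarAlgebra.p Γ w) =
      ∑ e with Γ.src e = w, (∑ f, tmul (GraphCStarAlgebra.S Γ f) (q f e)) *
        star (∑ f, tmul (GraphCStarAlgebra.S Γ f) (q f e)) := fun w hw => by
    rw [hCK.sum_mul_star w hw, map_sum]
    exact Finset.sum_congr rfl fun e _ => by rw [map_mul, map_star, hq]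
  refine ⟨fun v w => P w v, ⟨fun v w => ⟨?_, ?_⟩, fun v => ?_, fun e v => ?_, fun w hw g => ?_,
    fun u w hu hw => ?_, fun e => ?_, fun u hu => ?_⟩, hP⟩
  · exact hinj ((hmul w).symm.trans (hP w)) v
  · exact hinj ((hstar w).symm.trans (hP w)) v
  · refine hinj (X := fun v => ∑ w, P w v) (Y := fun _ => 1) ?_ v
    simp only [tmul_sum]
    rw [Finset.sum_comm, ← hone, ← map_one α, ← hCK.sum_eq_one, map_sum]
    exact Finset.sum_congr rfl fun w _ => (hP w).symm
  · exact hinj ((hrng e).symm.trans (hP _)) v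
  · rw [← R.slice_edge_vertex g (P w), ← hP, hsrc w hw, map_sum]
    exact Finset.sum_congr rfl fun e _ =>
      (R.slice_edge_edge g (fun f => q f e) (fun f => q f e)).symm
  · rw [← R.slice_vertex u (P w), ← hP, hsrc w hw, map_sum]
    exact Finset.sum_eq_zero fun e _ => R.slice_sink_edge hu _ _
  · have h1 := hτ (GraphCStarAlgebra.S Γ e * star (GraphCStarAlgebra.S Γ e))
      (Submodule.subset_span (Or.inr ⟨e, e, rfl, rfl⟩))
    rw [R.tau_S, if_pos rfl, one_smul, map_mul, map_star, hq] at h1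
    simp only [tauSlice, add_apply, sum_apply, R.slice_edge_edge] at h1
    rwa [Finset.sum_eq_zero (s := Finset.univ.filter _)
      (fun u hu => R.slice_sink_edge (Finset.mem_filter.1 hu).2 _ _), add_zero] at h1
  -- For `v` not a sink, `p_v = ∑ S_f S_f*` gives `τ(p_v)` equal to the number of edges leaving `v`,
  -- whence the sum over all edges in `tau_sink`.
  · have h1 := hτ (GraphCStarAlgebra.p Γ u) (Submodule.subset_span (Or.inl ⟨u, hu, rfl⟩))
    rw [R.tau_p hu, one_smul, hP] at h1
    simpa only [tauSlice, add_apply, sum_apply, R.slice_edge_vertex, R.slice_vertex] using h1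

end SeparatingRep

/-- A linear action preserving `τ` is diagonal, with unitary coefficients. -/
theorem exists_unitary_of_isLinTauObject {ρ : V → ℕ} (hρ : Γ.IsPathRank ρ) (hR : Γ.PropertyR)
    {U : QuantumTransformationGroup (GraphCStarAlgebra Γ)} (hU : IsLinTauObject Γ U) :
    ∃ u : E → U.cqg.carrier, (∀ e, star (u e) * u e = 1) ∧ (∀ e, u e * star (u e) = 1) ∧
      (∀ e, U.action (GraphCStarAlgebra.S Γ e) = tmul (GraphCStarAlgebra.S Γ e) (u e)) ∧
      ∀ v, U.action (GraphCStarAlgebra.p Γ v) = tmul (GraphCStarAlgebra.p Γ v) 1 := by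
  obtain ⟨⟨q, hq⟩, hτ⟩ := hU
  obtain ⟨R⟩ := SeparatingRep.nonempty Γ
  obtain ⟨P, hP, hp⟩ := R.linTauRelations hρ U.action hq
    (fun x hx => R.tauSlice_of_preservesTau hτ hx)
  obtain ⟨h0, h1, h2⟩ := hP.diagonal hρ hR.edge_unique
  refine ⟨fun e => q e e, h1, h2, fun e => ?_, fun v => ?_⟩
  · rw [hq, Finset.sum_eq_single e (fun f _ hf => ?_) (by simp)]
    rw [h0 f e hf, tmul_zero]
  · rw [hp, Finset.sum_eq_single v (fun w _ hw => ?_) (by simp), (hP.vertex hρ hR.edge_unique v).2]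
    rw [(hP.vertex hρ hR.edge_unique v).1 w hw, tmul_zero]

end Coefficients

/-! ### Uniqueness of `*`-homomorphisms on universal C*-algebras -/

theorem StarAlgHom.continuous_of_cstar {A B : Type u} [CStarAlgebra A] [CStarAlgebra B]
    (φ : A →⋆ₐ[ℂ] B) : Continuous φ :=
  AddMonoidHomClass.continuous_of_bound φ 1 (by simpa using NonUnitalStarAlgHom.norm_apply_le φ)

theorem FreeStarAlgebra.letter_inr {X : Type u} (x : X) :
    FreeStarAlgebra.letter (Sum.inr x) = star (FreeStarAlgebra.gen x) :=
  (FreeStarAlgebra.star_letter (Sum.inl x)).symm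

theorem FreeStarAlgebra.mem_of_gen_mem {X B : Type u} [CStarAlgebra B]
    (φ : FreeStarAlgebra X →⋆ₐ[ℂ] B) (S : StarSubalgebra ℂ B)
    (h : ∀ x, φ (FreeStarAlgebra.gen x) ∈ S) (a : FreeStarAlgebra X) : φ a ∈ S := by
  induction a using FreeStarAlgebra.induction_letters with
  | scalar r =>
    rw [AlgHomClass.commutes]
    exact S.algebraMap_mem r
  | letters y =>
    cases y with
    | inl x => exact h x
    | inr x =>
      rw [FreeStarAlgebra.letter_inr, map_star]
      exact star_mem (h x)
  | mul a b ha hb =>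
    rw [map_mul]
    exact mul_mem ha hb
  | add a b ha hb =>
    rw [map_add]
    exact add_mem ha hb

theorem UniversalCStarAlgebra.hom_ext {X B : Type u} [CStarAlgebra B]
    {R : Set (FreeStarAlgebra X)} {φ ψ : UniversalCStarAlgebra R →⋆ₐ[ℂ] B}
    (h : ∀ x, φ (of R x) = ψ (of R x)) : φ = ψ := by
  refine StarAlgHom.ext fun a => ?_
  refine (denseRange_mk R).induction_on a
    (isClosed_eq φ.continuous_of_cstar ψ.continuous_of_cstar) fun t => ?_
  exact FreeStarAlgebra.mem_of_gen_mem (mk R) (StarAlgHom.equalizer φ ψ) h t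

theorem CircleFreeProduct.hom_ext {I B : Type u} [CStarAlgebra B]
    {φ ψ : CircleFreeProduct I →⋆ₐ[ℂ] B} (h : ∀ i, φ (z i) = ψ (z i)) : φ = ψ :=
  UniversalCStarAlgebra.hom_ext h

section GraphAlgebra

variable {V E : Type u} [Fintype V] [Fintype E] {Γ : DirectedGraph V E}

namespace GraphCStarAlgebra

theorem hom_ext {B : Type u} [CStarAlgebra B] {φ ψ : GraphCStarAlgebra Γ →⋆ₐ[ℂ] B}
    (hS : ∀ e, φ (S Γ e) = ψ (S Γ e)) (hp : ∀ v, φ (p Γ v) = ψ (p Γ v)) : φ = ψ :=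
  UniversalCStarAlgebra.hom_ext (Sum.rec hS hp)

/-- A closed subspace containing `1` and stable under left multiplication by the generators and
their adjoints is everything. -/
theorem mem_of_mul_gen {T : Submodule ℂ (GraphCStarAlgebra Γ)}
    (hT : IsClosed (T : Set (GraphCStarAlgebra Γ))) (h1 : 1 ∈ T)
    (hS : ∀ e, ∀ a ∈ T, S Γ e * a ∈ T) (hS' : ∀ e, ∀ a ∈ T, star (S Γ e) * a ∈ T)
    (hp : ∀ v, ∀ a ∈ T, p Γ v * a ∈ T) (a : GraphCStarAlgebra Γ) : a ∈ T := by
  have key : ∀ x : FreeStarAlgebra (E ⊕ V), ∀ a ∈ T, mk Γ x * a ∈ T := by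
    intro x
    induction x using FreeStarAlgebra.induction_letters with
    | scalar r =>
      intro a ha
      rw [AlgHomClass.commutes, ← Algebra.smul_def]
      exact T.smul_mem r ha
    | letters y =>
      rcases y with (e | v) | (e | v)
      · exact hS e
      · exact hp v
      · rw [FreeStarAlgebra.letter_inr, map_star]
        exact hS' e
      · have h2 : mk Γ (FreeStarAlgebra.letter (Sum.inr (Sum.inr v))) = p Γ v := by
          rw [FreeStarAlgebra.letter_inr, map_star]
          exact (isCuntzKriegerFamily Γ).self_adjoint v
        rw [h2]
        exact hp v
    | mul x y hx hy =>
      intro a ha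
      rw [map_mul, mul_assoc]
      exact hx _ (hy a ha)
    | add x y hx hy =>
      intro a ha
      rw [map_add, add_mul]
      exact T.add_mem (hx a ha) (hy a ha)
  refine (UniversalCStarAlgebra.denseRange_mk {r | GraphRelator Γ r}).induction_on
    (p := fun a => a ∈ T) a hT (fun x => ?_)
  have h2 := key x 1 h1
  rwa [mul_one] at h2

end GraphCStarAlgebra

/-! ### The diagonal action of the free product of circles -/

open MinTensor

/-- The unitary cancels in both `S_e* S_e` and `S_e S_e*`, and every relation involves `S_e` only
through these or through `S_e S_e* S_e`. -/
theorem IsCuntzKriegerFamily.tmul_unitary {A Q : Type u} [CStarAlgebra A] [CStarAlgebra Q]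
    {S : E → A} {p : V → A} (h : IsCuntzKriegerFamily Γ S p) {u : E → Q}
    (h1 : ∀ e, star (u e) * u e = 1) (h2 : ∀ e, u e * star (u e) = 1) :
    IsCuntzKriegerFamily Γ (fun e => tmul (S e) (u e)) (fun v => tmul (p v) (1 : Q)) := by
  refine ⟨fun e => ?_, fun v => ?_, fun v => ?_, fun v w hvw => ?_, ?_, fun e => ?_, fun v hv => ?_⟩
  · rw [star_tmul, tmul_mul_tmul, tmul_mul_tmul, h.partial_isometry, h2, one_mul]
  · rw [tmul_mul_tmul, h.idempotent, one_mul]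
  · rw [star_tmul, h.self_adjoint, star_one]
  · rw [tmul_mul_tmul, h.orthogonal v w hvw, zero_tmul]
  · rw [← sum_tmul, h.sum_eq_one, one_eq]
  · rw [star_tmul, tmul_mul_tmul, h.star_mul_self, h1]
  · rw [h.sum_mul_star v hv, sum_tmul]
    exact Finset.sum_congr rfl fun e _ => by rw [star_tmul, tmul_mul_tmul, h2]

variable (Γ) in
/-- The diagonal action `S_e ↦ S_e ⊗ z_e` of the free product of circles on `C*(Γ)`. -/
def diagonalAction : GraphCStarAlgebra Γ →⋆ₐ[ℂ]
    MinTensor (GraphCStarAlgebra Γ) (CircleFreeProduct E) :=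
  GraphCStarAlgebra.lift ((GraphCStarAlgebra.isCuntzKriegerFamily Γ).tmul_unitary
    CircleFreeProduct.star_z_mul_z CircleFreeProduct.z_mul_star_z)

theorem diagonalAction_S (e : E) : diagonalAction Γ (GraphCStarAlgebra.S Γ e) =
    tmul (GraphCStarAlgebra.S Γ e) (CircleFreeProduct.z e) :=
  GraphCStarAlgebra.lift_S _ _ e

theorem diagonalAction_p (v : V) : diagonalAction Γ (GraphCStarAlgebra.p Γ v) =
    tmul (GraphCStarAlgebra.p Γ v) 1 :=
  GraphCStarAlgebra.lift_p _ _ v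

/-- An element which the diagonal action multiplies by a group-like unitary. -/
structure IsEigenvector (a : GraphCStarAlgebra Γ) (x : CircleFreeProduct E) : Prop where
  action : diagonalAction Γ a = tmul a x
  comul : CircleFreeProduct.comul x = tmul x x
  mul_star : x * star x = 1

theorem isEigenvector_S (e : E) : IsEigenvector (GraphCStarAlgebra.S Γ e) (CircleFreeProduct.z e) :=
  ⟨diagonalAction_S e, CircleFreeProduct.comul_z e, CircleFreeProduct.z_mul_star_z e⟩

theorem isEigenvector_star_S (e : E) :
    IsEigenvector (star (GraphCStarAlgebra.S Γ e)) (star (CircleFreeProduct.z e)) :=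
  ⟨by rw [map_star, diagonalAction_S, star_tmul], by
    rw [map_star, CircleFreeProduct.comul_z, star_tmul], by
    rw [star_star, CircleFreeProduct.star_z_mul_z]⟩

theorem isEigenvector_p (v : V) : IsEigenvector (GraphCStarAlgebra.p Γ v) 1 :=
  ⟨diagonalAction_p v, by rw [map_one, one_eq], by rw [star_one, one_mul]⟩

/-- All generators and their adjoints are eigenvectors, so closed linear conditions on `C*(Γ)` can
be verified one eigenvector factor at a time. -/
theorem mem_of_mul_eigenvector {T : Submodule ℂ (GraphCStarAlgebra Γ)}
    (hT : IsClosed (T : Set (GraphCStarAlgebra Γ))) (h1 : 1 ∈ T)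
    (h : ∀ a x, IsEigenvector a x → ∀ b ∈ T, a * b ∈ T) (a : GraphCStarAlgebra Γ) : a ∈ T :=
  GraphCStarAlgebra.mem_of_mul_gen hT h1 (fun e => h _ _ (isEigenvector_S e))
    (fun e => h _ _ (isEigenvector_star_S e)) (fun v => h _ _ (isEigenvector_p v)) a

/-- Left multiplication by a generating pair permutes elementary pairs among themselves and is
continuous. This is the only multiplicativity of the associator needed to check the coaction
identity. -/
theorem AssocEq.mul_left {A B C : Type u} [CStarAlgebra A] [CStarAlgebra B] [CStarAlgebra C]
    (a : A) (b : B) (c : C) {u : MinTensor (MinTensor A B) C} {v : MinTensor A (MinTensor B C)}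
    (h : AssocEq u v) : AssocEq (tmul (tmul a b) c * u) (tmul a (tmul b c) * v) := by
  let g : MinTensor (MinTensor A B) C × MinTensor A (MinTensor B C) :=
    (tmul (tmul a b) c, tmul a (tmul b c))
  have key : associatorGraph A B C ≤ (associatorGraph A B C).comap (LinearMap.mulLeft ℂ g) := by
    refine Submodule.topologicalClosure_minimal _ ?_
      ((Submodule.isClosed_topologicalClosure _).preimage (continuous_const_mul g))
    rw [Submodule.span_le]
    rintro _ ⟨⟨a', b', c'⟩, rfl⟩
    change (tmul (tmul a b) c * _, tmul a (tmul b c) * _) ∈ associatorGraph A B C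
    simp only [tmul_mul_tmul]
    exact Submodule.le_topologicalClosure _ (Submodule.subset_span ⟨(_, _, _), rfl⟩)
  exact key h

theorem diagonalAction_coaction (c : GraphCStarAlgebra Γ) :
    AssocEq (MinTensor.map (diagonalAction Γ) (StarAlgHom.id ℂ _) (diagonalAction Γ c))
      (MinTensor.map (StarAlgHom.id ℂ _) CircleFreeProduct.comul (diagonalAction Γ c)) := by
  set L := (MinTensor.map (diagonalAction Γ) (StarAlgHom.id ℂ (CircleFreeProduct E))).comp
    (diagonalAction Γ) with hL
  set R := (MinTensor.map (StarAlgHom.id ℂ (GraphCStarAlgebra Γ)) CircleFreeProduct.comul).comp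
    (diagonalAction Γ) with hR
  let D := associatorGraph (GraphCStarAlgebra Γ) (CircleFreeProduct E) (CircleFreeProduct E)
  have hD : IsClosed (D : Set (MinTensor (MinTensor (GraphCStarAlgebra Γ) (CircleFreeProduct E))
      (CircleFreeProduct E) × MinTensor (GraphCStarAlgebra Γ)
        (MinTensor (CircleFreeProduct E) (CircleFreeProduct E)))) :=
    Submodule.isClosed_topologicalClosure _
  let T : Submodule ℂ (GraphCStarAlgebra Γ) :=
    D.comap (L.toAlgHom.toLinearMap.prod R.toAlgHom.toLinearMap)
  have hT : ∀ x, x ∈ T ↔ (L x, R x) ∈ D := fun x => Iff.rfl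
  have : c ∈ T := by
    refine mem_of_mul_eigenvector
      (hD.preimage (L.continuous_of_cstar.prodMk R.continuous_of_cstar)) ?_ (fun a x h b hb => ?_) c
    · rw [hT, map_one, map_one, one_eq, one_eq, one_eq]
      exact Submodule.le_topologicalClosure _ (Submodule.subset_span ⟨(1, 1, 1), rfl⟩)
    · rw [hT] at hb ⊢
      have hl : L a = tmul (tmul a x) x := by
        rw [hL, StarAlgHom.comp_apply, h.action, map_tmul, h.action, StarAlgHom.coe_id, id_eq]
      have hr : R a = tmul a (tmul x x) := by
        rw [hR, StarAlgHom.comp_apply, h.action, map_tmul, h.comul, StarAlgHom.coe_id, id_eq]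
      rw [map_mul, map_mul, hl, hr]
      exact AssocEq.mul_left a x x hb
  exact this

theorem diagonalAction_dense_span : Dense (Submodule.span ℂ
    {y | ∃ (c : GraphCStarAlgebra Γ) (q : CircleFreeProduct E),
      y = diagonalAction Γ c * tmul 1 q} :
      Set (MinTensor (GraphCStarAlgebra Γ) (CircleFreeProduct E))) := by
  set M := Submodule.span ℂ {y | ∃ (c : GraphCStarAlgebra Γ) (q : CircleFreeProduct E),
    y = diagonalAction Γ c * tmul 1 q} with hM
  refine MinTensor.dense_of_tmul_mem M fun a => ?_
  let T : Submodule ℂ (GraphCStarAlgebra Γ) := ⨅ b, M.topologicalClosure.comap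
    (tmulCLM.flip b : GraphCStarAlgebra Γ →L[ℂ] MinTensor _ _).toLinearMap
  have hT : ∀ x, x ∈ T ↔ ∀ b, tmul x b ∈ M.topologicalClosure := fun x => by
    simp only [T, Submodule.mem_iInf]
    rfl
  refine (hT a).1 (mem_of_mul_eigenvector ?_ ?_ (fun a x h c hc => ?_) a)
  · have : (T : Set (GraphCStarAlgebra Γ)) = ⋂ b, (tmulCLM.flip b) ⁻¹'
        (M.topologicalClosure : Set (MinTensor (GraphCStarAlgebra Γ) (CircleFreeProduct E))) := by
      ext x
      rw [SetLike.mem_coe, hT, Set.mem_iInter]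
      rfl
    rw [this]
    exact isClosed_iInter fun b => M.isClosed_topologicalClosure.preimage (map_continuous _)
  · rw [hT]
    exact fun b => Submodule.le_topologicalClosure _
      (Submodule.subset_span ⟨1, b, by rw [map_one, one_mul]⟩)
  · rw [hT] at hc ⊢
    intro b
    -- Since `α(a) = a ⊗ x` with `x x* = 1`, the factor `x` is absorbed by replacing `b` with `x*
    -- b`.
    have h3 : tmul (a * c) b = diagonalAction Γ a * tmul c (star x * b) := by
      rw [h.action, tmul_mul_tmul, ← mul_assoc, h.mul_star, one_mul]
    rw [h3]
    refine Submodule.topologicalClosure_minimal (s := M)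
      (t := M.topologicalClosure.comap (LinearMap.mulLeft ℂ (diagonalAction Γ a))) (fun w hw => ?_)
      (M.isClosed_topologicalClosure.preimage (continuous_const_mul (diagonalAction Γ a))) (hc _)
    refine Submodule.le_topologicalClosure _ ?_
    change diagonalAction Γ a * w ∈ M
    induction hw using Submodule.span_induction with
    | mem w hw =>
      obtain ⟨c, b, rfl⟩ := hw
      exact Submodule.subset_span ⟨a * c, b, by rw [map_mul, mul_assoc]⟩
    | zero => rw [mul_zero]; exact Submodule.zero_mem _
    | add w w' _ _ hw hw' => rw [mul_add]; exact Submodule.add_mem _ hw hw'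
    | smul r w _ hw => rw [mul_smul_comm]; exact Submodule.smul_mem _ r hw

/-- Slicing `S_e ⊗ z_e` with the functional `⟨ξ_e, · ζ_{r(e)}⟩`, which is `1` at `S_e`, returns
`z_e`, and these generate. -/
theorem diagonalAction_faithful : Dense (StarAlgebra.adjoin ℂ
    {q | ∃ (θ : GraphCStarAlgebra Γ →L[ℂ] ℂ)
      (R : MinTensor (GraphCStarAlgebra Γ) (CircleFreeProduct E) →L[ℂ] CircleFreeProduct E),
      IsSliceMap θ R ∧ ∃ c, q = R (diagonalAction Γ c)} : Set (CircleFreeProduct E)) := by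
  classical
  obtain ⟨R⟩ := SeparatingRep.nonempty Γ
  refine CircleFreeProduct.denseRange_mk.mono ?_
  rintro _ ⟨t, rfl⟩
  refine FreeStarAlgebra.mem_of_gen_mem CircleFreeProduct.mk _ (fun e => ?_) t
  refine StarAlgebra.subset_adjoin ℂ _ ⟨_, _,
    isSliceMap_slice R.π (R.ξ e) (R.ζ (Γ.rng e)), GraphCStarAlgebra.S Γ e, ?_⟩
  rw [diagonalAction_S, slice_tmul, R.apply_S, if_pos rfl, one_smul]
  rfl

variable (Γ) in
/-- The free product of circles with its diagonal action on `C*(Γ)`. -/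
def diagonalQTG : QuantumTransformationGroup (GraphCStarAlgebra Γ) where
  cqg := circleFreeProductCQG E
  action := diagonalAction Γ
  coaction := diagonalAction_coaction
  dense_span := diagonalAction_dense_span
  faithful := diagonalAction_faithful

theorem isLinTauObject_diagonalQTG : IsLinTauObject Γ (diagonalQTG Γ) := by
  classical
  obtain ⟨R⟩ := SeparatingRep.nonempty Γ
  constructor
  · suffices h : ∃ q : E → E → CircleFreeProduct E, ∀ e, diagonalAction Γ
        (GraphCStarAlgebra.S Γ e) = ∑ f, tmul (GraphCStarAlgebra.S Γ f) (q f e) from h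
    refine ⟨fun f e => if f = e then CircleFreeProduct.z e else 0, fun e => ?_⟩
    rw [diagonalAction_S, Finset.sum_eq_single e (fun f _ hf => ?_) (by simp)]
    · beta_reduce
      rw [if_pos rfl]
    · beta_reduce
      rw [if_neg hf, tmul_zero]
  · refine ⟨R.tauV2plus, R.isTau_tauV2plus, fun ⟨x, hx⟩ => ?_⟩
    suffices h : ∃ t : V2plus Γ ⊗[ℂ] CircleFreeProduct E,
        MinTensor.ofAlgebraic _ _ (TensorProduct.map (V2plus Γ).subtype LinearMap.id t) =
          diagonalAction Γ x ∧
        TensorProduct.lid ℂ (CircleFreeProduct E)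
          (TensorProduct.map R.tauV2plus LinearMap.id t) = R.tau x • (1 : CircleFreeProduct E) from h
    induction hx using Submodule.span_induction with
    | mem x hx =>
      rcases hx with ⟨u, hu, rfl⟩ | ⟨e, f, hef, rfl⟩
      · have hmem : GraphCStarAlgebra.p Γ u ∈ V2plus Γ :=
          Submodule.subset_span (Or.inl ⟨u, hu, rfl⟩)
        refine ⟨(⟨_, hmem⟩ : V2plus Γ) ⊗ₜ 1, ?_, ?_⟩
        · rw [TensorProduct.map_tmul, diagonalAction_p]
          rfl
        · rw [TensorProduct.map_tmul, TensorProduct.lid_tmul]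
          rfl
      · have hmem : GraphCStarAlgebra.S Γ e * star (GraphCStarAlgebra.S Γ f) ∈ V2plus Γ :=
          Submodule.subset_span (Or.inr ⟨e, f, hef, rfl⟩)
        -- `α(S_e S_f*) = S_e S_f* ⊗ z_e z_f*`; `τ` kills it for `e ≠ f`, and for `e = f` the second
        -- factor is `1`.
        refine ⟨(⟨_, hmem⟩ : V2plus Γ) ⊗ₜ
          (CircleFreeProduct.z e * star (CircleFreeProduct.z f)), ?_, ?_⟩
        · rw [TensorProduct.map_tmul, map_mul (diagonalAction Γ), map_star (diagonalAction Γ),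
            diagonalAction_S, diagonalAction_S, star_tmul, tmul_mul_tmul]
          rfl
        · rw [TensorProduct.map_tmul, TensorProduct.lid_tmul]
          change R.tau (GraphCStarAlgebra.S Γ e * star (GraphCStarAlgebra.S Γ f)) •
            (CircleFreeProduct.z e * star (CircleFreeProduct.z f)) = _
          rw [R.tau_S]
          split_ifs with h
          · rw [h, CircleFreeProduct.z_mul_star_z]
          · rw [zero_smul, zero_smul]
    | zero => exact ⟨0, by simp only [map_zero], by simp only [map_zero, zero_smul]⟩
    | add x y hx hy h1 h2 =>
      obtain ⟨t, ht1, ht2⟩ := h1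
      obtain ⟨s, hs1, hs2⟩ := h2
      exact ⟨t + s, by simp only [map_add, ht1, hs1],
        by simp only [map_add, ht2, hs2, add_smul]⟩
    | smul c x hx h1 =>
      obtain ⟨t, ht1, ht2⟩ := h1
      exact ⟨c • t, by simp only [map_smul, ht1],
        by simp only [map_smul, ht2, smul_smul, smul_eq_mul]⟩

end GraphAlgebra

/-! ### The universal object -/

section Universal

open MinTensor

variable {V E : Type u} [Fintype V] [Fintype E] {Γ : DirectedGraph V E}

/-- The unitaries which determine a diagonal action are group-like. -/
theorem comul_eq_tmul_of_action {U : QuantumTransformationGroup (GraphCStarAlgebra Γ)} {e : E}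
    {u : U.cqg.carrier}
    (h : U.action (GraphCStarAlgebra.S Γ e) = tmul (GraphCStarAlgebra.S Γ e) u) :
    U.cqg.comul u = tmul u u := by
  classical
  obtain ⟨R⟩ := SeparatingRep.nonempty Γ
  have h1 := U.coaction (GraphCStarAlgebra.S Γ e)
  rw [h, map_tmul, map_tmul, h] at h1
  -- The coaction identity at `S_e` reads `(S_e ⊗ u) ⊗ u = S_e ⊗ Δ(u)` under the associator; the
  -- coefficient `1` of `S_e` between `ξ_e` and `ζ_{r(e)}` allows `S_e` to be cancelled.
  refine eq_tmul_of_assocEq h1 R.π (R.ξ e) (R.ζ (Γ.rng e)) ?_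
  rw [R.apply_S, if_pos rfl]
  exact one_ne_zero

theorem map_diagonalAction {Q : Type u} [CStarAlgebra Q]
    {α : GraphCStarAlgebra Γ →⋆ₐ[ℂ] MinTensor (GraphCStarAlgebra Γ) Q}
    {φ : CircleFreeProduct E →⋆ₐ[ℂ] Q}
    (hS : ∀ e, α (GraphCStarAlgebra.S Γ e) =
      tmul (GraphCStarAlgebra.S Γ e) (φ (CircleFreeProduct.z e)))
    (hp : ∀ v, α (GraphCStarAlgebra.p Γ v) = tmul (GraphCStarAlgebra.p Γ v) 1)
    (c : GraphCStarAlgebra Γ) :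
    MinTensor.map (StarAlgHom.id ℂ _) φ (diagonalAction Γ c) = α c := by
  have h : (MinTensor.map (StarAlgHom.id ℂ _) φ).comp (diagonalAction Γ) = α := by
    refine GraphCStarAlgebra.hom_ext (fun e => ?_) (fun v => ?_)
    · rw [StarAlgHom.comp_apply, diagonalAction_S, map_tmul, hS]
      rfl
    · rw [StarAlgHom.comp_apply, diagonalAction_p, map_tmul, hp, map_one]
      rfl
  exact DFunLike.congr_fun h c

/-- A slice map sends the image of `id ⊗ φ` into the range of `φ`. -/
theorem slice_map_mem_range {A B Q : Type u} [CStarAlgebra A] [CStarAlgebra B] [CStarAlgebra Q]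
    (φ : B →⋆ₐ[ℂ] Q) {θ : A →L[ℂ] ℂ} {R : MinTensor A Q →L[ℂ] Q} (hR : IsSliceMap θ R)
    (y : MinTensor A B) : R (MinTensor.map (StarAlgHom.id ℂ A) φ y) ∈ Set.range φ := by
  refine denseRange_ofAlgebraic.induction_on
    (p := fun y => R (MinTensor.map (StarAlgHom.id ℂ A) φ y) ∈ Set.range φ) y
    (φ.isClosed_range.preimage
      (R.continuous.comp (MinTensor.map (StarAlgHom.id ℂ A) φ).continuous_of_cstar)) fun t => ?_
  induction t with
  | zero => exact ⟨0, by simp only [map_zero]⟩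
  | add s t hs ht =>
    obtain ⟨x, hx⟩ := hs
    obtain ⟨y, hy⟩ := ht
    exact ⟨x + y, by simp only [map_add, hx, hy]⟩
  | tmul a b =>
    refine ⟨θ a • b, ?_⟩
    change _ = R (MinTensor.map (StarAlgHom.id ℂ A) φ (tmul a b))
    rw [map_tmul, hR, map_smul]
    rfl

/-- Every slice of the action of `U` lies in the range of `φ`, a `*`-subalgebra. Faithfulness makes
this range dense, and ranges of `*`-homomorphisms are closed. -/
theorem surjective_of_map_diagonalAction {U : QuantumTransformationGroup (GraphCStarAlgebra Γ)}
    {φ : CircleFreeProduct E →⋆ₐ[ℂ] U.cqg.carrier}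
    (h : ∀ c, MinTensor.map (StarAlgHom.id ℂ _) φ (diagonalAction Γ c) = U.action c) :
    Function.Surjective φ := by
  have h1 : StarAlgebra.adjoin ℂ {q | ∃ (θ : GraphCStarAlgebra Γ →L[ℂ] ℂ)
      (R : MinTensor (GraphCStarAlgebra Γ) U.cqg.carrier →L[ℂ] U.cqg.carrier),
      IsSliceMap θ R ∧ ∃ c, q = R (U.action c)} ≤ φ.range := by
    refine StarAlgebra.adjoin_le ?_
    rintro _ ⟨θ, R, hR, c, rfl⟩
    rw [← h]
    exact slice_map_mem_range φ hR _
  have h2 : Dense (Set.range φ) := U.faithful.mono h1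
  rw [← Set.range_eq_univ, ← φ.isClosed_range.closure_eq, h2.closure_eq]

theorem exists_morphism_of_isLinTauObject (hR : Γ.PropertyR)
    {U : QuantumTransformationGroup (GraphCStarAlgebra Γ)} (hU : IsLinTauObject Γ U) :
    ∃ φ : CircleFreeProduct E →⋆ₐ[ℂ] U.cqg.carrier,
      (∀ x, MinTensor.map φ φ (CircleFreeProduct.comul x) = U.cqg.comul (φ x)) ∧
      Function.Surjective φ ∧
      ∀ c, MinTensor.map (StarAlgHom.id ℂ _) φ (diagonalAction Γ c) = U.action c := by
  obtain ⟨ρ, hρ⟩ := hR.exists_isPathRank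
  obtain ⟨u, h1, h2, hS, hp⟩ := exists_unitary_of_isLinTauObject hρ hR hU
  let φ := CircleFreeProduct.lift u h1 h2
  have hz : ∀ e, φ (CircleFreeProduct.z e) = u e := CircleFreeProduct.lift_z u h1 h2
  have hφ := map_diagonalAction (φ := φ) (fun e => by rw [hz, hS]) hp
  refine ⟨φ, fun x => ?_, surjective_of_map_diagonalAction hφ, hφ⟩
  have h : (MinTensor.map φ φ).comp CircleFreeProduct.comul = U.cqg.comul.comp φ := by
    refine CircleFreeProduct.hom_ext fun e => ?_
    rw [StarAlgHom.comp_apply, StarAlgHom.comp_apply, CircleFreeProduct.comul_z, map_tmul, hz,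
      comul_eq_tmul_of_action (hS e)]
  exact DFunLike.congr_fun h x

theorem isUniversalObject_diagonalQTG (hR : Γ.PropertyR) :
    IsUniversalObject (IsLinTauObject Γ) (diagonalQTG Γ) :=
  ⟨isLinTauObject_diagonalQTG, fun _ hW => exists_morphism_of_isLinTauObject hR hW⟩

/-- A homomorphism over `C*(Γ)` to the free product of circles from the quantum group of a linear
action preserving `τ` is injective. -/
theorem injective_of_map_action (hR : Γ.PropertyR)
    {U : QuantumTransformationGroup (GraphCStarAlgebra Γ)} (hU : IsLinTauObject Γ U)
    {φ : U.cqg.carrier →⋆ₐ[ℂ] CircleFreeProduct E}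
    (h : ∀ c, MinTensor.map (StarAlgHom.id ℂ _) φ (U.action c) = diagonalAction Γ c) :
    Function.Injective φ := by
  classical
  obtain ⟨R⟩ := SeparatingRep.nonempty Γ
  obtain ⟨ψ, -, hψs, hψ⟩ := exists_morphism_of_isLinTauObject hR hU
  -- The composite is compatible with the diagonal action, so slicing at `S_e` shows that it fixes
  -- `z_e`. With `ψ` surjective, the left inverse `φ` of `ψ` is also a right inverse of it, hence
  -- injective.
  have hid : φ.comp ψ = StarAlgHom.id ℂ _ := by
    refine CircleFreeProduct.hom_ext fun e => ?_
    have h1 := h (GraphCStarAlgebra.S Γ e)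
    rw [← hψ, diagonalAction_S, map_tmul, map_tmul] at h1
    have h2 := congrArg (slice R.π (R.ξ e) (R.ζ (Γ.rng e))) h1
    rw [slice_tmul, slice_tmul] at h2
    change inner ℂ (R.ξ e) (R.π (GraphCStarAlgebra.S Γ e) (R.ζ (Γ.rng e))) •
      φ (ψ (CircleFreeProduct.z e)) = _ at h2
    rwa [R.apply_S, if_pos rfl, one_smul, one_smul] at h2
  have hinv : Function.LeftInverse φ ψ := fun x => DFunLike.congr_fun hid x
  exact (hinv.rightInverse_of_surjective hψs).injective

end Universal

end

theorem theorem4p1 {V E : Type u} [Fintype V] [Fintype E] (Γ : DirectedGraph V E)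
    (hconn : Γ.IsConnected) (hR : Γ.PropertyR) :
    (∃ U : QuantumTransformationGroup (GraphCStarAlgebra Γ),
      IsUniversalObject (IsLinTauObject Γ) U) ∧
    ∀ U : QuantumTransformationGroup (GraphCStarAlgebra Γ),
      IsUniversalObject (IsLinTauObject Γ) U →
        IsomorphicCQG U.cqg (circleFreeProductCQG E) := by
  refine ⟨⟨diagonalQTG Γ, isUniversalObject_diagonalQTG hR⟩, fun U hU => ?_⟩
  -- Universality of `U`, tested on the diagonal object, gives a surjective morphism onto the free
  -- product; rigidity of `U` itself makes it injective.
  obtain ⟨φ, hφ, hφs, hφa⟩ := hU.2 (diagonalQTG Γ) isLinTauObject_diagonalQTG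
  exact ⟨φ, hφ, injective_of_map_action hR hU.1 (φ := φ) hφa, hφs⟩
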